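/- Let $X=C_n$ be a primitive multiple curve of multiplicity $n\ge 1$ over an algebraically closed field $\mathbb K$: an irreducible Cohen–Macaulay scheme of finite type over $\mathbb K$ whose reduced subscheme $C=X_{\mathrm{red}}$ is a smooth projective curve, whose nilradical ideal sheaf $\mathcal N\subset\mathcal O_X$ is locally principal, and such that $n$ is the least natural number with $\mathcal N^n=0$. For $0\le i\le n$ let $C_i\subset X$ be the closed subscheme with ideal sheaf $\mathcal N^i$ (so $C_0=\emptyset$, $C_1=C$). A *generalized line bundle* on $X$ is a coherent sheaf $\mathcal F$ that is pure of dimension $1$ and satisfies $\mathcal F_\eta\cong\mathcal O_{X,\eta}$ at the generic point $\eta$ of $X$. For such $\mathcal F$ let $\mathcal T_{n-1}(\mathcal F)$ be the kernel of the canonical morphism $\mathcal F|_{C_{n-1}}\to(\mathcal F|_{C_{n-1}})^{\vee\vee}$, where $\mathcal E^\vee=\mathcal Hom_{\mathcal O_X}(\mathcal E,\mathcal O_X)$ (for $n=1$ it is $0$), and let $\operatorname{Supp}(\mathcal T_{n-1}(\mathcal F))$ be its schematic support, i.e. the closed subscheme of $X$ defined by its annihilator. A closed subscheme $Z\subset X$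 is *associated* to $\mathcal F$ if $Z$ has finite support, $Z\subset C_{n-1}$, the schematic intersection $Z\cap C$ equals $\operatorname{Supp}(\mathcal T_{n-1}(\mathcal F))$, and $\mathcal F\cong\mathcal I_{Z/X}\otimes\mathcal G$ for some line bundle $\mathcal G$ on $X$. We say that closed subschemes $Z,Z'$ of $X$ differ by a Cartier divisor if $Z'=Z+D$ for a (not necessarily effective) Cartier divisor $D$, i.e. $\mathcal I_{Z'/X}\cdot\mathcal I_{D_1}=\mathcal I_{Z/X}\cdot\mathcal I_{D_2}$ for some effective Cartier divisors $D_1,D_2$ on $X$ (with $D=D_2-D_1$). Two sheaves are locally isomorphic if every point of $X$ has an open neighbourhood on which they become isomorphic. Then: 1. Every generalized line bundle $\mathcal F$ on $X$ has an associated subscheme $Z$. 2. The subscheme $Z$ is unique up to adding a Cartier divisor: if $Z$ is associated to $\mathcal F$ and $Z'\subset X$ is any closed subscheme, then $\mathcal F\cong\mathcal I_{Z'/X}\otimes\mathcal G'$ for some line bundle $\mathcal G'$ if and only if $Z$ and $Z'$ differ by a Cartier divisor. 3. If $\mathcal F,\mathcal F'$ are locally isomorphic generalized line bundles, then any subscheme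 associated to $\mathcal F$ and any subscheme associated to $\mathcal F'$ differ by a Cartier divisor, and there is a line bundle $\mathcal E$ on $X$ with $\mathcal F\cong\mathcal F'\otimes\mathcal E$. 4. Equivalently, the group $\operatorname{Pic}(X)$ of isomorphism classes of line bundles (with $[\mathcal L][\mathcal L']=[\mathcal L\otimes\mathcal L']$) acts, by $[\mathcal L]\cdot[\mathcal F']=[\mathcal F'\otimes\mathcal L]$, on the set of isomorphism classes of generalized line bundles locally isomorphic to a given generalized line bundle $\mathcal F$, and this action is transitive. -/

import Mathlib

universe u

open CategoryTheory AlgebraicGeometry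

noncomputable section

namespace GLB

/-! ### Sheaves of modules on a scheme -/

/-- The structure sheaf `𝒪_X`, as a sheaf of modules over itself. -/
def structureSheaf (X : Scheme.{u}) : X.Modules := SheafOfModules.unit X.ringCatSheaf

/-- The tensor product `M ⊗ N` of two sheaves of `𝒪_X`-modules: the sheafification of the presheaf
`U ↦ Γ(M, U) ⊗ Γ(N, U)`. -/
def tensor {X : Scheme.{u}} (M N : X.Modules) : X.Modules :=
  (PresheafOfModules.sheafification (𝟙 X.ringCatSheaf.obj)).obj
    (PresheafOfModules.Monoidal.tensorObj (R := X.presheaf) M.val N.val)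

/-- The stalk of a sheaf of `𝒪_X`-modules at a point. -/
abbrev stalk {X : Scheme.{u}} (M : X.Modules) (x : X) : Type u :=
  ↑(TopCat.Presheaf.stalk M.presheaf x)

/-- The stalk of `M` at `x` is a module over the local ring `𝒪_{X,x}`. -/
instance {X : Scheme.{u}} (M : X.Modules) (x : X) : Module (X.presheaf.stalk x) (stalk M x) :=
  PresheafOfModules.instModuleCarrierStalkCommRingCatCarrierAbPresheafOpensCarrier
    (R := X.presheaf) M.val x

/-- `L` is a line bundle: it is locally isomorphic to the structure sheaf. -/
def IsLineBundle {X : Scheme.{u}} (L : X.Modules) : Prop :=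
  ∀ x : X, ∃ U : X.Opens, x ∈ U ∧
    Nonempty (L.restrict U.ι ≅ (structureSheaf X).restrict U.ι)

/-- `M` is coherent (on a locally Noetherian scheme): it is quasi-coherent and its sections over
every affine open form a finitely generated module. -/
def IsCoherent {X : Scheme.{u}} (M : X.Modules) : Prop :=
  SheafOfModules.IsQuasicoherent (R := X.ringCatSheaf) M ∧
    ∀ U : X.affineOpens, Module.Finite Γ(X, U.1) (M.presheaf.obj (.op U.1))

/-- The (set-theoretic) support of a sheaf of modules. -/
def support {X : Scheme.{u}} (M : X.Modules) : Set X := {x | Nontrivial (stalk M x)}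

/-- The dimension of a sheaf: the dimension of its support. -/
def dim {X : Scheme.{u}} (M : X.Modules) : WithBot ℕ∞ := topologicalKrullDim (support M)

/-- A pure (coherent) sheaf, where pure always means pure of dimension `1`. -/
structure IsPure {X : Scheme.{u}} (M : X.Modules) : Prop where
  coherent : IsCoherent M
  dim_eq : dim M = 1
  dim_sub : ∀ (G : X.Modules) (i : G ⟶ M), Mono i → IsCoherent G → ¬ Limits.IsZero G → dim G = 1

/-- A generalized line bundle: a pure sheaf whose stalk at the generic point `η` is isomorphic
to `𝒪_{X,η}`. -/
structure IsGeneralizedLineBundle {X : Scheme.{u}} [IrreducibleSpace X] (F : X.Modules) :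
    Prop where
  pure : IsPure F
  generic : Nonempty (stalk F (genericPoint X) ≃ₗ[X.presheaf.stalk (genericPoint X)]
    X.presheaf.stalk (genericPoint X))

/-- Two sheaves of modules are locally isomorphic if they become isomorphic on an open
neighbourhood of each point. -/
def LocallyIsomorphic {X : Scheme.{u}} (F F' : X.Modules) : Prop :=
  ∀ x : X, ∃ U : X.Opens, x ∈ U ∧ Nonempty (F.restrict U.ι ≅ F'.restrict U.ι)

/-! ### Primitive multiple curves -/

/-- A (Noetherian) local ring is Cohen-Macaulay if it has a regular sequence in its maximal ideal
whose length is the Krull dimension. -/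
def IsCohenMacaulayLocalRing (R : Type u) [CommRing R] : Prop :=
  ∃ rs : List R, RingTheory.Sequence.IsRegular R rs ∧ (rs.length : WithBot ℕ∞) = ringKrullDim R

attribute [local instance] MvPolynomial.gradedAlgebra

/-- The projective space `ℙ^m` over `K`. -/
abbrev projectiveSpace (K : Type u) [Field K] (m : ℕ) : Scheme.{u} :=
  Proj (MvPolynomial.homogeneousSubmodule (Fin (m + 1)) K)

/-- The structure morphism `ℙ^m ⟶ Spec K`. -/
def projectiveSpaceStr (K : Type u) [Field K] (m : ℕ) :
    projectiveSpace K m ⟶ Spec (CommRingCat.of K) :=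
  Proj.toSpecZero (MvPolynomial.homogeneousSubmodule (Fin (m + 1)) K) ≫
    Spec.map (CommRingCat.ofHom
      (algebraMap K (MvPolynomial.homogeneousSubmodule (Fin (m + 1)) K 0)))

/-- A `K`-scheme is projective if it admits a closed immersion over `K` into some `ℙ^m`. -/
def IsProjectiveOver (K : Type u) [Field K] {Y : Scheme.{u}}
    (f : Y ⟶ Spec (CommRingCat.of K)) : Prop :=
  ∃ (m : ℕ) (i : Y ⟶ projectiveSpace K m), IsClosedImmersion i ∧ i ≫ projectiveSpaceStr K m = f

/-- `X`, with structure morphism `f : X ⟶ Spec K`, is a primitive multiple curve of multiplicity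
`n` over the field `K`. Its reduced subscheme `C` is the closed subscheme cut out by the
nilradical. -/
structure IsPrimitiveMultipleCurve (K : Type u) [Field K] (X : Scheme.{u})
    (f : X ⟶ Spec (CommRingCat.of K)) (n : ℕ) : Prop where
  irreducible : IrreducibleSpace X
  locallyOfFiniteType : LocallyOfFiniteType f
  quasiCompact : QuasiCompact f
  cohenMacaulay : ∀ x : X, IsCohenMacaulayLocalRing (X.presheaf.stalk x)
  smooth : SmoothOfRelativeDimension 1 (X.nilradical.subschemeι ≫ f)
  projective : IsProjectiveOver K (X.nilradical.subschemeι ≫ f)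
  multiplicity : IsLeast {k : ℕ | X.nilradical ^ k = ⊥} n
  locally_principal : ∀ x : X, ∃ U : X.affineOpens, x ∈ U.1 ∧
    (X.nilradical.ideal U).IsPrincipal

/-! ### Closed subschemes and their ideal sheaves

A closed subscheme of `X` is given by its quasi-coherent ideal sheaf, a term of
`X.IdealSheafData`. -/

/-- The ideal sheaf `I_{Z/X}` as a sheaf of `𝒪_X`-modules: the kernel of `𝒪_X ⟶ ι_* 𝒪_Z`, where
`ι : Z ⟶ X` is the inclusion. -/
def idealModule {X : Scheme.{u}} (Z : X.IdealSheafData) : X.Modules :=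
  Limits.kernel (C := X.Modules)
    (show structureSheaf X ⟶ (Scheme.Modules.pushforward Z.subschemeι).obj
        (structureSheaf Z.subscheme) from
      SheafOfModules.unitToPushforwardObjUnit Z.subschemeι.toRingCatSheafHom)

/-- `D` is an effective Cartier divisor: its ideal is locally generated by one nonzerodivisor. -/
def IsEffectiveCartier {X : Scheme.{u}} (D : X.IdealSheafData) : Prop :=
  ∀ x : X, ∃ U : X.affineOpens, x ∈ U.1 ∧
    ∃ f ∈ nonZeroDivisors Γ(X, U.1), D.ideal U = Ideal.span {f}

/-- `Z' = Z + D` for a Cartier divisor `D`, i.e. `I_{Z'} = I_Z · I_D` as fractional ideals.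
On a curve `D` is a difference `D₂ - D₁` of effective Cartier divisors, so this says
`I_{Z'} · I_{D₁} = I_Z · I_{D₂}`. -/
def DifferByCartier {X : Scheme.{u}} (Z Z' : X.IdealSheafData) : Prop :=
  ∃ D₁ D₂ : X.IdealSheafData, IsEffectiveCartier D₁ ∧ IsEffectiveCartier D₂ ∧
    Z' * D₁ = Z * D₂

/-! ### The torsion sheaf `T_i(F)` and the associated subscheme -/

/-- The module `T_i(M)` for an `A`-module `M` and an ideal `N` of `A`: the kernel of the canonical
map from `M / N ^ i M` to its bidual. -/
def torsionPart (A : Type u) [CommRing A] (N : Ideal A) (M : Type u) [AddCommGroup M] [Module A M]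
    (i : ℕ) : Submodule A (M ⧸ (N ^ i • (⊤ : Submodule A M))) :=
  LinearMap.ker (Module.Dual.eval A (M ⧸ (N ^ i • (⊤ : Submodule A M))))

/-- For a coherent sheaf `F`, the sections over an affine open `U` of the coherent sheaf `T_i(F)`,
the kernel of the canonical morphism from `F|_{C_i}` to its bidual, where `C_i` is the closed
subscheme with ideal sheaf the `i`-th power of the nilradical (for `i = 0` it is empty and
`T_0(F) = 0`). -/
abbrev torsionSections {X : Scheme.{u}} (F : X.Modules) (i : ℕ) (U : X.affineOpens) :=
  torsionPart Γ(X, U.1) (X.nilradical.ideal U) (F.presheaf.obj (.op U.1)) i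

/-- The closed subscheme `S` is the schematic support of `T_i(F)`: its ideal sheaf is the
annihilator of `T_i(F)`. -/
def IsSupportOfTorsion {X : Scheme.{u}} (F : X.Modules) (i : ℕ) (S : X.IdealSheafData) : Prop :=
  ∀ U : X.affineOpens, S.ideal U = Module.annihilator Γ(X, U.1) (torsionSections F i U)

/-- `F ≅ I_{Z/X} ⊗ G` for some line bundle `G`. -/
def IsTwistOfIdeal {X : Scheme.{u}} (F : X.Modules) (Z : X.IdealSheafData) : Prop :=
  ∃ G : X.Modules, IsLineBundle G ∧ Nonempty (F ≅ tensor (idealModule Z) G)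

/-- `Z` is a subscheme associated to `F`, on a primitive multiple curve of multiplicity `n`:
`F ≅ I_{Z/X} ⊗ G` for a line bundle `G`, where `Z` has finite support, is contained in `C_{n-1}`,
and its schematic intersection with `C` is the schematic support of `T_{n-1}(F)`. -/
structure IsAssociatedSubscheme {X : Scheme.{u}} (n : ℕ) (F : X.Modules) (Z : X.IdealSheafData) :
    Prop where
  twist : IsTwistOfIdeal F Z
  finite_support : (Z.support : Set X).Finite
  le : X.nilradical ^ (n - 1) ≤ Z
  inter : IsSupportOfTorsion F (n - 1) (Z ⊔ X.nilradical)

/-! ### The Picard group and local isomorphism classes -/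

/-- Isomorphism of line bundles. -/
instance lineBundleSetoid (X : Scheme.{u}) : Setoid {L : X.Modules // IsLineBundle L} where
  r L L' := Nonempty (L.1 ≅ L'.1)
  iseqv := ⟨fun _ => ⟨Iso.refl _⟩, fun ⟨e⟩ => ⟨e.symm⟩, fun ⟨e⟩ ⟨e'⟩ => ⟨e ≪≫ e'⟩⟩

/-- The set `Pic X` of isomorphism classes of line bundles. -/
def Pic (X : Scheme.{u}) : Type (u + 1) := Quotient (lineBundleSetoid X)

/-- The class of a line bundle in `Pic X`. -/
def Pic.mk {X : Scheme.{u}} (L : X.Modules) (h : IsLineBundle L) : Pic X :=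
  Quotient.mk (lineBundleSetoid X) ⟨L, h⟩

/-- Isomorphism of generalized line bundles that are locally isomorphic to `F`. -/
instance locIsoSetoid {X : Scheme.{u}} [IrreducibleSpace X] (F : X.Modules) :
    Setoid {F' : X.Modules // IsGeneralizedLineBundle F' ∧ LocallyIsomorphic F F'} where
  r L L' := Nonempty (L.1 ≅ L'.1)
  iseqv := ⟨fun _ => ⟨Iso.refl _⟩, fun ⟨e⟩ => ⟨e.symm⟩, fun ⟨e⟩ ⟨e'⟩ => ⟨e ≪≫ e'⟩⟩

/-- The set of isomorphism classes of generalized line bundles locally isomorphic to `F`. -/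
def LocIsoClass {X : Scheme.{u}} [IrreducibleSpace X] (F : X.Modules) : Type (u + 1) :=
  Quotient (locIsoSetoid F)

/-- The class of a generalized line bundle that is locally isomorphic to `F`. -/
def LocIsoClass.mk {X : Scheme.{u}} [IrreducibleSpace X] {F : X.Modules} (F' : X.Modules)
    (h : IsGeneralizedLineBundle F' ∧ LocallyIsomorphic F F') : LocIsoClass F :=
  Quotient.mk (locIsoSetoid F) ⟨F', h⟩

end GLB

end

noncomputable section

open TopologicalSpace Opposite

namespace GLB

/-! ### Sheaves of modules given by families of submodules of the function ring -/

section

variable {X : Scheme.{u}} [IrreducibleSpace X]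

/-! Everything takes place inside the function ring Q, the stalk of the structure sheaf at the
generic point. The Cohen–Macaulay condition makes every non-nilpotent element of a stalk a
nonzerodivisor, so the stalk at x embeds in Q, with image R_x (`CurveStalks.specMap_injective`).
Purity makes a generalized line bundle torsion-free (`IsPure.genericGerm_injective`), so it embeds
in the constant sheaf Q as well. It thus becomes a family of finitely generated R_x-submodules M_x
of Q, with M_x = R_x on a nonempty open set, that is, off finitely many closed points.

In this language a line bundle is a family locally generated by one unit of Q. Tensoring with it is
multiplication of families (`famTensorIso`), and an isomorphism of sheaves is multiplication by a
unit of Q (`exists_unit_of_restrictIso`). An effective Cartier divisor is a locally principal family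
of ideals, and two closed subschemes differ by a Cartier divisor when their ideal families differ by
a locally principal factor (`differByCartier_iff`).

Uniqueness and the statements on local isomorphism are then formal. If two generalized line bundles
are locally isomorphic, then M'_x = w_x M_x with units w_x that may be taken to be 1 off a finite
set. Hence the modules R_x w_x form a locally principal family ℓ with M' = M ℓ
(`exists_mul_eq_of_locallyIsomorphic`). Locally principal families are invertible, which gives the
group structure on `Pic X` and the transitivity of its action.

Existence of the associated subscheme is a problem at finitely many points. Let y generate the
maximal ideal of Q and the ideal of nilpotents of R_x. One needs a unit g of Q with g M_x inside R_x
and y^(n-1) in g M_x (`LocalData.exists_unit_mul`). Smoothness of the reduced curve makes R_x modulo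
nilpotents a valuation ring, so the successive quotients of the filtration of M_x by the multiples
of y^i are cyclic. The unit g is built starting from the level i = n-1, and is corrected at each new
level by a factor 1 + t that acts trivially on the levels already treated. The ideals g_x M_x define
an ideal sheaf, because almost all of them are trivial (`famIdeal_basicOpen`). That y^(n-1) lies in
g M_x puts Z inside C_{n-1}. It also identifies the annihilator of T_{n-1}, which is locally (M_x ∩
y^(n-1) Q) / y^(n-1) M_x, with g M_x + y R_x, the ideal of the intersection of Z and C
(`LocalData.annihilates_iff`). -/

lemma generic_mem {U : X.Opens} {x : X} (hx : x ∈ U) : genericPoint X ∈ U :=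
  ((genericPoint_spec X).mem_open_set_iff U.isOpen).mpr ⟨x, trivial, hx⟩

/-- The map from sections over an open set containing the generic point to the function ring. -/
def gen (U : X.Opens) (h : genericPoint X ∈ U) : Γ(X, U) →+* X.functionField :=
  (X.presheaf.germ U (genericPoint X) h).hom

lemma gen_res {U V : X.Opens} (i : V ⟶ U) (h : genericPoint X ∈ V) (a : Γ(X, U)) :
    gen V h (X.presheaf.map i.op a) = gen U (i.le h) a :=
  X.presheaf.germ_res_apply i _ h a

/-- The image of the local ring at `x` in the function ring. -/
def localRing (x : X) : Subring X.functionField :=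
  (X.presheaf.stalkSpecializes ((genericPoint_spec X).specializes (Set.mem_univ x))).hom.range

variable (X) in
/-- A family of submodules of the function ring over the local rings. -/
abbrev Family := ∀ x : X, Submodule (localRing x) X.functionField

lemma gen_mem_localRing {U : X.Opens} {x : X} (hx : x ∈ U) (a : Γ(X, U)) :
    gen U (generic_mem hx) a ∈ localRing x :=
  RingHom.mem_range.mpr ⟨X.presheaf.germ U x hx a,
    ConcreteCategory.congr_hom (X.presheaf.germ_stalkSpecializes hx
      ((genericPoint_spec X).specializes (Set.mem_univ x))) a⟩

/-- Sections of the sheaf of a family. -/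
def famSections (M : Family X) (U : X.Opens) : AddSubgroup (U → X.functionField) where
  -- Constant functions on the points of `U`, rather than single elements of the function ring: over
  -- the empty set only the zero section remains, as a sheaf requires.
  carrier := {s | (∀ x : U, s x ∈ M x.1) ∧ ∀ x x', s x = s x'}
  add_mem' := fun ha hb => ⟨fun x => add_mem (ha.1 x) (hb.1 x),
    fun x x' => congrArg₂ (· + ·) (ha.2 x x') (hb.2 x x')⟩
  zero_mem' := ⟨fun _ => zero_mem _, fun _ _ => rfl⟩
  neg_mem' := fun ha => ⟨fun x => neg_mem (ha.1 x), fun x x' => congrArg Neg.neg (ha.2 x x')⟩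

instance (M : Family X) (U : X.Opens) : Module Γ(X, U) (famSections M U) where
  smul a s := ⟨fun x => gen U (generic_mem x.2) a * s.1 x,
    fun x => (M x.1).smul_mem ⟨_, gen_mem_localRing x.2 a⟩ (s.2.1 x),
    fun x x' => congrArg₂ (· * ·) rfl (s.2.2 x x')⟩
  one_smul s := Subtype.ext <| funext fun x =>
    (congrArg (· * s.1 x) (map_one (gen U (generic_mem x.2)))).trans (one_mul _)
  mul_smul a b s := Subtype.ext <| funext fun x =>
    (congrArg (· * s.1 x) (map_mul (gen U (generic_mem x.2)) a b)).trans (mul_assoc _ _ _)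
  smul_zero _ := Subtype.ext <| funext fun _ => mul_zero _
  smul_add _ _ _ := Subtype.ext <| funext fun _ => mul_add _ _ _
  add_smul a b s := Subtype.ext <| funext fun x =>
    (congrArg (· * s.1 x) (map_add (gen U (generic_mem x.2)) a b)).trans (add_mul _ _ _)
  zero_smul s := Subtype.ext <| funext fun x =>
    (congrArg (· * s.1 x) (map_zero (gen U (generic_mem x.2)))).trans (zero_mul _)

/-- Restriction of sections. -/
def famRes (M : Family X) {U V : X.Opens} (h : V ≤ U) : famSections M U →+ famSections M V where
  toFun s := ⟨fun x => s.1 ⟨x.1, h x.2⟩, fun x => s.2.1 ⟨x.1, h x.2⟩, fun x x' => s.2.2 ⟨x.1, h x.2⟩ ⟨x'.1, h x'.2⟩⟩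
  map_zero' := rfl
  map_add' _ _ := rfl

/-- The presheaf of abelian groups of a family. -/
def famPresheaf (M : Family X) : X.Opensᵒᵖ ⥤ Ab.{u} where
  obj U := AddCommGrpCat.of (famSections M U.unop)
  map f := AddCommGrpCat.ofHom (famRes M f.unop.le)
  map_id _ := rfl
  map_comp _ _ := by ext; rfl

instance (M : Family X) (U : X.Opensᵒᵖ) :
    Module (X.ringCatSheaf.obj.obj U) ((famPresheaf M).obj U) :=
  inferInstanceAs (Module Γ(X, U.unop) (famSections M U.unop))

/-- By irreducibility all nonempty open sets contain the generic point, so the constants on the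
members of a cover can be compared there and glue to one constant. -/
lemma famPresheaf_isSheaf (M : Family X) : TopCat.Presheaf.IsSheaf (X := X) (famPresheaf M) := by
  rw [TopCat.Presheaf.isSheaf_iff_isSheaf_comp (forget AddCommGrpCat),
    TopCat.Presheaf.isSheaf_iff_isSheafUniqueGluing_types]
  intro ι U sf hsf
  have key : ∀ (i j : ι) (x : X) (hi : x ∈ U i) (hj : x ∈ U j),
      (sf i : famSections M (U i)).1 ⟨x, hi⟩ = (sf j : famSections M (U j)).1 ⟨x, hj⟩ :=
    fun i j x hi hj => congrFun (congrArg Subtype.val (hsf i j)) ⟨x, hi, hj⟩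
  have hc : ∀ x : (iSup U : X.Opens), ∃ i, x.1 ∈ U i := fun x => Opens.mem_iSup.mp x.2
  choose c hc using hc
  have key' : ∀ x x' : (iSup U : X.Opens), (sf (c x) : famSections M (U (c x))).1 ⟨x.1, hc x⟩ =
      (sf (c x') : famSections M (U (c x'))).1 ⟨x'.1, hc x'⟩ := fun x x' =>
    ((sf (c x) : famSections M _).2.2 _ ⟨_, generic_mem (hc x)⟩).trans <|
      (key _ _ _ _ (generic_mem (hc x'))).trans ((sf (c x') : famSections M _).2.2 _ _)
  refine ⟨(⟨fun x => (sf (c x) : famSections M (U (c x))).1 ⟨x.1, hc x⟩,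
    fun x => (sf (c x) : famSections M (U (c x))).2.1 ⟨x.1, hc x⟩, key'⟩ :
      famSections M (iSup U)), fun i => ?_, fun t ht => ?_⟩
  · exact Subtype.ext (funext fun x => key _ _ _ _ _)
  · refine Subtype.ext (funext fun x => ?_)
    exact congrFun (congrArg Subtype.val (ht (c x))) ⟨x.1, hc x⟩

/-- The sheaf of modules of a family. -/
def famSheaf (M : Family X) : X.Modules where
  val := PresheafOfModules.ofPresheaf (famPresheaf M) (by
    intro U V f a s
    exact Subtype.ext (funext fun x =>
      congrArg (· * s.1 ⟨x.1, f.unop.le x.2⟩) (gen_res f.unop (generic_mem x.2) a).symm))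
  isSheaf := famPresheaf_isSheaf M

/-- A section of the sheaf of a family, from a constant. -/
def famConst (M : Family X) (U : X.Opens) (k : X.functionField) (h : ∀ x ∈ U, k ∈ M x) :
    Γ(famSheaf M, U) :=
  (⟨fun _ => k, fun x => h x.1 x.2, fun _ _ => rfl⟩ : famSections M U)

/-- The value of a section of the sheaf of a family. -/
def famVal (M : Family X) {U : X.Opens} (h : genericPoint X ∈ U) : Γ(famSheaf M, U) →+ X.functionField where
  toFun s := (show famSections M U from s).1 ⟨_, h⟩
  map_zero' := rfl
  map_add' _ _ := rfl

lemma famVal_mem (M : Family X) {U : X.Opens} {x : X} (hx : x ∈ U) (s : Γ(famSheaf M, U)) :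
    famVal M (generic_mem hx) s ∈ M x := by
  have := (show famSections M U from s).2.1 ⟨x, hx⟩
  rwa [(show famSections M U from s).2.2 _ ⟨_, generic_mem hx⟩] at this

lemma famVal_injective (M : Family X) {U : X.Opens} (h : genericPoint X ∈ U) :
    Function.Injective (famVal M h) := fun s t e => by
  refine Subtype.ext (funext fun x => ?_)
  exact ((show famSections M U from s).2.2 x ⟨_, h⟩).trans <| e.trans
    ((show famSections M U from t).2.2 ⟨_, h⟩ x)

@[simp]
lemma famVal_famConst (M : Family X) (U : X.Opens) (h : genericPoint X ∈ U) (k : X.functionField)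
    (hk : ∀ x ∈ U, k ∈ M x) : famVal M h (famConst M U k hk) = k := rfl

lemma famVal_res (M : Family X) {U V : X.Opens} (i : V ⟶ U) (h : genericPoint X ∈ V)
    (s : Γ(famSheaf M, U)) :
    famVal M h ((famSheaf M).presheaf.map i.op s) = famVal M (i.le h) s := rfl

lemma famVal_smul (M : Family X) {U : X.Opens} (h : genericPoint X ∈ U) (a : Γ(X, U))
    (s : Γ(famSheaf M, U)) : famVal M h (a • s) = gen U h a * famVal M h s := rfl

lemma famSheaf_subsingleton (M : Family X) {U : X.Opens} (h : genericPoint X ∉ U) :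
    Subsingleton Γ(famSheaf M, U) := by
  refine ⟨fun s t => Subtype.ext (funext fun x => ?_)⟩
  exact absurd (generic_mem x.2) h

/-- A morphism of sheaves of modules from compatible linear maps on sections. -/
def homOfSections {Y : Scheme.{u}} {F G : Y.Modules} (φ : ∀ U : Y.Opens, Γ(F, U) →+ Γ(G, U))
    (hsmul : ∀ (U : Y.Opens) (a : Γ(Y, U)) (s : Γ(F, U)), φ U (a • s) = a • φ U s)
    (hres : ∀ (U V : Y.Opens) (i : V ⟶ U) (s : Γ(F, U)),
      φ V (F.presheaf.map i.op s) = G.presheaf.map i.op (φ U s)) : F ⟶ G :=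
  ⟨PresheafOfModules.homMk
    { app := fun U => AddCommGrpCat.ofHom (φ U.unop)
      naturality := fun U V f => by
        ext s
        exact hres U.unop V.unop f.unop s }
    (fun U a s => hsmul U.unop a s)⟩

lemma isIso_of_bijective {Y : Scheme.{u}} {F G : Y.Modules} (φ : F ⟶ G)
    (h : ∀ U, Function.Bijective (φ.app U)) : IsIso φ :=
  Scheme.Modules.Hom.isIso_iff_isIso_app.mpr fun U =>
    (ConcreteCategory.isIso_iff_bijective (φ.app U)).mpr (h U)

end

/-! ### Sheaves embedded in the function ring -/

section

variable {X : Scheme.{u}} [IrreducibleSpace X]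

/-- Compatible injections of the sections of a sheaf of modules into the function ring. -/
structure RatEmb (F : X.Modules) where
  /-- the injection on sections over an open set -/
  val : ∀ (U : X.Opens), genericPoint X ∈ U → Γ(F, U) →+ X.functionField
  val_smul : ∀ (U : X.Opens) (h : genericPoint X ∈ U) (a : Γ(X, U)) (s : Γ(F, U)),
    val U h (a • s) = gen U h a * val U h s
  val_res : ∀ (U V : X.Opens) (i : V ⟶ U) (h : genericPoint X ∈ V) (s : Γ(F, U)),
    val V h (F.presheaf.map i.op s) = val U (i.le h) s
  val_inj : ∀ (U : X.Opens) (h : genericPoint X ∈ U), Function.Injective (val U h)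

lemma mem_localRing_iff {x : X} {k : X.functionField} :
    k ∈ localRing x ↔ ∃ (U : X.Opens) (hx : x ∈ U) (a : Γ(X, U)), gen U (generic_mem hx) a = k := by
  constructor
  · intro h
    obtain ⟨t, rfl⟩ := RingHom.mem_range.mp h
    obtain ⟨U, hx, a, rfl⟩ := TopCat.Presheaf.exists_germ_eq X.presheaf t
    exact ⟨U, hx, a, (ConcreteCategory.congr_hom (X.presheaf.germ_stalkSpecializes hx
      ((genericPoint_spec X).specializes (Set.mem_univ x))) a).symm⟩
  · rintro ⟨U, hx, a, rfl⟩
    exact gen_mem_localRing hx a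

namespace RatEmb

variable {F : X.Modules} (χ : RatEmb F)

/-- The family of germs of a sheaf embedded in the function ring. -/
def fam : Family X := fun x =>
  { carrier := {k | ∃ (U : X.Opens) (hx : x ∈ U) (s : Γ(F, U)), χ.val U (generic_mem hx) s = k}
    add_mem' := by
      rintro _ _ ⟨U, hx, s, rfl⟩ ⟨V, hx', t, rfl⟩
      refine ⟨U ⊓ V, ⟨hx, hx'⟩, F.presheaf.map (homOfLE inf_le_left).op s +
        F.presheaf.map (homOfLE inf_le_right).op t, ?_⟩
      rw [map_add, χ.val_res, χ.val_res]
    zero_mem' := ⟨⊤, trivial, 0, map_zero _⟩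
    smul_mem' := by
      rintro ⟨r, hr⟩ _ ⟨U, hx, s, rfl⟩
      obtain ⟨V, hx', a, rfl⟩ := mem_localRing_iff.mp hr
      refine ⟨U ⊓ V, ⟨hx, hx'⟩, X.presheaf.map (homOfLE (inf_le_right : U ⊓ V ≤ V)).op a •
        F.presheaf.map (homOfLE (inf_le_left : U ⊓ V ≤ U)).op s, ?_⟩
      rw [χ.val_smul, χ.val_res, gen_res]
      rfl }

/-- The morphism to the sheaf of a family. -/
def toFam (M : Family X) (h : ∀ x, χ.fam x ≤ M x) : F ⟶ famSheaf M :=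
  homOfSections
    (fun U =>
      { toFun := fun s => (⟨fun x => χ.val U (generic_mem x.2) s,
          fun x => h x.1 ⟨U, x.2, s, rfl⟩, fun _ _ => rfl⟩ : famSections M U)
        map_zero' := Subtype.ext (funext fun _ => map_zero _)
        map_add' := fun s t => Subtype.ext (funext fun _ => map_add _ s t) })
    (fun U a s => Subtype.ext (funext fun x => χ.val_smul U (generic_mem x.2) a s))
    (fun U V i s => Subtype.ext (funext fun x => χ.val_res U V i (generic_mem x.2) s))

lemma famVal_toFam (M : Family X) (h : ∀ x, χ.fam x ≤ M x) (U : X.Opens) (hU : genericPoint X ∈ U)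
    (s : Γ(F, U)) : famVal M hU ((χ.toFam M h).app U s) = χ.val U hU s := rfl

/-- An element that is a germ of `F` at every point of `U` comes from local sections of `F`. They
agree on overlaps because the embedding is injective, hence glue. An open set without the generic
point is empty. -/
lemma toFam_bijective (U : X.Opens) : Function.Bijective ((χ.toFam χ.fam fun _ => le_rfl).app U) := by
  by_cases hU : genericPoint X ∈ U
  · refine ⟨fun s t e => χ.val_inj U hU ?_, fun t => ?_⟩
    · rw [← χ.famVal_toFam _ (fun _ => le_rfl), e, χ.famVal_toFam]
    · have h : ∀ x : U, ∃ (V : X.Opens) (hx : x.1 ∈ V) (s : Γ(F, V)),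
          χ.val V (generic_mem hx) s = famVal χ.fam hU t := fun x => famVal_mem χ.fam x.2 t
      choose V hx s hs using h
      obtain ⟨r, hr, -⟩ := TopCat.Sheaf.existsUnique_gluing' ⟨_, F.isSheaf⟩
        (fun x : U => V x ⊓ U) U (fun x => homOfLE inf_le_right)
        (fun y hy => Opens.mem_iSup.mpr ⟨⟨y, hy⟩, hx _, hy⟩)
        (fun x => F.presheaf.map (homOfLE (inf_le_left : V x ⊓ U ≤ V x)).op (s x)) (by
          intro x x'
          refine χ.val_inj ((V x ⊓ U) ⊓ (V x' ⊓ U))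
            ⟨⟨generic_mem (hx x), hU⟩, generic_mem (hx x'), hU⟩ ?_
          refine (χ.val_res _ _ _ _ _).trans ?_
          refine Eq.trans ?_ (χ.val_res _ _ _ _ _).symm
          rw [χ.val_res, χ.val_res, hs, hs])
      refine ⟨r, famVal_injective _ hU ?_⟩
      rw [χ.famVal_toFam, ← hs ⟨_, hU⟩]
      have := congrArg (χ.val (V ⟨_, hU⟩ ⊓ U) ⟨generic_mem (hx ⟨_, hU⟩), hU⟩) (hr ⟨_, hU⟩)
      exact ((χ.val_res _ _ _ _ _).symm.trans this).trans (χ.val_res _ _ _ _ _)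
  · have hbot : U = ⊥ := by
      ext x
      exact ⟨fun hx => absurd (generic_mem hx) hU, fun h => h.elim⟩
    have : Subsingleton Γ(F, U) := by
      refine ⟨fun s t => TopCat.Sheaf.eq_of_locally_eq' ⟨_, F.isSheaf⟩ (fun x : PEmpty.{1} => ⊥) U
        (fun x => x.elim) (by rw [hbot]; exact bot_le) s t (fun x => x.elim)⟩
    have := famSheaf_subsingleton χ.fam hU
    exact ⟨fun _ _ _ => Subsingleton.elim _ _, fun t => ⟨0, Subsingleton.elim _ _⟩⟩

/-- A sheaf embedded in the function ring is isomorphic to the sheaf of its family of germs. -/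
def isoFam : F ≅ famSheaf χ.fam :=
  have := isIso_of_bijective _ χ.toFam_bijective
  asIso (χ.toFam χ.fam fun _ => le_rfl)

end RatEmb

/-- Multiplication by an element of the function ring. -/
def famMul {M M' : Family X} (w : X.functionField) (h : ∀ x, ∀ k ∈ M x, w * k ∈ M' x) :
    famSheaf M ⟶ famSheaf M' :=
  homOfSections (fun U =>
      { toFun := fun s => (⟨fun x => w * (show famSections M U from s).1 x, fun x =>
          h x.1 _ ((show famSections M U from s).2.1 x), fun x x' =>
          congrArg (w * ·) ((show famSections M U from s).2.2 x x')⟩ :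
          famSections M' U)
        map_zero' := Subtype.ext (funext fun _ => mul_zero _)
        map_add' := fun _ _ => Subtype.ext (funext fun _ => mul_add _ _ _) })
    (fun _ _ _ => Subtype.ext (funext fun _ => mul_left_comm _ _ _)) (fun _ _ _ _ => rfl)

variable (X) in
/-- The principal family generated by an element. -/
def prin (w : X.functionField) : Family X := fun x => Submodule.span (localRing x) {w}

lemma mem_prin_mul {w k : X.functionField} {M : Family X} {x : X} :
    k ∈ (prin X w * M) x ↔ ∃ m ∈ M x, w * m = k :=
  Submodule.mem_span_singleton_mul

/-- Multiplication by a unit of the function ring is an isomorphism. -/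
def famMulIso (w : X.functionFieldˣ) (M : Family X) : famSheaf M ≅ famSheaf (prin X w * M) where
  hom := famMul w fun _ k hk => mem_prin_mul.mpr ⟨k, hk, rfl⟩
  inv := famMul (w⁻¹ : X.functionFieldˣ) fun x k hk => by
    obtain ⟨m, hm, rfl⟩ := mem_prin_mul.mp hk
    rwa [Units.inv_mul_cancel_left]
  hom_inv_id := by
    ext U s
    exact Subtype.ext (funext fun x => Units.inv_mul_cancel_left w _)
  inv_hom_id := by
    ext U s
    exact Subtype.ext (funext fun x => Units.mul_inv_cancel_left w _)

/-- The comparison of the sheaves of two families on an open set. -/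
def famRestrictHom {M M' : Family X} (U : X.Opens) (h : ∀ x ∈ U, M x = M' x) :
    (famSheaf M).restrict U.ι ⟶ (famSheaf M').restrict U.ι :=
  homOfSections (fun V =>
      { toFun := fun s => (⟨(show famSections M (U.ι ''ᵁ V) from s).1, fun x => by
            rw [← h x.1 (U.ι_image_le V x.2)]
            exact (show famSections M (U.ι ''ᵁ V) from s).2.1 x,
          (show famSections M (U.ι ''ᵁ V) from s).2.2⟩ : famSections M' (U.ι ''ᵁ V))
        map_zero' := rfl
        map_add' := fun _ _ => rfl })
    (fun _ _ _ => rfl) (fun _ _ _ _ => rfl)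

/-- Families that agree on an open set define sheaves that agree there. -/
def famRestrictIso {M M' : Family X} (U : X.Opens) (h : ∀ x ∈ U, M x = M' x) :
    (famSheaf M).restrict U.ι ≅ (famSheaf M').restrict U.ι where
  hom := famRestrictHom U h
  inv := famRestrictHom U fun x hx => (h x hx).symm
  hom_inv_id := by ext V s; rfl
  inv_hom_id := by ext V s; rfl

end

/-! ### Tensor products as products of families -/

section

variable {X : Scheme.{u}} [IrreducibleSpace X]

open scoped TensorProduct

/-- Multiplication of sections of the sheaves of two families. -/
def famBilin (M ℓ : Family X) (U : X.Opens) :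
    famSections M U →ₗ[Γ(X, U)] famSections ℓ U →ₗ[Γ(X, U)] famSections (M * ℓ) U :=
  LinearMap.mk₂ Γ(X, U)
    (fun s t => ⟨fun x => s.1 x * t.1 x, fun x => Submodule.mul_mem_mul (s.2.1 x) (t.2.1 x),
      fun x x' => congrArg₂ (· * ·) (s.2.2 x x') (t.2.2 x x')⟩)
    (fun _ _ _ => Subtype.ext (funext fun _ => add_mul _ _ _))
    (fun _ _ _ => Subtype.ext (funext fun _ => mul_assoc _ _ _))
    (fun _ _ _ => Subtype.ext (funext fun _ => mul_add _ _ _))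
    (fun _ _ _ => Subtype.ext (funext fun _ => mul_left_comm _ _ _))

/-- Multiplication of sections, as a map from the presheaf tensor product. -/
def famTensorMap (M ℓ : Family X) :
    PresheafOfModules.Monoidal.tensorObj (R := X.presheaf) (famSheaf M).val (famSheaf ℓ).val ⟶
      (famSheaf (M * ℓ)).val where
  app U := ModuleCat.ofHom (R := Γ(X, U.unop))
    (X := TensorProduct Γ(X, U.unop) (famSections M U.unop) (famSections ℓ U.unop))
    (Y := famSections (M * ℓ) U.unop) (TensorProduct.lift (famBilin M ℓ U.unop))
  naturality _ := ModuleCat.MonoidalCategory.tensor_ext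
    (fun _ _ => rfl)

/-- A family is locally principal if, near every point, it is generated by a unit of the function
ring. -/
def LocPrincipal (ℓ : Family X) : Prop :=
  ∀ x : X, ∃ U : X.Opens, x ∈ U ∧ ∃ w : X.functionFieldˣ, ∀ x' ∈ U, ℓ x' = prin X w x'

/-- Sections over an open set are determined by, and exhaust, the elements of the function ring
that are regular at its points. -/
def SectionsRegular (X : Scheme.{u}) [IrreducibleSpace X] : Prop :=
  ∀ (U : X.Opens) (h : genericPoint X ∈ U) (k : X.functionField),
    (∀ x ∈ U, k ∈ localRing x) → ∃ a, gen U h a = k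

/-- A section of `ℓ` is `w` times an element lying in all local rings over `U`, hence times a
function `a` on `U`, and `a` moves across the tensor sign. -/
lemma exists_tmul_of_principal {M ℓ : Family X} {U : X.Opens} {w : X.functionFieldˣ}
    (hR : SectionsRegular X) (hU : genericPoint X ∈ U) (h : ∀ x ∈ U, ℓ x = prin X w x)
    (τ : TensorProduct Γ(X, U) (famSections M U) (famSections ℓ U)) :
    ∃ m : famSections M U, τ = m ⊗ₜ (show famSections ℓ U from
      famConst ℓ U w fun x hx => by rw [h x hx]; exact Submodule.mem_span_singleton_self _) := by
  induction τ using TensorProduct.induction_on with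
  | zero => exact ⟨0, (TensorProduct.zero_tmul _ _).symm⟩
  | tmul m l =>
    have hl : ∀ x ∈ U, (w⁻¹ : X.functionFieldˣ) * l.1 ⟨_, hU⟩ ∈ localRing x := fun x hx => by
      have h1 := l.2.1 ⟨x, hx⟩
      rw [h x hx, l.2.2 _ ⟨_, hU⟩] at h1
      obtain ⟨r, hr⟩ := Submodule.mem_span_singleton.mp h1
      rw [← hr, Subring.smul_def, smul_eq_mul, mul_left_comm, Units.inv_mul, mul_one]
      exact r.2
    obtain ⟨a, ha⟩ := hR U hU _ hl
    refine ⟨a • m, ?_⟩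
    rw [TensorProduct.smul_tmul]
    congr 1
    refine Subtype.ext (funext fun x => ?_)
    rw [l.2.2 x ⟨_, hU⟩]
    exact ((mul_comm _ _).trans (congrArg _ ha)).trans (Units.mul_inv_cancel_left w _) |>.symm
  | add τ τ' h1 h2 =>
    obtain ⟨m, rfl⟩ := h1
    obtain ⟨m', rfl⟩ := h2
    exact ⟨m + m', (TensorProduct.add_tmul _ _ _).symm⟩

/-- Where `ℓ` is generated by `w` every tensor is `m ⊗ w`, and `m` is recovered from `m * w` since
`w` is a unit. -/
lemma famTensorMap_locallyInjective {M ℓ : Family X} (hℓ : LocPrincipal ℓ)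
    (hR : SectionsRegular X) :
    Presheaf.IsLocallyInjective (Opens.grothendieckTopology X)
      ((PresheafOfModules.toPresheaf X.ringCatSheaf.obj).map (famTensorMap M ℓ)) where
  equalizerSieve_mem {U} s t hst := by
    intro x hx
    obtain ⟨V, hxV, w, hw⟩ := hℓ x
    let W : X.Opens := U.unop ⊓ V
    let i : W ⟶ U.unop := homOfLE inf_le_left
    refine ⟨W, i, ?_, hx, hxV⟩
    let P := (PresheafOfModules.Monoidal.tensorObj (R := X.presheaf) (famSheaf M).val
      (famSheaf ℓ).val).presheaf
    let φ := (PresheafOfModules.toPresheaf X.ringCatSheaf.obj).map (famTensorMap M ℓ)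
    change P.map i.op s = P.map i.op t
    have h1 : φ.app (op W) (P.map i.op s) = φ.app (op W) (P.map i.op t) := by
      exact (NatTrans.naturality_apply φ i.op s).trans
        ((congrArg _ hst).trans (NatTrans.naturality_apply φ i.op t).symm)
    have hW : genericPoint X ∈ W := generic_mem (x := x) ⟨hx, hxV⟩
    obtain ⟨m, hm⟩ := exists_tmul_of_principal hR hW (fun x hx => hw x hx.2) (P.map i.op s)
    obtain ⟨m', hm'⟩ := exists_tmul_of_principal hR hW (fun x hx => hw x hx.2) (P.map i.op t)
    rw [hm, hm'] at h1 ⊢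
    congr 1
    refine Subtype.ext (funext fun x => ?_)
    exact (Units.mul_left_inj w).mp (congrFun (congrArg Subtype.val h1) x)

/-- Where `ℓ` is generated by `w`, a section `s` of the product is the image of `(w⁻¹ * s) ⊗ w`. -/
lemma famTensorMap_locallySurjective {M ℓ : Family X} (hℓ : LocPrincipal ℓ) :
    Presheaf.IsLocallySurjective (Opens.grothendieckTopology X)
      ((PresheafOfModules.toPresheaf X.ringCatSheaf.obj).map (famTensorMap M ℓ)) where
  imageSieve_mem {U} s := by
    intro x hx
    obtain ⟨V, hxV, w, hw⟩ := hℓ x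
    let W : X.Opens := U ⊓ V
    have hW : genericPoint X ∈ W := generic_mem (x := x) ⟨hx, hxV⟩
    let s' : famSections (M * ℓ) U := s
    have h1 : ∀ x' : W, (w⁻¹ : X.functionFieldˣ) * s'.1 ⟨x'.1, x'.2.1⟩ ∈ M x'.1 := fun x' => by
      have h1 : s'.1 ⟨x'.1, x'.2.1⟩ ∈ M x'.1 * ℓ x'.1 := s'.2.1 ⟨x'.1, x'.2.1⟩
      rw [hw _ x'.2.2, mul_comm] at h1
      obtain ⟨m, hm, e⟩ := Submodule.mem_span_singleton_mul.mp h1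
      rwa [← e, Units.inv_mul_cancel_left]
    let m : famSections M W := ⟨fun x' => (w⁻¹ : X.functionFieldˣ) * s'.1 ⟨x'.1, x'.2.1⟩, h1,
      fun x' x'' => congrArg _ (s'.2.2 _ _)⟩
    let l : famSections ℓ W := famConst ℓ W w fun x hx => by
      rw [hw x hx.2]; exact Submodule.mem_span_singleton_self _
    refine ⟨W, homOfLE inf_le_left, ⟨(m ⊗ₜ[Γ(X, W)] l :), ?_⟩, hx, hxV⟩
    refine Subtype.ext (funext fun x' => ?_)
    change (w⁻¹ : X.functionFieldˣ) * s'.1 ⟨x'.1, x'.2.1⟩ * w = s'.1 ⟨x'.1, x'.2.1⟩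
    rw [mul_right_comm, Units.inv_mul, one_mul]

/-- The tensor product with a locally principal family. -/
def famTensorIso {M ℓ : Family X} (hℓ : LocPrincipal ℓ) (hR : SectionsRegular X) :
    tensor (famSheaf M) (famSheaf ℓ) ≅ famSheaf (M * ℓ) := by
  have := famTensorMap_locallyInjective (M := M) hℓ hR
  have := famTensorMap_locallySurjective (M := M) hℓ
  let φ := (PresheafOfModules.sheafification (𝟙 X.ringCatSheaf.obj)).map (famTensorMap M ℓ)
  have h1 : IsIso φ := by
    rw [← isIso_iff_of_reflects_iso _ (SheafOfModules.toSheaf X.ringCatSheaf)]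
    -- Sheafification inverts locally bijective maps. It remains to compose with the counit, an
    -- isomorphism because the target is already a sheaf.
    have hW := (Opens.grothendieckTopology X).W_of_isLocallyBijective
      ((PresheafOfModules.toPresheaf X.ringCatSheaf.obj).map (famTensorMap M ℓ))
    exact ((Opens.grothendieckTopology X).W_iff _).mp hW
  let ψ := (PresheafOfModules.sheafificationAdjunction (𝟙 X.ringCatSheaf.obj)).counit.app
    (famSheaf (M * ℓ))
  have h2 : IsIso ψ := NatIso.isIso_app_of_isIso
    (PresheafOfModules.sheafificationAdjunction (𝟙 X.ringCatSheaf.obj)).counit _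
  exact (SheafOfModules.fullyFaithfulForget X.ringCatSheaf).preimageIso
    ((SheafOfModules.forget X.ringCatSheaf).mapIso ((@asIso _ _ _ _ φ h1) ≪≫ @asIso _ _ _ _ ψ h2))

/-- Isomorphic sheaves have isomorphic tensor products. -/
def tensorIso {Y : Scheme.{u}} {F F' G G' : Y.Modules} (e : F ≅ F') (e' : G ≅ G') :
    tensor F G ≅ tensor F' G' :=
  (PresheafOfModules.sheafification (𝟙 Y.ringCatSheaf.obj)).mapIso
    (show PresheafOfModules.Monoidal.tensorObj (R := Y.presheaf) F.val G.val ≅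
        PresheafOfModules.Monoidal.tensorObj (R := Y.presheaf) F'.val G'.val from
      @CategoryTheory.MonoidalCategory.tensorIso (PresheafOfModules (Y.presheaf ⋙ forget₂ _ _)) _ _ _ _ _ _
        ((SheafOfModules.forget Y.ringCatSheaf).mapIso e)
        ((SheafOfModules.forget Y.ringCatSheaf).mapIso e'))

end

/-! ### Isomorphisms as units of the function ring, line bundles as locally principal families -/

section

variable {X : Scheme.{u}} [IrreducibleSpace X]

section RestrictHom

variable {Y : Scheme.{u}} {F G H : Y.Modules} {U : Y.Opens}

lemma ι_image_preimage_of_le {V : Y.Opens} (h : V ≤ U) : U.ι ''ᵁ U.ι ⁻¹ᵁ V = V := by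
  rw [Scheme.Hom.image_preimage_eq_opensRange_inf, Scheme.Opens.opensRange_ι, inf_eq_right]
  exact h

lemma restrict_smul (V : U.toScheme.Opens) (a : Γ(Y, U.ι ''ᵁ V)) (s : Γ(F, U.ι ''ᵁ V)) :
    ((show Γ(U.toScheme, V) from a) • (show Γ(F.restrict U.ι, V) from s) : Γ(F.restrict U.ι, V)) =
      (show Γ(F.restrict U.ι, V) from (a • s : Γ(F, U.ι ''ᵁ V))) := by
  have h : (U.ι.appIso V).inv a = a := by
    rw [Scheme.Opens.ι_appIso]; rfl
  exact congrArg (fun b : Γ(Y, U.ι ''ᵁ V) => (b • s : Γ(F, U.ι ''ᵁ V))) h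

/-- The maps on sections over the open subsets of `U` induced by a morphism of restrictions. -/
def resApp (φ : F.restrict U.ι ⟶ G.restrict U.ι) {V : Y.Opens} (h : V ≤ U) :
    Γ(F, V) →+ Γ(G, V) :=
  (G.presheaf.map (homOfLE (ι_image_preimage_of_le h).ge).op).hom.comp
    ((φ.app (U.ι ⁻¹ᵁ V)).hom.comp
      (F.presheaf.map (homOfLE (ι_image_preimage_of_le h).le).op).hom)

lemma map_homOfLE_apply {V V' : Y.Opens} (h : V = V') (s : Γ(F, V')) :
    F.presheaf.map (homOfLE h.ge).op (F.presheaf.map (homOfLE h.le).op s) = s := by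
  subst h
  have : (homOfLE (le_refl V)).op = 𝟙 (op V) := rfl
  rw [this, F.presheaf.map_id]; rfl

lemma map_map_apply {V V' V'' : Y.Opens} (i : V' ⟶ V) (j : V'' ⟶ V') (s : Γ(F, V)) :
    F.presheaf.map j.op (F.presheaf.map i.op s) = F.presheaf.map (j ≫ i).op s := by
  rw [op_comp, F.presheaf.map_comp]; rfl

lemma resApp_smul (φ : F.restrict U.ι ⟶ G.restrict U.ι) {V : Y.Opens} (h : V ≤ U)
    (a : Γ(Y, V)) (s : Γ(F, V)) : resApp φ h (a • s) = a • resApp φ h s := by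
  let i : U.ι ''ᵁ U.ι ⁻¹ᵁ V ⟶ V := homOfLE (ι_image_preimage_of_le h).le
  let j : V ⟶ U.ι ''ᵁ U.ι ⁻¹ᵁ V := homOfLE (ι_image_preimage_of_le h).ge
  have h1 : F.presheaf.map i.op (a • s) = Y.presheaf.map i.op a • F.presheaf.map i.op s :=
    F.map_smul i a s
  have h2 := φ.app_smul (show Γ(U.toScheme, U.ι ⁻¹ᵁ V) from Y.presheaf.map i.op a)
    (F.presheaf.map i.op s)
  have h3 : φ.app (U.ι ⁻¹ᵁ V) (F.presheaf.map i.op (a • s)) =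
      (show Γ(G, U.ι ''ᵁ U.ι ⁻¹ᵁ V) from Y.presheaf.map i.op a •
        (show Γ(G, U.ι ''ᵁ U.ι ⁻¹ᵁ V) from φ.app (U.ι ⁻¹ᵁ V) (F.presheaf.map i.op s))) :=
    (congrArg (φ.app (U.ι ⁻¹ᵁ V)) (h1.trans (restrict_smul _ _ _).symm)).trans
      (h2.trans (restrict_smul _ _ _))
  refine (congrArg (G.presheaf.map j.op) h3).trans ((G.map_smul j _ _).trans ?_)
  have h4 : Y.presheaf.map j.op (Y.presheaf.map i.op a) = a := by
    have : i.op ≫ j.op = 𝟙 (op V) := rfl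
    rw [← CommRingCat.comp_apply, ← Y.presheaf.map_comp, this, Y.presheaf.map_id]; rfl
  exact congrArg (· • resApp φ h s) h4

lemma resApp_res (φ : F.restrict U.ι ⟶ G.restrict U.ι) {V V' : Y.Opens} (h : V ≤ U) (i : V' ⟶ V)
    (s : Γ(F, V)) : resApp φ (i.le.trans h) (F.presheaf.map i.op s) =
      G.presheaf.map i.op (resApp φ h s) := by
  let k : U.ι ''ᵁ U.ι ⁻¹ᵁ V ⟶ V := homOfLE (ι_image_preimage_of_le h).le
  let k' : U.ι ''ᵁ U.ι ⁻¹ᵁ V' ⟶ V' := homOfLE (ι_image_preimage_of_le (i.le.trans h)).le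
  let l : V ⟶ U.ι ''ᵁ U.ι ⁻¹ᵁ V := homOfLE (ι_image_preimage_of_le h).ge
  let l' : V' ⟶ U.ι ''ᵁ U.ι ⁻¹ᵁ V' := homOfLE (ι_image_preimage_of_le (i.le.trans h)).ge
  let r : U.ι ⁻¹ᵁ V' ⟶ U.ι ⁻¹ᵁ V := homOfLE fun _ hx => i.le hx
  let r' : U.ι ''ᵁ U.ι ⁻¹ᵁ V' ⟶ U.ι ''ᵁ U.ι ⁻¹ᵁ V := U.ι.opensFunctor.map r
  have hn : φ.app (U.ι ⁻¹ᵁ V') (F.presheaf.map r'.op (F.presheaf.map k.op s)) =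
      G.presheaf.map r'.op (φ.app (U.ι ⁻¹ᵁ V) (F.presheaf.map k.op s)) :=
    NatTrans.naturality_apply φ.mapPresheaf r.op (F.presheaf.map k.op s)
  have h1 : F.presheaf.map k'.op (F.presheaf.map i.op s) =
      F.presheaf.map r'.op (F.presheaf.map k.op s) :=
    (map_map_apply i k' s).trans (map_map_apply k r' s).symm
  have h2 : ∀ t : Γ(G, U.ι ''ᵁ U.ι ⁻¹ᵁ V), G.presheaf.map l'.op (G.presheaf.map r'.op t) =
      G.presheaf.map i.op (G.presheaf.map l.op t) := fun t =>
    (map_map_apply r' l' t).trans (map_map_apply l i t).symm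
  exact (congrArg (fun t => G.presheaf.map l'.op (φ.app (U.ι ⁻¹ᵁ V') t)) h1).trans
    ((congrArg (G.presheaf.map l'.op) hn).trans (h2 _))

lemma resApp_inv (e : F.restrict U.ι ≅ G.restrict U.ι) {V : Y.Opens} (h : V ≤ U) (s : Γ(F, V)) :
    resApp e.inv h (resApp e.hom h s) = s := by
  have h1 := map_homOfLE_apply (F := G) (ι_image_preimage_of_le h).symm
    (e.hom.app (U.ι ⁻¹ᵁ V) (F.presheaf.map (homOfLE (ι_image_preimage_of_le h).le).op s))
  refine (congrArg (fun t => F.presheaf.map _ (e.inv.app (U.ι ⁻¹ᵁ V) t)) h1).trans ?_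
  have h2 := congrArg (fun φ => φ.app (U.ι ⁻¹ᵁ V)
    (F.presheaf.map (homOfLE (ι_image_preimage_of_le h).le).op s)) e.hom_inv_id
  exact (congrArg (F.presheaf.map _) h2).trans (map_homOfLE_apply (ι_image_preimage_of_le h) s)

lemma resApp_bijective (e : F.restrict U.ι ≅ G.restrict U.ι) {V : Y.Opens} (h : V ≤ U) :
    Function.Bijective (resApp e.hom h) :=
  Function.bijective_iff_has_inverse.mpr
    ⟨resApp e.inv h, resApp_inv e h, resApp_inv e.symm h⟩

lemma eq_of_locally_eq {F : Y.Modules} {V : Y.Opens} {s t : Γ(F, V)}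
    (h : ∀ x ∈ V, ∃ U : Y.Opens, x ∈ U ∧ F.presheaf.map (homOfLE (inf_le_left : V ⊓ U ≤ V)).op s =
      F.presheaf.map (homOfLE inf_le_left).op t) : s = t := by
  choose U hU H using h
  exact TopCat.Sheaf.eq_of_locally_eq' ⟨_, F.isSheaf⟩ (fun x : V => V ⊓ U x.1 x.2) V
    (fun x => homOfLE inf_le_left) (fun x hx => Opens.mem_iSup.mpr ⟨⟨x, hx⟩, hx, hU x hx⟩) s t
    (fun x => H x.1 x.2)

end RestrictHom

/-- The elements of a family spread out to neighbourhoods. -/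
def Spread (M : Family X) : Prop :=
  ∀ (x : X), ∀ k ∈ M x, ∃ U : X.Opens, x ∈ U ∧ ∀ x' ∈ U, k ∈ M x'

lemma RatEmb.spread {F : X.Modules} (χ : RatEmb F) : Spread χ.fam := by
  rintro x _ ⟨U, hx, s, rfl⟩
  exact ⟨U, hx, fun x' hx' => ⟨U, hx', s, rfl⟩⟩

lemma Spread.mul {M M' : Family X} (h : Spread M) (h' : Spread M') : Spread (M * M') := by
  intro x k hk
  induction hk using Submodule.mul_induction_on' with
  | mem_mul_mem m hm m' hm' =>
    obtain ⟨U, hU, H⟩ := h x m hm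
    obtain ⟨U', hU', H'⟩ := h' x m' hm'
    exact ⟨U ⊓ U', ⟨hU, hU'⟩, fun x' hx' => Submodule.mul_mem_mul (H x' hx'.1) (H' x' hx'.2)⟩
  | add k hk k' hk' ih ih' =>
    obtain ⟨U, hU, H⟩ := ih
    obtain ⟨U', hU', H'⟩ := ih'
    exact ⟨U ⊓ U', ⟨hU, hU'⟩, fun x' hx' => add_mem (H x' hx'.1) (H' x' hx'.2)⟩

lemma spread_prin (w : X.functionField) : Spread (prin X w) := by
  intro x k hk
  obtain ⟨⟨r, hr⟩, rfl⟩ := Submodule.mem_span_singleton.mp hk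
  obtain ⟨U, hx, a, rfl⟩ := mem_localRing_iff.mp hr
  exact ⟨U, hx, fun x' hx' => Submodule.smul_mem _ (⟨_, gen_mem_localRing hx' a⟩ : localRing x')
    (Submodule.mem_span_singleton_self _)⟩

lemma LocPrincipal.spread {ℓ : Family X} (h : LocPrincipal ℓ) : Spread ℓ := by
  intro x k hk
  obtain ⟨U, hx, w, hw⟩ := h x
  rw [hw x hx] at hk
  obtain ⟨V, hxV, hV⟩ := spread_prin _ x k hk
  exact ⟨U ⊓ V, ⟨hx, hxV⟩, fun x' hx' => by rw [hw x' hx'.1]; exact hV x' hx'.2⟩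

lemma one_eq_prin : (1 : Family X) = prin X 1 := by
  funext x
  exact Submodule.one_eq_span

lemma mem_one_iff {x : X} {k : X.functionField} : k ∈ (1 : Family X) x ↔ k ∈ localRing x := by
  rw [one_eq_prin]
  refine Submodule.mem_span_singleton.trans ⟨?_, fun h => ⟨⟨k, h⟩, mul_one k⟩⟩
  rintro ⟨r, rfl⟩
  rw [Subring.smul_def, smul_eq_mul, mul_one]
  exact r.2

lemma exists_gen_eq (k : X.functionField) :
    ∃ (U : X.Opens) (h : genericPoint X ∈ U) (a : Γ(X, U)), gen U h a = k := by
  obtain ⟨U, hx, a, rfl⟩ := TopCat.Presheaf.exists_germ_eq X.presheaf k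
  exact ⟨U, hx, a, rfl⟩

/-- An isomorphism between the restrictions of the sheaves of two families is given by
multiplication by a unit of the function ring. -/
lemma exists_unit_of_restrictIso {M M' : Family X}
    (hreg : ∀ u : X.functionField, (∀ k, k * u = 0 → k = 0) → IsUnit u)
    (hM : Spread M) (hM' : Spread M') (h1 : (1 : X.functionField) ∈ M (genericPoint X))
    {U : X.Opens} (hU : genericPoint X ∈ U)
    (e : (famSheaf M).restrict U.ι ≅ (famSheaf M').restrict U.ι) :
    ∃ w : X.functionFieldˣ, ∀ x ∈ U, M' x = (prin X w * M) x := by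
  obtain ⟨V₀, hV₀, H₀⟩ := hM _ _ h1
  let T₀ : X.Opens := U ⊓ V₀
  have hT₀ : genericPoint X ∈ T₀ := ⟨hU, hV₀⟩
  let c : Γ(famSheaf M, T₀) := famConst M T₀ 1 fun x hx => H₀ x hx.2
  -- At the generic point the isomorphism is linear over the function ring, hence is multiplication
  -- by the image `w` of 1. On a small enough open set every section is a function times the section
  -- `c` with value 1.
  let w := famVal M' hT₀ (resApp e.hom inf_le_left c)
  have key : ∀ (V : X.Opens) (h : V ≤ U) (hV : genericPoint X ∈ V) (s : Γ(famSheaf M, V)),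
      famVal M' hV (resApp e.hom h s) = famVal M hV s * w := by
    intro V h hV s
    obtain ⟨W, hW, a, ha⟩ := exists_gen_eq (famVal M hV s)
    let T : X.Opens := (V ⊓ T₀) ⊓ W
    have hT : genericPoint X ∈ T := ⟨⟨hV, hT₀⟩, hW⟩
    let i1 : T ⟶ V := homOfLE fun z hz => hz.1.1
    let i2 : T ⟶ T₀ := homOfLE fun z hz => hz.1.2
    let b : Γ(X, T) := X.presheaf.map (homOfLE inf_le_right : T ⟶ W).op a
    have hbg : gen T hT b = famVal M hV s := (gen_res _ hT a).trans ha
    have hb : (famSheaf M).presheaf.map i1.op s = b • (famSheaf M).presheaf.map i2.op c := by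
      refine famVal_injective M hT ?_
      rw [famVal_smul, famVal_res, famVal_res, hbg, famVal_famConst, mul_one]
    have h3 := congrArg (fun t => famVal M' hT (resApp e.hom (i1.le.trans h) t)) hb
    rw [resApp_smul, resApp_res e.hom h i1 s, resApp_res e.hom inf_le_left i2 c, famVal_res,
      famVal_smul, famVal_res, hbg] at h3
    exact h3
  -- If `k * w = 0`, a section with value `k` on a small open set is mapped to zero, so `k = 0` by
  -- injectivity. A regular element of the function ring is a unit.
  have hw : IsUnit w := by
    refine hreg w fun k hk => ?_
    obtain ⟨W, hW, a, rfl⟩ := exists_gen_eq k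
    let T : X.Opens := T₀ ⊓ W
    have hT : genericPoint X ∈ T := ⟨hT₀, hW⟩
    let i2 : T ⟶ T₀ := homOfLE inf_le_left
    let b : Γ(X, T) := X.presheaf.map (homOfLE inf_le_right : T ⟶ W).op a
    let s : Γ(famSheaf M, T) := b • (famSheaf M).presheaf.map i2.op c
    have hs : famVal M hT s = gen W hW a := by
      refine Eq.trans ?_ (mul_one _)
      exact congrArg (· * _) (gen_res _ hT a)
    have h2 := key T (i2.le.trans inf_le_left) hT s
    rw [hs, hk] at h2
    have h4 := (resApp_bijective e (i2.le.trans inf_le_left)).1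
      ((famVal_injective M' hT (h2.trans (map_zero _).symm)).trans (map_zero _).symm)
    rw [← hs, h4, map_zero]
  obtain ⟨w', hw'⟩ := hw
  refine ⟨w', fun x hx => Submodule.ext fun k => ?_⟩
  rw [mem_prin_mul, hw']
  constructor
  · intro hk
    obtain ⟨V, hxV, hV⟩ := hM' x k hk
    have hV' : genericPoint X ∈ U ⊓ V := generic_mem (x := x) ⟨hx, hxV⟩
    obtain ⟨s, hs⟩ := (resApp_bijective e (V := U ⊓ V) inf_le_left).2
      (famConst M' (U ⊓ V) k fun x hx => hV x hx.2)
    refine ⟨famVal M hV' s, famVal_mem M (U := U ⊓ V) (x := x) ⟨hx, hxV⟩ s, ?_⟩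
    rw [mul_comm, ← key (U ⊓ V) inf_le_left hV' s, hs]; rfl
  · rintro ⟨k, hk, rfl⟩
    obtain ⟨V, hxV, hV⟩ := hM x k hk
    have hV' : genericPoint X ∈ U ⊓ V := generic_mem (x := x) ⟨hx, hxV⟩
    have := key (U ⊓ V) inf_le_left hV' (famConst M (U ⊓ V) k fun x hx => hV x hx.2)
    rw [famVal_famConst, mul_comm] at this
    rw [← this]
    exact famVal_mem M' (U := U ⊓ V) (x := x) ⟨hx, hxV⟩ _

/-- An isomorphism between the sheaves of two families is given by multiplication by a unit of the
function ring. -/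
lemma exists_unit_of_iso {M M' : Family X}
    (hreg : ∀ u : X.functionField, (∀ k, k * u = 0 → k = 0) → IsUnit u)
    (hM : Spread M) (hM' : Spread M') (h1 : (1 : X.functionField) ∈ M (genericPoint X))
    (e : famSheaf M ≅ famSheaf M') : ∃ w : X.functionFieldˣ, M' = prin X w * M := by
  obtain ⟨w, hw⟩ := exists_unit_of_restrictIso hreg hM hM' h1 (U := ⊤) trivial
    ((Scheme.Modules.restrictFunctor (Scheme.Opens.ι ⊤)).mapIso e)
  exact ⟨w, funext fun x => hw x trivial⟩

/-- Sections over nonempty open sets are determined by their germs at the generic point. -/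
def GenInjective (X : Scheme.{u}) [IrreducibleSpace X] : Prop :=
  ∀ (U : X.Opens) (h : genericPoint X ∈ U), Function.Injective (gen U h)

/-- The embedding of the structure sheaf in the function ring. -/
def unitEmb (hX : GenInjective X) : RatEmb (structureSheaf X) where
  val U h := (gen U h).toAddMonoidHom
  val_smul U h a s := map_mul (gen U h) a s
  val_res _ _ i h s := gen_res i h s
  val_inj U h := hX U h

lemma unitEmb_fam (hX : GenInjective X) : (unitEmb hX).fam = 1 := by
  funext x
  ext k
  rw [mem_one_iff, mem_localRing_iff]
  exact Iff.rfl

/-- The structure sheaf is the sheaf of the unit family. -/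
def structureSheafIso (hX : GenInjective X) : structureSheaf X ≅ famSheaf 1 :=
  (unitEmb hX).isoFam ≪≫ eqToIso (by rw [unitEmb_fam])

/-- Such an element is a section of the sheaf of the unit family, which is the structure sheaf by
gluing of local sections. -/
lemma GenInjective.sectionsRegular (hX : GenInjective X) : SectionsRegular X := by
  intro U h k hk
  obtain ⟨a, ha⟩ := ((unitEmb hX).toFam_bijective U).2
    (famConst _ U k fun x hx => by rw [unitEmb_fam]; exact mem_one_iff.mpr (hk x hx))
  exact ⟨a, congrArg (famVal _ h) ha⟩

/-- The sheaf of a locally principal family is a line bundle. -/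
lemma LocPrincipal.isLineBundle (hX : GenInjective X) {ℓ : Family X} (h : LocPrincipal ℓ) :
    IsLineBundle (famSheaf ℓ) := by
  intro x
  obtain ⟨U, hx, w, hw⟩ := h x
  refine ⟨U, hx, ⟨famRestrictIso (M' := prin X w * 1) U (fun x' hx' => by rw [mul_one, hw x' hx']) ≪≫
    (Scheme.Modules.restrictFunctor U.ι).mapIso
      ((famMulIso w 1).symm ≪≫ (structureSheafIso hX).symm)⟩⟩

/-- A line bundle is the sheaf of a locally principal family. -/
lemma IsLineBundle.exists_fam (hX : GenInjective X)
    (hreg : ∀ u : X.functionField, (∀ k, k * u = 0 → k = 0) → IsUnit u)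
    {L : X.Modules} (hL : IsLineBundle L) :
    ∃ ℓ : Family X, LocPrincipal ℓ ∧ Nonempty (L ≅ famSheaf ℓ) := by
  -- Restriction of sections of `L` to a smaller nonempty open set is injective: locally `L` is the
  -- structure sheaf, where this is `GenInjective`.
  have htf : ∀ (V W : X.Opens) (i : W ⟶ V) (hW : genericPoint X ∈ W) (s : Γ(L, V)),
      L.presheaf.map i.op s = 0 → s = 0 := by
    intro V W i hW s hs
    refine eq_of_locally_eq fun x hx => ?_
    obtain ⟨U, hxU, ⟨e⟩⟩ := hL x
    refine ⟨U, hxU, ?_⟩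
    have hT : genericPoint X ∈ V ⊓ U := generic_mem (x := x) ⟨hx, hxU⟩
    refine (resApp_bijective e (V := V ⊓ U) inf_le_right).1 (hX (V ⊓ U) hT ?_)
    rw [map_zero, map_zero]
    refine Eq.trans ?_ (map_zero (gen (V ⊓ U) hT)).symm
    refine Eq.trans ?_ (map_zero (gen (W ⊓ U) ⟨hW, hT.2⟩))
    let j : W ⊓ U ⟶ V ⊓ U := homOfLE (inf_le_inf_right U i.le)
    refine (gen_res j ⟨hW, hT.2⟩ _).symm.trans (congrArg (gen (W ⊓ U) ⟨hW, hT.2⟩) ?_)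
    refine (resApp_res e.hom inf_le_right j _).symm.trans ?_
    rw [map_map_apply]
    have : j ≫ homOfLE (inf_le_left : V ⊓ U ≤ V) = homOfLE inf_le_left ≫ i := rfl
    rw [this, ← map_map_apply, hs, map_zero, map_zero]
    rfl
  obtain ⟨U, hU, ⟨e⟩⟩ := hL (genericPoint X)
  -- The embedding restricts to a neighbourhood of the generic point on which `L` is trivial,
  -- applies the trivialization and takes the generic germ.
  let χ : RatEmb L :=
    { val := fun V h => (gen (V ⊓ U) ⟨h, hU⟩).toAddMonoidHom.comp
        ((resApp e.hom (V := V ⊓ U) inf_le_right).comp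
          (L.presheaf.map (homOfLE (inf_le_left : V ⊓ U ≤ V)).op).hom)
      val_smul := fun V h a s => by
        have h1 : L.presheaf.map (homOfLE (inf_le_left : V ⊓ U ≤ V)).op (a • s) =
          X.presheaf.map (homOfLE (inf_le_left : V ⊓ U ≤ V)).op a •
            L.presheaf.map (homOfLE (inf_le_left : V ⊓ U ≤ V)).op s := L.map_smul _ a s
        refine (congrArg (fun t => gen (V ⊓ U) ⟨h, hU⟩ (resApp e.hom inf_le_right t)) h1).trans ?_
        rw [resApp_smul]
        exact (map_mul (gen (V ⊓ U) ⟨h, hU⟩) _ _).trans (congrArg (· * _) (gen_res _ _ a))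
      val_res := fun V W i h s => by
        let j : W ⊓ U ⟶ V ⊓ U := homOfLE (inf_le_inf_right U i.le)
        refine Eq.trans ?_ (gen_res j ⟨h, hU⟩ _)
        refine congrArg (gen (W ⊓ U) ⟨h, hU⟩) ?_
        refine Eq.trans ?_ (resApp_res e.hom inf_le_right j _)
        refine congrArg (resApp e.hom (inf_le_right)) ?_
        exact (map_map_apply i (homOfLE inf_le_left : W ⊓ U ⟶ W) s).trans
          (map_map_apply (homOfLE inf_le_left : V ⊓ U ⟶ V) j s).symm
      val_inj := fun V h => by
        refine (injective_iff_map_eq_zero _).mpr fun s hs => ?_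
        refine htf V (V ⊓ U) (homOfLE inf_le_left) ⟨h, hU⟩ s ?_
        refine (resApp_bijective e (V := V ⊓ U) inf_le_right).1 ?_
        rw [map_zero]
        exact hX _ _ (hs.trans (map_zero _).symm) }
  refine ⟨χ.fam, fun x => ?_, ⟨χ.isoFam⟩⟩
  obtain ⟨V, hxV, ⟨e'⟩⟩ := hL x
  obtain ⟨w, hw⟩ := exists_unit_of_restrictIso (M := 1) hreg
    (by rw [one_eq_prin]; exact spread_prin _) χ.spread (mem_one_iff.mpr (one_mem _))
    (generic_mem hxV) ((Scheme.Modules.restrictFunctor V.ι).mapIso (structureSheafIso hX).symm ≪≫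
      e'.symm ≪≫ (Scheme.Modules.restrictFunctor V.ι).mapIso χ.isoFam)
  exact ⟨V, hxV, w, fun x' hx' => by rw [hw x' hx', mul_one]⟩

end

/-! ### Quasi-coherence as extension of sections from basic open sets -/

section

section Quasicoherent

variable {Y : Scheme.{u}}

/-- Sections of `F` over `V` extend to `T` after multiplication by a power of `g`, in an essentially
unique way. -/
structure Extends (F : Y.Modules) {T V : Y.Opens} (h : V ≤ T) (g : Γ(Y, T)) : Prop where
  exists_lift : ∀ s : Γ(F, V), ∃ (n : ℕ) (t : Γ(F, T)),
    F.presheaf.map (homOfLE h).op t = Y.presheaf.map (homOfLE h).op (g ^ n) • s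
  eq_zero : ∀ t : Γ(F, T), F.presheaf.map (homOfLE h).op t = 0 → ∃ n : ℕ, g ^ n • t = 0

/-- Sections of `F` over basic open subsets of `W` extend to `W`. -/
def BasicExtends (F : Y.Modules) (W : Y.Opens) : Prop :=
  ∀ f : Γ(Y, W), Extends F (Y.basicOpen_le f) f

lemma extends_congr {F : Y.Modules} {T T' V V' : Y.Opens} (hT : T' = T) (hV : V' = V) (h : V ≤ T)
    (h' : V' ≤ T') (g : Γ(Y, T)) :
    Extends F h g ↔ Extends F h' (Y.presheaf.map (homOfLE hT.le).op g) := by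
  subst hT hV
  have : (homOfLE (le_refl T')).op = 𝟙 (op T') := rfl
  have h2 : Y.presheaf.map (homOfLE (le_refl T')).op g = g := by
    rw [this, Y.presheaf.map_id]; rfl
  exact iff_of_eq (congrArg (Extends F h) h2.symm)

/-- Scalars act on the restriction to `Spec` through the identifications of rings of sections
attached to `hW.fromSpec`; their composite is plain restriction from `W`. -/
lemma fromSpec_smul {W : Y.Opens} (hW : IsAffineOpen W) (F : Y.Modules)
    (U : (Spec Γ(Y, W)).Opens) (h : hW.fromSpec ''ᵁ U ≤ W) (r : Γ(Y, W))
    (x : Γ(F, hW.fromSpec ''ᵁ U)) :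
    (r • (show Γ(F.restrict hW.fromSpec, U) from x) : Γ(F.restrict hW.fromSpec, U)) =
      (show Γ(F.restrict hW.fromSpec, U) from
        (Y.presheaf.map (homOfLE h).op r • x : Γ(F, hW.fromSpec ''ᵁ U))) := by
  have key : (Scheme.ΓSpecIso Γ(Y, W)).inv ≫ (Spec Γ(Y, W)).presheaf.map U.leTop.op ≫
      (hW.fromSpec.appIso U).inv = Y.presheaf.map (homOfLE h).op := by
    let i : U ⟶ hW.fromSpec ⁻¹ᵁ W := homOfLE (by rw [hW.fromSpec_preimage_self]; exact le_top)
    have h1 : (Scheme.ΓSpecIso Γ(Y, W)).inv ≫ (Spec Γ(Y, W)).presheaf.map U.leTop.op =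
        hW.fromSpec.app W ≫ (Spec Γ(Y, W)).presheaf.map i.op := by
      rw [hW.fromSpec_app_self, Category.assoc, ← Functor.map_comp]
      rfl
    have h2 := hW.fromSpec.appIso_inv_naturality i.op
    have h3 := hW.fromSpec.app_appIso_inv W
    rw [← Category.assoc, h1, Category.assoc, h2, ← Category.assoc, h3]
    exact (Y.presheaf.map_comp (X := op W) (Y := op (hW.fromSpec ''ᵁ hW.fromSpec ⁻¹ᵁ W))
      (homOfLE (Set.image_preimage_subset hW.fromSpec W.1)).op _).symm
  exact congrArg (fun b : Γ(Y, hW.fromSpec ''ᵁ U) => (b • x : Γ(F, hW.fromSpec ''ᵁ U)))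
    (ConcreteCategory.congr_hom key r)

/-- Both sides say that the sections over the basic open set of `f` are the localization at `f` of
the sections over `W`. The right-hand side is a criterion for quasi-coherence on a spectrum; the
left-hand side is easy to check on elements. -/
lemma basicExtends_iff {W : Y.Opens} (hW : IsAffineOpen W) (F : Y.Modules) :
    BasicExtends F W ↔ IsLocalizing (modulesSpecToSheaf.obj (F.restrict hW.fromSpec)) := by
  have hT : hW.fromSpec ''ᵁ ⊤ = W := by
    rw [Scheme.Hom.image_top_eq_opensRange, hW.opensRange_fromSpec]
  refine forall_congr' fun f => ?_
  have hV : hW.fromSpec ''ᵁ PrimeSpectrum.basicOpen f = Y.basicOpen f :=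
    hW.fromSpec_image_basicOpen f
  have hle : hW.fromSpec ''ᵁ PrimeSpectrum.basicOpen f ≤ hW.fromSpec ''ᵁ ⊤ :=
    Scheme.Hom.image_mono _ le_top
  rw [extends_congr (F := F) hT hV (Y.basicOpen_le f) hle]
  have e1 : ∀ n : ℕ, Y.presheaf.map (homOfLE (hle.trans hT.le)).op (f ^ n) =
      Y.presheaf.map (homOfLE hle).op (Y.presheaf.map (homOfLE hT.le).op f ^ n) := fun n => by
    rw [← map_pow, ← CommRingCat.comp_apply, ← Functor.map_comp]
    rfl
  constructor
  · intro H
    refine IsLocalizedModule.Away.mk_of_addCommGroup ?_ ?_ ?_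
    · exact Scheme.Modules.isUnit_algebraMap_end_of_le_basicOpen f le_rfl
    · intro s
      obtain ⟨n, t, ht⟩ := H.exists_lift s
      refine ⟨n, t, ?_⟩
      refine (fromSpec_smul hW F _ (hle.trans hT.le) (f ^ n) s).trans (Eq.trans ?_ ht.symm)
      exact congrArg (fun b : Γ(Y, hW.fromSpec ''ᵁ PrimeSpectrum.basicOpen f) => 
        (b • (show Γ(F, hW.fromSpec ''ᵁ PrimeSpectrum.basicOpen f) from s) :)) (e1 n)
    · intro t ht
      obtain ⟨n, hn⟩ := H.eq_zero t ht
      refine ⟨n, (fromSpec_smul hW F _ hT.le (f ^ n) t).trans (Eq.trans ?_ hn)⟩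
      exact congrArg (fun b : Γ(Y, hW.fromSpec ''ᵁ ⊤) =>
        (b • (show Γ(F, hW.fromSpec ''ᵁ ⊤) from t) : Γ(F, hW.fromSpec ''ᵁ ⊤)))
        (map_pow (Y.presheaf.map (homOfLE hT.le).op).hom f n)
  · intro H
    let φ := ((modulesSpecToSheaf.obj (F.restrict hW.fromSpec)).obj.map
      (PrimeSpectrum.basicOpen f).leTop.op).hom
    refine ⟨fun s => ?_, fun t ht => ?_⟩
    · obtain ⟨⟨t, ⟨_, n, rfl⟩⟩, ht⟩ := (H : IsLocalizedModule (.powers f) φ).surj s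
      refine ⟨n, t, ht.symm.trans ((fromSpec_smul hW F _ (hle.trans hT.le) (f ^ n) s).trans ?_)⟩
      exact congrArg (fun b : Γ(Y, hW.fromSpec ''ᵁ PrimeSpectrum.basicOpen f) => (b • s :)) (e1 n)
    · obtain ⟨⟨_, n, rfl⟩, hn⟩ := ((H : IsLocalizedModule (.powers f) φ).eq_zero_iff).mp ht
      refine ⟨n, Eq.trans ?_ ((fromSpec_smul hW F _ hT.le (f ^ n) t).symm.trans hn)⟩
      exact congrArg (fun b : Γ(Y, hW.fromSpec ''ᵁ ⊤) => (b • t : Γ(F, hW.fromSpec ''ᵁ ⊤)))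
        (map_pow (Y.presheaf.map (homOfLE hT.le).op).hom f n).symm

/-- Over an affine open set, sections of a quasi-coherent sheaf extend. -/
lemma basicExtends_of_isQuasicoherent {F : Y.Modules}
    (hF : SheafOfModules.IsQuasicoherent (R := Y.ringCatSheaf) F) {W : Y.Opens}
    (hW : IsAffineOpen W) : BasicExtends F W := by
  rw [basicExtends_iff hW, ← isIso_fromTildeΓ_iff_isLocalizing,
    ← isQuasicoherent_iff_isIso_fromTildeΓ]
  exact Scheme.Modules.isQuasicoherent_restrictFunctor hW.fromSpec F

/-- Presentations can be transported along isomorphisms. -/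
def presentationOfIso {M N : Y.Modules} (e : M ≅ N) (P : M.Presentation) : N.Presentation :=
  @SheafOfModules.Presentation.ofIsIso _ _ _ Y.ringCatSheaf _ _ M N e.hom e.isIso_hom P

/-- A presentation of the restriction to an affine open set. -/
lemma BasicExtends.nonempty_presentation {F : Y.Modules} {W : Y.Opens} (hW : IsAffineOpen W)
    (h : BasicExtends F W) : Nonempty (F.restrict W.ι).Presentation := by
  rw [basicExtends_iff hW, ← isIso_fromTildeΓ_iff_isLocalizing] at h
  let P := presentationTilde
    ((modulesSpecToSheaf.obj (F.restrict hW.fromSpec)).presheaf.obj (.op ⊤)) .univ (by simp) _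
    (Submodule.span_eq _)
  let P' : (F.restrict hW.fromSpec).Presentation :=
    presentationOfIso (@asIso _ _ _ _ (F.restrict hW.fromSpec).fromTildeΓ h) P
  let P'' := Scheme.Modules.presentationRestrict hW.isoSpec.hom P'
  let e : Scheme.Modules.restrictFunctor hW.fromSpec ⋙
      Scheme.Modules.restrictFunctor hW.isoSpec.hom ≅ Scheme.Modules.restrictFunctor W.ι :=
    (Scheme.Modules.restrictFunctorComp _ _).symm ≪≫
      Scheme.Modules.restrictFunctorCongr hW.isoSpec_hom_fromSpec
  exact ⟨presentationOfIso (e.app F) P''⟩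

/-- A sheaf of modules is quasi-coherent if its sections extend on an affine open cover. -/
lemma isQuasicoherent_of_basicExtends {F : Y.Modules}
    (h : ∀ y : Y, ∃ W : Y.Opens, y ∈ W ∧ IsAffineOpen W ∧ BasicExtends F W) :
    SheafOfModules.IsQuasicoherent (R := Y.ringCatSheaf) F := by
  choose W hy hW hF using h
  have P := fun y => (hF y).nonempty_presentation (hW y)
  refine SheafOfModules.QuasicoherentData.isQuasicoherent
    (M := F) (R := Y.ringCatSheaf) { I := ↥Y, X := W, coversTop := ?_, presentation := fun y => ?_ }
  · rw [Opens.coversTop_iff, IsOpenCover, eq_top_iff]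
    exact fun y _ => Opens.mem_iSup.mpr ⟨y, hy y⟩
  -- The presentation is wanted on the slice site over `W y`. It is carried over from the open
  -- subscheme by an equivalence, which preserves colimits and the unit.
  · let G := (Scheme.Modules.overEquiv (W y)).inverse
    have : Limits.PreservesColimitsOfSize.{u, u} G :=
      (Scheme.Modules.overEquiv (W y)).symm.toAdjunction.leftAdjoint_preservesColimits
    let η : SheafOfModules.unit (Y.ringCatSheaf.over (W y)) ≅
        G.obj (SheafOfModules.unit (W y).toScheme.ringCatSheaf) :=
      (Scheme.Modules.overEquiv (W y)).unitIso.app _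
    let e : G.obj (F.restrict (W y).ι) ≅ F.over (W y) :=
      G.mapIso ((Scheme.Modules.overFunctorEquiv (W y)).symm.app F) ≪≫
        (Scheme.Modules.overEquiv (W y)).unitIso.symm.app _
    refine SheafOfModules.Presentation.ofIsIso.{u, u, u} e.hom (?_)
    have P1 := (P y).some
    exact @SheafOfModules.Presentation.map _ _ _ _ _ _ _ _ _ _ _ _ _ P1 G this η

end Quasicoherent

end

/-! ### Coherence is a local property -/

section

section Coherent

variable {Y : Scheme.{u}}

lemma exists_resApp_eq {F G : Y.Modules} {U V : Y.Opens} (e : F.restrict U.ι ≅ G.restrict U.ι)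
    (h : V ≤ U) (t : Γ(G, V)) : ∃ s : Γ(F, V), resApp e.hom h s = t :=
  (resApp_bijective e h).2 t

lemma BasicExtends.of_restrictIso {F G : Y.Modules} {U W : Y.Opens} (h : W ≤ U)
    (e : F.restrict U.ι ≅ G.restrict U.ι) (hF : BasicExtends F W) : BasicExtends G W := by
  intro f
  have hle := Y.basicOpen_le f
  refine ⟨fun t => ?_, fun t ht => ?_⟩
  · obtain ⟨s, rfl⟩ := exists_resApp_eq e (hle.trans h) t
    obtain ⟨n, s', hs'⟩ := (hF f).exists_lift s
    refine ⟨n, resApp e.hom h s', ?_⟩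
    rw [← resApp_smul, ← hs']
    exact (resApp_res e.hom h (homOfLE hle) s').symm
  · obtain ⟨s, rfl⟩ := exists_resApp_eq e h t
    have h1 := (resApp_res e.hom h (homOfLE hle) s).trans ht
    obtain ⟨n, hn⟩ := (hF f).eq_zero s
      ((resApp_bijective e (hle.trans h)).1 (h1.trans (map_zero _).symm))
    exact ⟨n, by rw [← resApp_smul, hn, map_zero]⟩

lemma finite_of_restrictIso {F G : Y.Modules} {U V : Y.Opens} (h : V ≤ U)
    (e : F.restrict U.ι ≅ G.restrict U.ι) (hF : Module.Finite Γ(Y, V) Γ(F, V)) :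
    Module.Finite Γ(Y, V) Γ(G, V) :=
  Module.Finite.of_surjective ({ resApp e.hom h with map_smul' := resApp_smul e.hom h } :
    Γ(F, V) →ₗ[Γ(Y, V)] Γ(G, V)) (resApp_bijective e h).2

/-- The sections over basic open sets are localizations of the sections over `W`, and finite
generation can be checked on localizations at elements generating the unit ideal. -/
lemma finite_of_basicOpen {G : Y.Modules} {W : Y.Opens} (hW : IsAffineOpen W)
    (hG : BasicExtends G W)
    (h : ∀ x ∈ W, ∃ f : Γ(Y, W), x ∈ Y.basicOpen f ∧
      Module.Finite Γ(Y, Y.basicOpen f) Γ(G, Y.basicOpen f)) : Module.Finite Γ(Y, W) Γ(G, W) := by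
  let t : Set Γ(Y, W) := {f | Module.Finite Γ(Y, Y.basicOpen f) Γ(G, Y.basicOpen f)}
  have ht : Ideal.span t = ⊤ := by
    rw [← hW.self_le_iSup_basicOpen_iff]
    intro x hx
    obtain ⟨f, hxf, hf⟩ := h x hx
    exact Opens.mem_iSup.mpr ⟨⟨f, hf⟩, hxf⟩
  let r (g : Γ(Y, W)) : Γ(Y, W) →+* Γ(Y, Y.basicOpen g) :=
    (Y.presheaf.map (homOfLE (Y.basicOpen_le g)).op).hom
  let (g : t) : Algebra Γ(Y, W) Γ(Y, Y.basicOpen g.1) := (r g.1).toAlgebra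
  let (g : t) : Module Γ(Y, W) Γ(G, Y.basicOpen g.1) := Module.compHom _ (r g.1)
  have (g : t) : IsScalarTower Γ(Y, W) Γ(Y, Y.basicOpen g.1) Γ(G, Y.basicOpen g.1) :=
    ⟨fun a b m => mul_smul (r g.1 a) b m⟩
  have (g : t) : IsLocalization.Away g.1 Γ(Y, Y.basicOpen g.1) :=
    hW.isLocalization_of_eq_basicOpen g.1 (homOfLE (Y.basicOpen_le g.1)) rfl
  let φ (g : t) : Γ(G, W) →ₗ[Γ(Y, W)] Γ(G, Y.basicOpen g.1) :=
    { (G.presheaf.map (homOfLE (Y.basicOpen_le g.1)).op).hom with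
      map_smul' := fun a s => G.map_smul (homOfLE (Y.basicOpen_le g.1)) a s }
  have (g : t) : IsLocalizedModule.Away g.1 (φ g) := by
    refine IsLocalizedModule.Away.mk_of_addCommGroup ?_ (fun s => ?_) (hG g.1).eq_zero
    · have h1 : IsUnit (algebraMap Γ(Y, W) Γ(Y, Y.basicOpen g.1) g.1) :=
        IsLocalization.Away.algebraMap_isUnit g.1
      refine (Module.End.isUnit_iff _).mpr ?_
      exact (Module.End.isUnit_iff (algebraMap _ (Module.End Γ(Y, Y.basicOpen g.1)
        Γ(G, Y.basicOpen g.1)) (algebraMap Γ(Y, W) _ g.1))).mp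
        (h1.map (algebraMap _ (Module.End Γ(Y, Y.basicOpen g.1) Γ(G, Y.basicOpen g.1))))
    · obtain ⟨n, t, ht⟩ := (hG g.1).exists_lift s
      exact ⟨n, t, ht.symm⟩
  exact Module.Finite.of_localizationSpan' t ht φ fun g => g.2

/-- Coherence is a local property. -/
lemma IsCoherent.of_locallyIsomorphic {F G : Y.Modules} (hF : IsCoherent F)
    (h : LocallyIsomorphic F G) : IsCoherent G := by
  have hQ : SheafOfModules.IsQuasicoherent (R := Y.ringCatSheaf) G := by
    refine isQuasicoherent_of_basicExtends fun y => ?_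
    obtain ⟨U, hy, ⟨e⟩⟩ := h y
    obtain ⟨W, hW, hyW, hWU⟩ := exists_isAffineOpen_mem_and_subset hy
    exact ⟨W, hyW, hW, (basicExtends_of_isQuasicoherent hF.1 hW).of_restrictIso hWU e⟩
  refine ⟨hQ, fun W => finite_of_basicOpen W.2 (basicExtends_of_isQuasicoherent hQ W.2)
    fun x hx => ?_⟩
  obtain ⟨U, hxU, ⟨e⟩⟩ := h x
  obtain ⟨f, hf, hxf⟩ := W.2.exists_basicOpen_le ⟨x, hxU⟩ hx
  exact ⟨f, hxf, finite_of_restrictIso hf e (hF.2 ⟨_, W.2.basicOpen f⟩)⟩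

end Coherent

end

/-! ### Pure sheaves are torsion-free -/

section

lemma app_map {Y : Scheme.{u}} {F G : Y.Modules} (φ : F ⟶ G) {U V : Y.Opens} (i : V ⟶ U) (s : Γ(F, U)) :
    φ.app V (F.presheaf.map i.op s) = G.presheaf.map i.op (φ.app U s) :=
  NatTrans.naturality_apply φ.mapPresheaf i.op s

variable {X : Scheme.{u}} [IrreducibleSpace X]

variable (X) in
/-- The topological and algebraic properties of a curve that are needed to embed sheaves in the
function ring. -/
structure CurveLike : Prop where
  genInjective : GenInjective X
  isUnit_of_regular : ∀ u : X.functionField, (∀ k, k * u = 0 → k = 0) → IsUnit u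
  isClosed : ∀ x : X, x ≠ genericPoint X → IsClosed {x}
  cofinite : ∀ U : X.Opens, genericPoint X ∈ U → ((U : Set X)ᶜ).Finite
  noeth : ∀ U : X.affineOpens, IsNoetherianRing Γ(X, U.1)

lemma subsingleton_sections (F : X.Modules) {U : X.Opens} (hU : genericPoint X ∉ U) :
    Subsingleton Γ(F, U) :=
  ⟨fun _ _ => eq_of_locally_eq fun _ hx => absurd (generic_mem hx) hU⟩

lemma isUnit_gen {U : X.Opens} (f : Γ(X, U)) {x : X} (hx : x ∈ X.basicOpen f)
    (h : genericPoint X ∈ U) : ∃ r : localRing x, r.1 * gen U h f = 1 := by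
  have hu : IsUnit (X.presheaf.map (homOfLE (X.basicOpen_le f)).op f) :=
    X.toRingedSpace.isUnit_res_basicOpen f
  obtain ⟨b, hb⟩ := hu.exists_left_inv
  refine ⟨⟨_, gen_mem_localRing hx b⟩, ?_⟩
  have h1 := congrArg (gen (X.basicOpen f) (generic_mem hx)) hb
  rw [map_mul, map_one] at h1
  refine Eq.trans ?_ h1
  exact congrArg (_ * ·) (gen_res (homOfLE (X.basicOpen_le f)) (generic_mem hx) f).symm

section Torsion

variable (F : X.Modules)

/-- The germ of a section at the generic point. -/
def genericGerm {U : X.Opens} (h : genericPoint X ∈ U) : Γ(F, U) →+ stalk F (genericPoint X) :=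
  (F.presheaf.germ U (genericPoint X) h).hom

lemma genericGerm_res {U V : X.Opens} (i : V ⟶ U) (h : genericPoint X ∈ V) (s : Γ(F, U)) :
    genericGerm F h (F.presheaf.map i.op s) = genericGerm F (i.le h) s :=
  F.presheaf.germ_res_apply i _ h s

lemma genericGerm_smul {U : X.Opens} (h : genericPoint X ∈ U) (a : Γ(X, U)) (s : Γ(F, U)) :
    genericGerm F h (a • s) = gen U h a • genericGerm F h s :=
  PresheafOfModules.germ_smul (R := X.presheaf) F.val (genericPoint X) U h a s

/-- The subpresheaf of torsion sections. -/
def torsionSubmodule : PresheafOfModules.Submodule F.val where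
  obj U :=
    { carrier := {s | ∀ h : genericPoint X ∈ U.unop, genericGerm F h s = 0}
      add_mem' := fun ha hb h => (map_add (genericGerm F h) _ _).trans (by rw [ha h, hb h, add_zero])
      zero_mem' := fun h => map_zero (genericGerm F h)
      smul_mem' := fun a s hs h => (genericGerm_smul F h a s).trans (by rw [hs h, smul_zero]) }
  map {U V} i s hs h := (genericGerm_res F i.unop h s).trans (hs _)

/-- The sheaf of torsion sections. -/
def torsionSheaf : X.Modules where
  val := (torsionSubmodule F).toPresheafOfModules
  isSheaf := by
    change TopCat.Presheaf.IsSheaf (X := X) (torsionSubmodule F).toPresheafOfModules.presheaf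
    rw [TopCat.Presheaf.isSheaf_iff_isSheaf_comp (forget AddCommGrpCat),
      TopCat.Presheaf.isSheaf_iff_isSheafUniqueGluing_types]
    intro ι U sf hsf
    let sf' (i : ι) : (torsionSubmodule F).obj (op (U i)) := sf i
    obtain ⟨r, hr, hu⟩ := TopCat.Sheaf.existsUnique_gluing ⟨_, F.isSheaf⟩ U
      (fun i => (sf' i).1) (fun i j => congrArg Subtype.val (hsf i j))
    have hmem : r ∈ (torsionSubmodule F).obj (op (iSup U)) := fun h => by
      obtain ⟨i, hi⟩ := Opens.mem_iSup.mp h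
      refine (genericGerm_res F (Opens.leSupr U i) hi r).symm.trans ?_
      exact (congrArg (genericGerm F hi) (hr i)).trans ((sf' i).2 hi)
    refine ⟨(⟨r, hmem⟩ : (torsionSubmodule F).obj (op (iSup U))), fun i => Subtype.ext (hr i),
      fun t ht => Subtype.ext (hu _ fun i => congrArg Subtype.val (ht i))⟩

/-- The inclusion of the torsion sections. -/
def torsionSheafι : torsionSheaf F ⟶ F := ⟨(torsionSubmodule F).ι⟩

lemma torsionSheafι_app_injective (U : X.Opens) :
    Function.Injective ((torsionSheafι F).app U) := fun _ _ h => Subtype.ext h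

lemma torsionSheafι_germ {U : X.Opens} (h : genericPoint X ∈ U) (s : Γ(torsionSheaf F, U)) :
    genericGerm F h ((torsionSheafι F).app U s) = 0 :=
  (show (torsionSubmodule F).obj (op U) from s).2 h

lemma exists_torsion_section {U : X.Opens} (s : Γ(F, U))
    (hs : ∀ h : genericPoint X ∈ U, genericGerm F h s = 0) :
    ∃ t : Γ(torsionSheaf F, U), (torsionSheafι F).app U t = s :=
  ⟨(⟨s, hs⟩ : (torsionSubmodule F).obj (op U)), rfl⟩

instance : Mono (torsionSheafι F) := by
  refine ⟨fun g h e => Scheme.Modules.hom_ext _ _ fun U => ?_⟩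
  ext s
  exact torsionSheafι_app_injective F U
    (congrArg (fun φ : _ ⟶ F => φ.app U s) e)

/-- A torsion section over the basic open set of `f`, times a power of `f`, extends to a section of
`F` whose generic germ is still zero, hence to a torsion section. Finiteness passes to submodules
because the coordinate rings are Noetherian. -/
lemma torsionSheaf_isCoherent (hX : CurveLike X) (hF : IsCoherent F) :
    IsCoherent (torsionSheaf F) := by
  constructor
  · refine isQuasicoherent_of_basicExtends fun y => ?_
    obtain ⟨W, hW, hyW, -⟩ := exists_isAffineOpen_mem_and_subset (U := ⊤) (x := y) trivial
    refine ⟨W, hyW, hW, fun f => ⟨fun s => ?_, fun t ht => ?_⟩⟩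
    · by_cases hη : genericPoint X ∈ X.basicOpen f
      · obtain ⟨n, t, ht⟩ := (basicExtends_of_isQuasicoherent hF.1 hW f).exists_lift
          ((torsionSheafι F).app _ s)
        obtain ⟨t', rfl⟩ := exists_torsion_section F t fun h => by
          rw [← genericGerm_res F (homOfLE (X.basicOpen_le f)) hη, ht, genericGerm_smul,
            torsionSheafι_germ, smul_zero]
        refine ⟨n, t', torsionSheafι_app_injective F _ ?_⟩
        rw [app_map, ht, Scheme.Modules.Hom.app_smul]
      · have := subsingleton_sections (torsionSheaf F) hη
        exact ⟨0, 0, Subsingleton.elim _ _⟩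
    · have h1 := (app_map (torsionSheafι F) (homOfLE (X.basicOpen_le f)) t).symm
      rw [ht, map_zero] at h1
      obtain ⟨n, hn⟩ := (basicExtends_of_isQuasicoherent hF.1 hW f).eq_zero _ h1
      refine ⟨n, torsionSheafι_app_injective F _ ?_⟩
      rw [Scheme.Modules.Hom.app_smul, hn, map_zero]
  · intro U
    have := hX.noeth U
    have := hF.2 U
    exact Module.Finite.of_injective
      ({ ((torsionSheafι F).app U.1).hom with map_smul' := (torsionSheafι F).app_smul } :
        Γ(torsionSheaf F, U.1) →ₗ[Γ(X, U.1)] Γ(F, U.1)) (torsionSheafι_app_injective F U.1)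

/-- Over an affine neighbourhood of the generic point the torsion has finitely many generators, and
each of them vanishes near that point. On the common open set every germ of the torsion is, up to a
unit, the germ of a section over the affine open set, hence zero. -/
lemma torsionSheaf_support_finite (hX : CurveLike X) (hF : IsCoherent F) :
    ∃ V : X.Opens, genericPoint X ∈ V ∧ ∀ x ∈ V, x ∉ support (torsionSheaf F) := by
  have hT := torsionSheaf_isCoherent F hX hF
  obtain ⟨W, hW, hηW, -⟩ :=
    exists_isAffineOpen_mem_and_subset (U := ⊤) (x := genericPoint X) trivial
  obtain ⟨S, hS⟩ := (hT.2 ⟨W, hW⟩).fg_top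
  have h1 : ∀ s : Γ(torsionSheaf F, W), ∃ V : X.Opens, genericPoint X ∈ V ∧
      (torsionSheaf F).presheaf.map (homOfLE (inf_le_right : V ⊓ W ≤ W)).op s = 0 := by
    intro s
    obtain ⟨V, hV, i, j, hij⟩ := F.presheaf.germ_eq (genericPoint X) hηW hηW
      ((torsionSheafι F).app W s) 0 ((torsionSheafι_germ F hηW s).trans (map_zero _).symm)
    refine ⟨V, hV, torsionSheafι_app_injective F _ ?_⟩
    rw [app_map, map_zero]
    rw [map_zero] at hij
    have h2 := congrArg (F.presheaf.map (homOfLE (inf_le_left : V ⊓ W ≤ V)).op) hij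
    rw [map_zero] at h2
    exact (map_map_apply i _ _).symm.trans h2
  choose V hV hVs using h1
  let V₀ : X.Opens := S.inf V ⊓ W
  have hηV₀ : genericPoint X ∈ V₀ := by
    refine ⟨?_, hηW⟩
    rw [Opens.coe_finset_inf, Finset.inf_eq_iInf]
    exact Set.mem_iInter₂.mpr fun i _ => hV i
  have h2 : ∀ s : Γ(torsionSheaf F, W),
      (torsionSheaf F).presheaf.map (homOfLE (inf_le_right : V₀ ≤ W)).op s = 0 := by
    intro s
    have hs : s ∈ Submodule.span Γ(X, W) (S : Set Γ(torsionSheaf F, W)) := hS ▸ Submodule.mem_top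
    induction hs using Submodule.span_induction with
    | mem s hs =>
      let i : V₀ ⟶ V s ⊓ W := homOfLE (inf_le_inf_right _ (Finset.inf_le hs))
      have h3 := congrArg ((torsionSheaf F).presheaf.map i.op) (hVs s)
      rw [map_zero] at h3
      exact (map_map_apply _ i _).symm.trans h3
    | zero => exact map_zero _
    | add s t _ _ hs ht => rw [map_add, hs, ht, add_zero]
    | smul a s _ hs => rw [Scheme.Modules.map_smul, hs, smul_zero]
  refine ⟨V₀, hηV₀, fun x hx hsupp => ?_⟩
  have : Nontrivial (stalk (torsionSheaf F) x) := hsupp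
  obtain ⟨t, ht⟩ := exists_ne (0 : stalk (torsionSheaf F) x)
  refine ht ?_
  obtain ⟨U, hUV, hxU, s, rfl⟩ := (torsionSheaf F).presheaf.exists_le_germ_eq t hx
  obtain ⟨f, hfU, hxf⟩ := hW.exists_basicOpen_le ⟨x, hxU⟩ hx.2
  let i : X.basicOpen f ⟶ U := homOfLE hfU
  obtain ⟨n, t, ht⟩ := (basicExtends_of_isQuasicoherent hT.1 hW f).exists_lift
    ((torsionSheaf F).presheaf.map i.op s)
  have h3 := congrArg ((torsionSheaf F).presheaf.map (homOfLE (hfU.trans hUV) : X.basicOpen f ⟶ V₀).op)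
    (h2 t)
  rw [map_zero, map_map_apply] at h3
  have h4 := ht.symm.trans h3
  have hu : IsUnit (X.presheaf.map (homOfLE (X.basicOpen_le f)).op (f ^ n)) := by
    rw [map_pow]
    exact (X.toRingedSpace.isUnit_res_basicOpen f).pow n
  have h5 := (hu.smul_eq_zero).mp h4
  refine ((torsionSheaf F).presheaf.germ_res_apply i x hxf s).symm.trans ?_
  exact (congrArg ((torsionSheaf F).presheaf.germ _ x hxf) h5).trans (map_zero _)

variable {F} in
/-- A pure sheaf on a curve is torsion-free. -/
lemma IsPure.genericGerm_injective (hX : CurveLike X) (hF : IsPure F) {U : X.Opens}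
    (h : genericPoint X ∈ U) : Function.Injective (genericGerm F h) := by
  refine (injective_iff_map_eq_zero _).mpr fun s hs => ?_
  obtain ⟨t, rfl⟩ := exists_torsion_section F s fun _ => hs
  by_contra hne
  have hz : ¬ Limits.IsZero (torsionSheaf F) := fun hz => by
    refine hne ?_
    have h1 := (Limits.IsZero.iff_id_eq_zero _).mp hz
    have h2 : t = 0 := congrArg (fun φ : torsionSheaf F ⟶ torsionSheaf F => φ.app U t) h1
    rw [h2, map_zero]
  have hdim := hF.dim_sub _ (torsionSheafι F) inferInstance
    (torsionSheaf_isCoherent F hX hF.coherent) hz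
  obtain ⟨V, hV, hsupp⟩ := torsionSheaf_support_finite F hX hF.coherent
  have hfin : (support (torsionSheaf F)).Finite :=
    (hX.cofinite V hV).subset fun x hx hxV => hsupp x hxV hx
  -- A finite set of closed points is discrete, hence of dimension 0 at most, whereas purity would
  -- give the nonzero subsheaf of torsion sections dimension 1.
  have : Finite (support (torsionSheaf F)) := hfin
  have : T1Space (support (torsionSheaf F)) := by
    refine ⟨fun x => ?_⟩
    have h1 := (hX.isClosed x.1 fun e => hsupp _ hV (e ▸ x.2)).preimage
      (continuous_subtype_val (p := (· ∈ support (torsionSheaf F))))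
    convert h1 using 1
    ext y
    exact Subtype.ext_iff
  have h0 := topologicalKrullDim_zero_of_discreteTopology (support (torsionSheaf F))
  rw [show topologicalKrullDim (support (torsionSheaf F)) = 1 from hdim] at h0
  exact absurd h0 (by decide)

end Torsion

end

/-! ### Generalized line bundles as good families -/

section

variable {X : Scheme.{u}} [IrreducibleSpace X]

/-- The families that define generalized line bundles: they are finitely generated, spread out, and
agree with the local rings on a nonempty open set. -/
structure IsGood (M : Family X) : Prop where
  spread : Spread M
  fg : ∀ x, (M x).FG
  eq_one : ∃ V : X.Opens, genericPoint X ∈ V ∧ ∀ x ∈ V, M x = (1 : Family X) x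

namespace RatEmb

variable {F : X.Modules} (χ : RatEmb F)

lemma mem_fam_iff {x : X} {W : X.Opens} (hW : IsAffineOpen W) (hF : BasicExtends F W) (hx : x ∈ W)
    {k : X.functionField} : k ∈ χ.fam x ↔
      ∃ (r : localRing x) (s : Γ(F, W)), k = r * χ.val W (generic_mem hx) s := by
  constructor
  · rintro ⟨U, hxU, s, rfl⟩
    obtain ⟨f, hfU, hxf⟩ := hW.exists_basicOpen_le ⟨x, hxU⟩ hx
    obtain ⟨n, t, ht⟩ := (hF f).exists_lift (F.presheaf.map (homOfLE hfU).op s)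
    obtain ⟨r, hr⟩ := isUnit_gen f hxf (generic_mem hx)
    refine ⟨r ^ n, t, ?_⟩
    have h1 := congrArg (χ.val _ (generic_mem hxf)) ht
    rw [χ.val_smul, χ.val_res, χ.val_res, gen_res, map_pow] at h1
    rw [h1, ← mul_assoc, SubmonoidClass.coe_pow, ← mul_pow, hr, one_pow, one_mul]
  · rintro ⟨r, s, rfl⟩
    exact (χ.fam x).smul_mem r ⟨W, hx, s, rfl⟩

/-- Germs of a quasi-coherent sheaf are sections over `W` up to denominators, and these denominators
are units at `x`. -/
lemma fam_eq_span {x : X} {W : X.Opens} (hW : IsAffineOpen W) (hF : BasicExtends F W) (hx : x ∈ W)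
    {S : Set Γ(F, W)} (hS : Submodule.span Γ(X, W) S = ⊤) :
    χ.fam x = Submodule.span (localRing x) (χ.val W (generic_mem hx) '' S) := by
  apply le_antisymm
  · intro k hk
    obtain ⟨r, s, rfl⟩ := (χ.mem_fam_iff hW hF hx).mp hk
    refine Submodule.smul_mem _ r ?_
    have hs : s ∈ Submodule.span Γ(X, W) S := hS ▸ Submodule.mem_top
    induction hs using Submodule.span_induction with
    | mem s hs => exact Submodule.subset_span ⟨s, hs, rfl⟩
    | zero => rw [map_zero]; exact zero_mem _
    | add s t _ _ hs ht =>
      rw [map_add]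
      exact add_mem (hs (Submodule.smul_mem _ _ ⟨_, hx, s, rfl⟩))
        (ht (Submodule.smul_mem _ _ ⟨_, hx, t, rfl⟩))
    | smul a s _ hs =>
      rw [χ.val_smul]
      exact Submodule.smul_mem _ (⟨_, gen_mem_localRing hx a⟩ : localRing x)
        (hs (Submodule.smul_mem _ _ ⟨_, hx, s, rfl⟩))
  · rw [Submodule.span_le]
    rintro _ ⟨s, -, rfl⟩
    exact ⟨W, hx, s, rfl⟩

/-- Finitely many generators near the generic point are all regular on some smaller open set, and 1
is a section near that point; together these give the equality with the local rings. -/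
lemma isGood (hF : IsCoherent F) (h1 : (1 : X.functionField) ∈ χ.fam (genericPoint X)) :
    IsGood χ.fam where
  spread := χ.spread
  fg x := by
    obtain ⟨W, hW, hx, -⟩ := exists_isAffineOpen_mem_and_subset (U := ⊤) (x := x) trivial
    obtain ⟨S, hS⟩ := (hF.2 ⟨W, hW⟩).fg_top
    rw [χ.fam_eq_span hW (basicExtends_of_isQuasicoherent hF.1 hW) hx hS]
    exact Submodule.fg_span (S.finite_toSet.image _)
  eq_one := by
    obtain ⟨W, hW, hx, -⟩ :=
      exists_isAffineOpen_mem_and_subset (U := ⊤) (x := genericPoint X) trivial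
    obtain ⟨S, hS⟩ := (hF.2 ⟨W, hW⟩).fg_top
    obtain ⟨V, hV, hV1⟩ := χ.spread _ _ h1
    have h2 : ∀ s : Γ(F, W), ∃ V : X.Opens, genericPoint X ∈ V ∧
        ∀ x ∈ V, χ.val W hx s ∈ localRing x := by
      intro s
      obtain ⟨V, hV, a, ha⟩ := exists_gen_eq (χ.val W hx s)
      exact ⟨V, hV, fun x hx => ha ▸ gen_mem_localRing hx a⟩
    choose V' hV' hs using h2
    refine ⟨V ⊓ (S.inf V' ⊓ W), ⟨hV, ?_, hx⟩, fun x hx => ?_⟩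
    · rw [Opens.coe_finset_inf, Finset.inf_eq_iInf]
      exact Set.mem_iInter₂.mpr fun i _ => hV' i
    · apply le_antisymm
      · rw [χ.fam_eq_span hW (basicExtends_of_isQuasicoherent hF.1 hW) hx.2.2 hS, Submodule.span_le]
        rintro _ ⟨s, hsS, rfl⟩
        exact mem_one_iff.mpr (hs s x ((Finset.inf_le hsS : S.inf V' ≤ V' s) hx.2.1))
      · rw [one_eq_prin]
        exact (Submodule.span_singleton_le_iff_mem _ _).mpr (hV1 x hx.1)

/-- The embedding of a sheaf that is mapped injectively to an embedded sheaf. -/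
def comp {G : X.Modules} (φ : G ⟶ F) (h : ∀ U, Function.Injective (φ.app U)) : RatEmb G where
  val U hU := (χ.val U hU).comp (φ.app U).hom
  val_smul U hU a s := (congrArg (χ.val U hU) (φ.app_smul a s)).trans (χ.val_smul U hU a _)
  val_res U V i hV s := (congrArg (χ.val V hV) (app_map φ i s)).trans (χ.val_res U V i hV _)
  val_inj U hU := (χ.val_inj U hU).comp (h U)

-- By irreducibility a nonzero section, multiplied by a denominator, extends to an affine
-- neighbourhood of any given point. Its germ there cannot vanish, since its value in the function
-- ring is not zero.
include χ in
lemma support_eq_univ (hF : IsCoherent F) {U : X.Opens} {s : Γ(F, U)} (hs : s ≠ 0) :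
    support F = Set.univ := by
  refine Set.eq_univ_of_forall fun x => ?_
  have hU : genericPoint X ∈ U := by
    by_contra h
    have := subsingleton_sections F h
    exact hs (Subsingleton.elim _ _)
  obtain ⟨W, hW, hx, -⟩ := exists_isAffineOpen_mem_and_subset (U := ⊤) (x := x) trivial
  have hηW : genericPoint X ∈ W := generic_mem hx
  obtain ⟨f, hfU, hηf⟩ := hW.exists_basicOpen_le ⟨genericPoint X, hU⟩ hηW
  obtain ⟨n, t, ht⟩ := (basicExtends_of_isQuasicoherent hF.1 hW f).exists_lift
    (F.presheaf.map (homOfLE hfU).op s)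
  obtain ⟨r, hr⟩ := isUnit_gen f hηf hηW
  have h1 := congrArg (χ.val _ hηf) ht
  rw [χ.val_smul, χ.val_res, χ.val_res, gen_res, map_pow] at h1
  refine ⟨⟨F.presheaf.germ W x hx t, 0, fun h0 => ?_⟩⟩
  obtain ⟨V, hV, i, j, hij⟩ := F.presheaf.germ_eq x hx hx t 0 (h0.trans (map_zero _).symm)
  have h2 := congrArg (χ.val V (generic_mem hV)) hij
  rw [χ.val_res, map_zero, map_zero] at h2
  rw [h2] at h1
  refine hs ((injective_iff_map_eq_zero _).mp (χ.val_inj U hU) s ?_)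
  have h3 := congrArg (r.1 ^ n * ·) h1
  simp only [mul_zero] at h3
  rw [← mul_assoc, ← mul_pow, hr, one_pow, one_mul] at h3
  exact h3.symm

/-- The embedding on the stalk at the generic point. -/
lemma exists_stalkEquiv (h : ∀ k, k ∈ χ.fam (genericPoint X)) :
    Nonempty (stalk F (genericPoint X) ≃ₗ[X.presheaf.stalk (genericPoint X)]
      X.presheaf.stalk (genericPoint X)) := by
  choose U hU s hs using fun t : stalk F (genericPoint X) => F.presheaf.exists_germ_eq t
  let θ (t : stalk F (genericPoint X)) : X.functionField := χ.val (U t) (hU t) (s t)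
  have hθ : ∀ (V : X.Opens) (hV : genericPoint X ∈ V) (a : Γ(F, V)),
      θ (genericGerm F hV a) = χ.val V hV a := by
    intro V hV a
    obtain ⟨W, hW, i, j, hij⟩ := F.presheaf.germ_eq (genericPoint X) (hU _) hV
      (s (genericGerm F hV a)) a (hs _)
    have h2 := congrArg (χ.val W hW) hij
    rwa [χ.val_res, χ.val_res] at h2
  have hadd : ∀ t t', θ (t + t') = θ t + θ t' := by
    intro t t'
    obtain ⟨V, hV, a, rfl⟩ := F.presheaf.exists_germ_eq t
    obtain ⟨V', hV', a', rfl⟩ := F.presheaf.exists_germ_eq t'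
    have hVV : genericPoint X ∈ V ⊓ V' := ⟨hV, hV'⟩
    have e1 : genericGerm F hVV
        (F.presheaf.map (homOfLE inf_le_left).op a + F.presheaf.map (homOfLE inf_le_right).op a') =
        genericGerm F hV a + genericGerm F hV' a' := by
      rw [map_add, genericGerm_res, genericGerm_res]
    refine (congrArg θ e1).symm.trans ((hθ _ _ _).trans ?_)
    rw [map_add, χ.val_res, χ.val_res]
    exact congrArg₂ (· + ·) (hθ V hV a).symm (hθ V' hV' a').symm
  have hsmul : ∀ (k : X.presheaf.stalk (genericPoint X)) t, θ (k • t) = k • θ t := by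
    intro k t
    obtain ⟨V, hV, a, rfl⟩ := F.presheaf.exists_germ_eq t
    obtain ⟨V', hV', b, rfl⟩ := exists_gen_eq k
    have hVV : genericPoint X ∈ V ⊓ V' := ⟨hV, hV'⟩
    have e1 : genericGerm F hVV
        (X.presheaf.map (homOfLE (inf_le_right : V ⊓ V' ≤ V')).op b •
          F.presheaf.map (homOfLE (inf_le_left : V ⊓ V' ≤ V)).op a) =
        gen V' hV' b • genericGerm F hV a := by
      rw [genericGerm_smul, genericGerm_res, gen_res]
    refine (congrArg θ e1).symm.trans ((hθ _ _ _).trans ?_)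
    rw [χ.val_smul, χ.val_res, gen_res]
    exact congrArg (gen V' hV' b * ·) (hθ V hV a).symm
  refine ⟨LinearEquiv.ofBijective { toFun := θ, map_add' := hadd, map_smul' := hsmul } ⟨?_, ?_⟩⟩
  · refine (injective_iff_map_eq_zero _).mpr fun t ht => ?_
    obtain ⟨V, hV, a, rfl⟩ := F.presheaf.exists_germ_eq t
    have h0 : χ.val V hV a = 0 := (hθ V hV a).symm.trans ht
    rw [(injective_iff_map_eq_zero _).mp (χ.val_inj V hV) a h0, map_zero]
  · intro k
    obtain ⟨V, hV, a, ha⟩ := h k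
    exact ⟨genericGerm F hV a, (hθ V hV a).trans ha⟩

end RatEmb

lemma app_injective_of_mono {Y : Scheme.{u}} {F G : Y.Modules} (φ : F ⟶ G) [Mono φ] (U : Y.Opens) :
    Function.Injective (φ.app U) := by
  have h1 : Mono ((Scheme.Modules.toPresheafOfModules Y).map φ) := inferInstance
  exact @PresheafOfModules.injective_of_mono _ _ _ _ _ φ.val h1 (op U)

/-- A generalized line bundle is the sheaf of a good family. -/
lemma IsGeneralizedLineBundle.exists_fam (hX : CurveLike X) {F : X.Modules}
    (hF : IsGeneralizedLineBundle F) : ∃ M : Family X, IsGood M ∧ Nonempty (F ≅ famSheaf M) := by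
  obtain ⟨θ⟩ := hF.generic
  let χ : RatEmb F :=
    { val := fun U h => θ.toAddEquiv.toAddMonoidHom.comp (genericGerm F h)
      val_smul := fun U h a s => (congrArg θ (genericGerm_smul F h a s)).trans (θ.map_smul _ _)
      val_res := fun U V i h s => congrArg θ (genericGerm_res F i h s)
      val_inj := fun U h => θ.injective.comp (hF.pure.genericGerm_injective hX h) }
  refine ⟨χ.fam, χ.isGood hF.pure.coherent ?_, ⟨χ.isoFam⟩⟩
  obtain ⟨U, hU, s, hs⟩ := F.presheaf.exists_germ_eq (θ.symm 1)
  exact ⟨U, hU, s, (congrArg θ hs).trans (θ.apply_symm_apply 1)⟩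

/-- The embedding of the sheaf of a family. -/
def famEmb (M : Family X) : RatEmb (famSheaf M) where
  val _ h := famVal M h
  val_smul _ h a s := famVal_smul M h a s
  val_res _ _ i h s := famVal_res M i h s
  val_inj _ h := famVal_injective M h

lemma famEmb_fam {M : Family X} (hM : Spread M) : (famEmb M).fam = M := by
  funext x
  ext k
  constructor
  · rintro ⟨U, hx, s, rfl⟩
    exact famVal_mem M hx s
  · intro hk
    obtain ⟨U, hx, h⟩ := hM x k hk
    exact ⟨U, hx, famConst M U k h, rfl⟩

lemma localRing_genericPoint (k : X.functionField) : k ∈ localRing (genericPoint X) := by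
  obtain ⟨U, h, a, rfl⟩ := exists_gen_eq k
  exact gen_mem_localRing h a

lemma IsGood.mem_genericPoint {M : Family X} (hM : IsGood M) (k : X.functionField) :
    k ∈ M (genericPoint X) := by
  obtain ⟨V, hV, h⟩ := hM.eq_one
  rw [h _ hV, mem_one_iff]
  exact localRing_genericPoint k

/-- This allows a proof to replace a spread-out family by the family of germs of an embedding, so
that the coherence of `F` can be used on it. -/
lemma exists_ratEmb_of_iso {M : Family X} (hM : Spread M) {F : X.Modules} (e : F ≅ famSheaf M) :
    ∃ χ : RatEmb F, χ.fam = M := by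
  have hb : ∀ U, Function.Bijective (e.hom.app U) := fun U =>
    ConcreteCategory.bijective_of_isIso (e.hom.app U)
  refine ⟨(famEmb M).comp e.hom fun U => (hb U).1, Eq.trans ?_ (famEmb_fam hM)⟩
  funext x
  ext k
  constructor
  · rintro ⟨U, hx, s, rfl⟩
    exact ⟨U, hx, e.hom.app U s, rfl⟩
  · rintro ⟨U, hx, s, rfl⟩
    obtain ⟨t, rfl⟩ := (hb U).2 s
    exact ⟨U, hx, t, rfl⟩

lemma RatEmb.support_eq_univ_of_isGood {F : X.Modules} (χ : RatEmb F) (h : IsGood χ.fam)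
    (hF : IsCoherent F) : support F = Set.univ := by
  obtain ⟨U, hU, s, hs⟩ := h.mem_genericPoint 1
  refine χ.support_eq_univ hF (s := s) fun h0 => ?_
  rw [h0, map_zero] at hs
  exact zero_ne_one hs

/-- A coherent sheaf isomorphic to the sheaf of a good family is a generalized line bundle, if the
curve carries a generalized line bundle at all. -/
lemma IsGood.isGeneralizedLineBundle {M : Family X} (hM : IsGood M) {F F₀ : X.Modules}
    (hF₀ : IsGeneralizedLineBundle F₀) (hX : CurveLike X) (hF : IsCoherent F) (e : F ≅ famSheaf M) :
    IsGeneralizedLineBundle F := by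
  -- The dimension of the curve is not computed but read off from `F₀`, which is pure of dimension 1
  -- and supported everywhere.
  have hdim : topologicalKrullDim (Set.univ : Set X) = 1 := by
    obtain ⟨M₀, hM₀, ⟨e₀⟩⟩ := hF₀.exists_fam hX
    obtain ⟨χ₀, rfl⟩ := exists_ratEmb_of_iso hM₀.spread e₀
    have h := hF₀.pure.dim_eq
    rwa [dim, χ₀.support_eq_univ_of_isGood hM₀ hF₀.pure.coherent] at h
  obtain ⟨χ, rfl⟩ := exists_ratEmb_of_iso hM.spread e
  refine ⟨⟨hF, ?_, fun G i _ hG hz => ?_⟩, χ.exists_stalkEquiv hM.mem_genericPoint⟩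
  · rwa [dim, χ.support_eq_univ_of_isGood hM hF]
  -- A nonzero coherent subsheaf is embedded in the function ring as well, so its support is again
  -- the whole curve.
  · obtain ⟨U, s, hs⟩ : ∃ (U : X.Opens) (s : Γ(G, U)), s ≠ 0 := by
      by_contra! h
      refine hz ((Limits.IsZero.iff_id_eq_zero _).mpr (Scheme.Modules.hom_ext _ _ fun U => ?_))
      ext s
      rw [h U s, map_zero, map_zero]
    rwa [dim, (χ.comp i (app_injective_of_mono i)).support_eq_univ hG hs]

end

/-! ### Local algebra: moving a submodule of the function ring into the local ring -/

section

section LocalAlgebra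

variable {K : Type u} [CommRing K]

/-- The maximal ideal of the local ring `K` is generated by an element `y` of nilpotency order `n`. -/
structure NilpotentGenerator (y : K) (n : ℕ) : Prop where
  isUnit_or : ∀ k : K, IsUnit k ∨ y ∣ k
  pow_eq_zero : y ^ n = 0
  pow_ne_zero : y ^ (n - 1) ≠ 0

namespace NilpotentGenerator

variable {y : K} {n : ℕ} (hy : NilpotentGenerator y n)

include hy

/-- Subtraction is truncated: for `n = 0` the two conditions on powers both concern `y ^ 0` and
contradict each other. -/
lemma one_le : 1 ≤ n := by
  by_contra h
  have hn : n = 0 := by omega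
  have h1 := hy.pow_eq_zero
  have h2 := hy.pow_ne_zero
  subst hn
  exact h2 h1

lemma pow_eq_zero_of_le {i : ℕ} (hi : n ≤ i) : y ^ i = 0 := by
  obtain ⟨j, rfl⟩ := Nat.exists_eq_add_of_le hi
  rw [pow_add, hy.pow_eq_zero, zero_mul]

lemma pow_ne_zero_of_lt {i : ℕ} (hi : i < n) : y ^ i ≠ 0 := by
  intro h
  refine hy.pow_ne_zero ?_
  obtain ⟨j, hj⟩ := Nat.exists_eq_add_of_le (show i ≤ n - 1 by omega)
  rw [hj, pow_add, h, zero_mul]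

lemma isUnit_iff [Nontrivial K] (k : K) : IsUnit k ↔ ¬ y ∣ k := by
  refine ⟨fun h hd => ?_, fun h => (hy.isUnit_or k).resolve_right h⟩
  have h1 := (isUnit_of_dvd_unit hd h).pow n
  rw [hy.pow_eq_zero] at h1
  exact not_isUnit_zero h1

/-- An element of `K` that is not a unit is a multiple of `y`, so powers of `y` can be split off `k`
one by one. A unit cofactor would make a power of `y` below the `n`-th vanish. -/
lemma dvd_of_pow_mul_eq_zero {j : ℕ} {k : K} (h : y ^ j * k = 0) : y ^ (n - j) ∣ k := by
  have key : ∀ i, i ≤ n - j → y ^ i ∣ k := by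
    intro i
    induction i with
    | zero => intro _; rw [pow_zero]; exact one_dvd k
    | succ i ih =>
      intro hi
      obtain ⟨k', rfl⟩ := ih (by omega)
      rw [← mul_assoc, ← pow_add] at h
      rcases hy.isUnit_or k' with hu | ⟨k'', rfl⟩
      · exact absurd ((hu.mul_left_eq_zero).mp h) (hy.pow_ne_zero_of_lt (by omega))
      · exact ⟨k'', by rw [pow_succ, mul_assoc]⟩
  exact key _ le_rfl

lemma isUnit_one_add {t : K} (h : y ∣ t) : IsUnit (1 + t) := by
  obtain ⟨z, rfl⟩ := h
  refine IsNilpotent.isUnit_one_add ⟨n, ?_⟩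
  rw [mul_pow, hy.pow_eq_zero, zero_mul]

end NilpotentGenerator

/-- The image of the local ring of a point in the function ring: it is Noetherian, a valuation ring
modulo the maximal ideal of `K`, and this ideal and its intersection with the subring have a
common generator. -/
structure LocalData (R : Subring K) (y : K) (n : ℕ) : Prop extends NilpotentGenerator y n where
  noeth : IsNoetherianRing R
  val : ∀ k : K, (∃ r ∈ R, y ∣ k - r) ∨ ∃ r ∈ R, y ∣ k * r - 1
  mem : y ∈ R
  dvd : ∀ r ∈ R, y ∣ r → ∃ s ∈ R, r = y * s

namespace LocalData

variable {R : Subring K} {y : K} {n : ℕ} (hR : LocalData R y n)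

include hR

/-- Induction on `i` from the case of one factor: if `y ^ i * s = y ^ (i + 1) * z`, then `s - y * z`
is killed by `y ^ i` with `i < n`, hence is divisible by `y`, and so is `s`. -/
lemma pow_dvd {r : K} (hr : r ∈ R) {i : ℕ} (hi : i < n) (h : y ^ i ∣ r) : ∃ s ∈ R, r = y ^ i * s := by
  induction i with
  | zero => exact ⟨r, hr, by rw [pow_zero, one_mul]⟩
  | succ i ih =>
    obtain ⟨z, hz⟩ := h
    obtain ⟨s, hs, e⟩ := ih (by omega) ⟨y * z, by rw [hz, pow_succ, mul_assoc]⟩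
    have h0 : y ^ i * (s - y * z) = 0 := by rw [mul_sub, ← e, hz]; ring
    have h1 : y ∣ s := by
      have h2 := (dvd_pow_self y (by omega : n - i ≠ 0)).trans (hR.dvd_of_pow_mul_eq_zero h0)
      exact (dvd_sub_left (Dvd.intro _ rfl)).mp h2
    obtain ⟨t, ht, rfl⟩ := hR.dvd s hs h1
    exact ⟨t, ht, by rw [e, pow_succ, mul_assoc]⟩

/-- Modulo `y ^ (i + 1)` the elements of `N` lie in a space of dimension at most one over the
residue field of `K`, on which `R` acts through a valuation ring of that field. Finitely generated
submodules there are cyclic: of two generators one divides the other, by `val` applied to the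
quotient of their leading coefficients `b` and `a`. -/
lemma exists_generator {i : ℕ} (N : Submodule R K) (hN : N.FG) (h : ∀ k ∈ N, y ^ i ∣ k) :
    ∃ e ∈ N, ∀ k ∈ N, ∃ r ∈ R, y ^ (i + 1) ∣ k - r * e := by
  induction N, hN using Submodule.fg_induction with
  | singleton x =>
    refine ⟨x, Submodule.mem_span_singleton_self x, fun k hk => ?_⟩
    obtain ⟨r, rfl⟩ := Submodule.mem_span_singleton.mp hk
    exact ⟨r, r.2, by rw [Subring.smul_def, smul_eq_mul, sub_self]; exact dvd_zero _⟩
  | sup N₁ N₂ _ _ h₁ h₂ =>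
    obtain ⟨e₁, he₁, h₁⟩ := h₁ fun k hk => h k (Submodule.mem_sup_left hk)
    obtain ⟨e₂, he₂, h₂⟩ := h₂ fun k hk => h k (Submodule.mem_sup_right hk)
    have key : (∃ r ∈ R, y ^ (i + 1) ∣ e₂ - r * e₁) ∨ (∃ r ∈ R, y ^ (i + 1) ∣ e₁ - r * e₂) := by
      obtain ⟨a, ha⟩ := h e₁ (Submodule.mem_sup_left he₁)
      obtain ⟨b, hb⟩ := h e₂ (Submodule.mem_sup_right he₂)
      rcases hR.isUnit_or a with ⟨a, rfl⟩ | ⟨a, rfl⟩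
      · rcases hR.val (b * (a⁻¹ : Kˣ)) with ⟨r, hr, z, hz⟩ | ⟨r, hr, z, hz⟩
        · refine Or.inl ⟨r, hr, z * a, ?_⟩
          have h1 : b - r * a = y * z * a := by
            rw [← hz, sub_mul, mul_assoc, Units.inv_mul, mul_one]
          rw [ha, hb]
          linear_combination y ^ i * h1
        · refine Or.inr ⟨r, hr, - z * a, ?_⟩
          have h1 : b * r - a = y * z * a := by
            rw [← hz, sub_mul, one_mul, mul_right_comm, mul_assoc b, Units.inv_mul, mul_one]
          rw [ha, hb]
          linear_combination - y ^ i * h1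
      · refine Or.inr ⟨0, zero_mem _, a, ?_⟩
        rw [ha, zero_mul, sub_zero, pow_succ, mul_assoc]
    rcases key with ⟨r, hr, hd⟩ | ⟨r, hr, hd⟩
    · refine ⟨e₁, Submodule.mem_sup_left he₁, fun k hk => ?_⟩
      obtain ⟨k₁, hk₁, k₂, hk₂, rfl⟩ := Submodule.mem_sup.mp hk
      obtain ⟨r₁, hr₁, hd₁⟩ := h₁ k₁ hk₁
      obtain ⟨r₂, hr₂, hd₂⟩ := h₂ k₂ hk₂
      refine ⟨r₁ + r₂ * r, add_mem hr₁ (mul_mem hr₂ hr), ?_⟩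
      have := (hd₁.add hd₂).add (hd.mul_left r₂)
      convert! this using 1; ring
    · refine ⟨e₂, Submodule.mem_sup_right he₂, fun k hk => ?_⟩
      obtain ⟨k₁, hk₁, k₂, hk₂, rfl⟩ := Submodule.mem_sup.mp hk
      obtain ⟨r₁, hr₁, hd₁⟩ := h₁ k₁ hk₁
      obtain ⟨r₂, hr₂, hd₂⟩ := h₂ k₂ hk₂
      refine ⟨r₂ + r₁ * r, add_mem hr₂ (mul_mem hr₁ hr), ?_⟩
      have := (hd₁.add hd₂).add (hd.mul_left r₁)
      convert! this using 1; ring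

/-- A finitely generated submodule that contains a unit can be multiplied by a unit of `K` into `R`,
in such a way that it contains the annihilator of `y`. -/
lemma exists_unit_mul {M : Submodule R K} (hM : M.FG) (w : Kˣ) (hw : (w : K) ∈ M) :
    ∃ g : Kˣ, (∀ k ∈ M, g * k ∈ R) ∧ ∃ k ∈ M, g * k = y ^ (n - 1) := by
  have := hR.noeth
  have : Module.Finite R M := .of_fg hM
  have hn := hR.one_le
  have hy : ∀ i, ∀ k ∈ M, y ^ i * k ∈ M := fun i k hk =>
    M.smul_mem (⟨y ^ i, pow_mem hR.mem i⟩ : R) hk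
  let D (i : ℕ) : Submodule R K :=
    { carrier := {k | y ^ i ∣ k}
      add_mem' := dvd_add
      zero_mem' := dvd_zero _
      smul_mem' := fun r k hk => Dvd.dvd.mul_left hk (r : K) }
  -- The level `i` of the filtration of `M` by multiples of powers of `y` is generated, modulo the
  -- next level, by some `y ^ i * ε`. If `ε` were not a unit, then `y ^ i * w`, which lies in this
  -- level, would be divisible by `y ^ (i + 1)`; this is impossible as `w` is a unit and `i < n`.
  have hgen : ∀ i < n, ∃ ε : Kˣ, y ^ i * ε ∈ M ∧
      ∀ k ∈ M, y ^ i ∣ k → ∃ r ∈ R, y ^ (i + 1) ∣ k - r * (y ^ i * ε) := by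
    intro i hi
    have hfg : (M ⊓ D i).FG := hM.of_le inf_le_left
    obtain ⟨e, he, h⟩ := hR.exists_generator (i := i) (M ⊓ D i) hfg fun k hk => hk.2
    obtain ⟨ε, hε⟩ := he.2
    rcases hR.isUnit_or ε with ⟨ε, rfl⟩ | ⟨ε, rfl⟩
    · exact ⟨ε, hε ▸ he.1, fun k hk hk' => hε ▸ h k ⟨hk, hk'⟩⟩
    · exfalso
      obtain ⟨r, -, z, hz⟩ := h (y ^ i * w) ⟨hy i w hw, Dvd.intro _ rfl⟩
      have h1 : y ^ i * (w - y * (r * ε + z)) = 0 := by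
        linear_combination hz + r * hε
      have h2 : IsUnit ((w : K) - y * (r * ε + z)) := by
        have := (hR.isUnit_one_add (t := - (y * (r * ε + z)) * (w⁻¹ : Kˣ))
          (((Dvd.intro _ rfl : y ∣ y * (r * ε + z)).neg_right).mul_right _)).mul w.isUnit
        convert! this using 1
        rw [add_mul, one_mul, mul_assoc, Units.inv_mul, mul_one, sub_eq_add_neg]
      exact hR.pow_ne_zero_of_lt hi ((h2.mul_left_eq_zero).mp h1)
  -- Induction on the number of treated levels: only the elements divisible by `y ^ (n - 1 - j)` are
  -- required to land in `R`. For `j = n - 1` this is all of `M`. The base case sends the generator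
  -- of the last level to `y ^ (n - 1)`.
  have key : ∀ j < n, ∃ g : Kˣ, (∀ k ∈ M, y ^ (n - 1 - j) ∣ k → g * k ∈ R) ∧
      ∃ k ∈ M, y ^ (n - 1 - j) ∣ k ∧ g * k = y ^ (n - 1) := by
    intro j
    induction j with
    | zero =>
      intro _
      obtain ⟨ε, hε, h⟩ := hgen (n - 1) (by omega)
      refine ⟨ε⁻¹, fun k hk hd => ?_, _, hε, Dvd.intro _ rfl, ?_⟩
      · obtain ⟨r, hr, hd'⟩ := h k hk hd
        rw [hR.pow_eq_zero_of_le (by omega), zero_dvd_iff, sub_eq_zero] at hd'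
        rw [hd']
        convert! mul_mem hr (pow_mem hR.mem (n - 1)) using 1
        rw [mul_comm (y ^ (n - 1)), mul_left_comm, Units.inv_mul_cancel_left]
      · rw [mul_comm (y ^ (n - 1)), Units.inv_mul_cancel_left]
    | succ j ih =>
      intro hj
      obtain ⟨g, hg, k₀, hk₀, hd₀, hgk₀⟩ := ih (by omega)
      let i := n - 1 - (j + 1)
      have hi : n - 1 - j = i + 1 := by omega
      rw [hi] at hg hd₀
      obtain ⟨ε, hε, h⟩ := hgen i (by omega)
      -- Multiplied by `y`, the new generator belongs to the treated levels, so its image is in `R`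
      -- and divisible by `y`, that is, of the form `y * c`. The defect `g * (y ^ i * ε) - c` is
      -- then killed by `y`, hence equals `y ^ (n - 1) * z`.
      obtain ⟨c, hc, hyc⟩ := hR.dvd (g * (y * (y ^ i * ε)))
        (hg _ (by simpa using hy 1 _ hε) ⟨ε, by ring⟩) ⟨g * (y ^ i * ε), by ring⟩
      obtain ⟨z, hz⟩ := hR.dvd_of_pow_mul_eq_zero (j := 1) (k := g * (y ^ i * ε) - c) (by
        linear_combination hyc)
      -- Multiplication by `1 + t` subtracts exactly the defect `y ^ (n - 1) * z` from `g * (y ^ i *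
      -- ε)`. As `t` is a multiple of `y ^ (n - 1 - i)`, it kills the multiples of `y ^ (i + 1)`, so
      -- the treated levels do not change.
      let t : K := - (y ^ (n - 1 - i) * z * ((g * ε)⁻¹ : Kˣ))
      have ht : y ∣ t := by
        refine Dvd.dvd.neg_right (Dvd.dvd.mul_right (Dvd.dvd.mul_right ?_ _) _)
        exact dvd_pow_self y (by omega)
      obtain ⟨v, hv⟩ := hR.isUnit_one_add ht
      have hgt : ∀ k, y ^ (i + 1) ∣ k → (g * v : Kˣ) * k = g * k := by
        rintro _ ⟨k, rfl⟩
        have h0 : y ^ (n - 1 - i) * y ^ (i + 1) = 0 := by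
          rw [← pow_add]; exact hR.pow_eq_zero_of_le (by omega)
        rw [Units.val_mul, hv]
        simp only [t]
        linear_combination - (g * z * ((g * ε)⁻¹ : Kˣ) * k) * h0
      have he : (g * v : Kˣ) * (y ^ i * ε) = c := by
        have h0 : y ^ (n - 1 - i) * y ^ i = y ^ (n - 1) := by
          rw [← pow_add]; congr 1; omega
        have h1 : (g : K) * ε * ((g * ε)⁻¹ : Kˣ) = 1 := by
          rw [← Units.val_mul, Units.mul_inv]
        rw [Units.val_mul, hv]
        simp only [t]
        linear_combination hz - y ^ (n - 1 - i) * y ^ i * z * h1 - z * h0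
      refine ⟨g * v, fun k hk hd => ?_, k₀, hk₀, ?_, ?_⟩
      · obtain ⟨r, hr, hd'⟩ := h k hk hd
        have h1 : k - r * (y ^ i * ε) ∈ M := sub_mem hk (M.smul_mem (⟨r, hr⟩ : R) hε)
        have h2 := hg _ h1 hd'
        rw [← hgt _ hd'] at h2
        have h3 := add_mem h2 (mul_mem hr hc)
        convert! h3 using 1
        rw [← he]; ring
      · exact (pow_dvd_pow y (by omega)).trans hd₀
      · rw [hgt _ hd₀, hgk₀]
  obtain ⟨g, hg, k, hk, -, e⟩ := key (n - 1) (by omega)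
  refine ⟨g, fun k hk => hg k hk ?_, k, hk, e⟩
  rw [Nat.sub_self, pow_zero]
  exact one_dvd k

/-- The left-hand side says that `a` kills the local torsion module. Testing it on the element with
`g * k = y ^ (n - 1)` determines `a` modulo `y` as an element of `g * M`. Conversely `y` kills all
multiples of `y ^ (n - 1)`, and any such `k` in `M` satisfies `g * k = y ^ (n - 1) * r` with `r` in
`R`, so `g * b` sends it to `y ^ (n - 1) * (r * b)`. -/
lemma annihilates_iff {M : Submodule R K} {g : Kˣ} (hg : ∀ k ∈ M, g * k ∈ R)
    (hg' : ∃ k ∈ M, g * k = y ^ (n - 1)) {a : K} (ha : a ∈ R) :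
    (∀ k ∈ M, y ^ (n - 1) ∣ k → ∃ m ∈ M, a * k = y ^ (n - 1) * m) ↔
      ∃ b ∈ M, ∃ s ∈ R, a = g * b + y * s := by
  have hn := hR.one_le
  constructor
  · intro h
    obtain ⟨k, hk, e⟩ := hg'
    have hk' : k = y ^ (n - 1) * (g⁻¹ : Kˣ) := by
      rw [← e, mul_comm, Units.inv_mul_cancel_left]
    obtain ⟨m, hm, e'⟩ := h k hk ⟨_, hk'⟩
    have h0 : y ^ (n - 1) * (a - g * m) = 0 := by
      linear_combination g * e' - a * e
    have h1 := hR.dvd_of_pow_mul_eq_zero h0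
    rw [show n - (n - 1) = 1 by omega, pow_one] at h1
    obtain ⟨s, hs, e2⟩ := hR.dvd _ (sub_mem ha (hg m hm)) h1
    exact ⟨m, hm, s, hs, by rw [← e2]; ring⟩
  · rintro ⟨b, hb, s, hs, rfl⟩ k hk ⟨z, rfl⟩
    obtain ⟨r, hr, e⟩ := hR.pow_dvd (hg _ hk) (i := n - 1) (by omega) ⟨g * z, by ring⟩
    refine ⟨r * b, M.smul_mem (⟨r, hr⟩ : R) hb, ?_⟩
    have h0 : y * y ^ (n - 1) = 0 := by
      rw [← pow_succ']; exact hR.pow_eq_zero_of_le (by omega)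
    linear_combination b * e + s * z * h0

end LocalData

end LocalAlgebra

end

/-! ### Local rings that are regular of dimension at most one modulo nilpotents -/

section

section LocalAlgebra

/-- The cotangent space of a smooth algebra of relative dimension one at the kernel of a retraction
is generated by one element. -/
lemma exists_mem_ker_le_span_sup {R S : Type u} [CommRing R] [CommRing S] [Algebra R S]
    [Nontrivial S] [Algebra.IsStandardSmoothOfRelativeDimension 1 R S] (σ : S →ₐ[R] R) :
    ∃ t ∈ RingHom.ker σ, RingHom.ker σ ≤ Ideal.span {t} ⊔ RingHom.ker σ ^ 2 := by
  let q := RingHom.ker σ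
  have hq : ∀ b : S, b - algebraMap R S (σ b) ∈ q := fun b => by
    rw [RingHom.mem_ker, map_sub, AlgHom.commutes]
    exact sub_self _
  -- The class of `b - σ b` is a derivation in `b`, and on the kernel of `σ` it is the projection to
  -- the cotangent space. This space is therefore a quotient of the differentials, which are free of
  -- rank one.
  let D : Derivation R S q.Cotangent := Derivation.mk'
    { toFun := fun b => q.toCotangent ⟨_, hq b⟩
      map_add' := fun a b => by
        rw [← map_add]
        congr 1
        refine Subtype.ext ?_
        simp only [map_add, Submodule.coe_add]
        ring
      map_smul' := fun r b => by
        rw [RingHom.id_apply]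
        refine Eq.trans ?_ (algebraMap_smul S r (q.toCotangent _))
        rw [← map_smul]
        congr 1
        refine Subtype.ext ?_
        simp only [Submodule.coe_smul, Algebra.smul_def, map_mul, mul_sub, AlgHom.commutes]
        simp }
    (fun a b => by
      change q.toCotangent _ = a • q.toCotangent _ + b • q.toCotangent _
      rw [← map_smul, ← map_smul, ← map_add, Ideal.toCotangent_eq]
      have h1 := Ideal.mul_mem_mul (hq a) (hq b)
      rw [← pow_two] at h1
      convert! neg_mem h1 using 1
      simp only [map_mul, Submodule.coe_add, Submodule.coe_smul, smul_eq_mul]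
      ring)
  have : Algebra.IsStandardSmooth R S := Algebra.IsStandardSmoothOfRelativeDimension.isStandardSmooth 1
  have hrank : Module.rank S Ω[S⁄R] = 1 := by
    exact_mod_cast Algebra.IsStandardSmoothOfRelativeDimension.rank_kaehlerDifferential (R := R) (S := S) 1
  obtain ⟨e⟩ := Module.nonempty_linearEquiv_iff_rank_eq_one.mpr hrank
  let l := D.liftKaehlerDifferential
  obtain ⟨t, ht⟩ := q.toCotangent_surjective (l (e 1))
  refine ⟨t, t.2, fun b hb => ?_⟩
  let c := e.symm (KaehlerDifferential.D R S b)
  have h1 : l (KaehlerDifferential.D R S b) = q.toCotangent (c • t) := by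
    rw [map_smul, ht, ← map_smul, ← map_smul, smul_eq_mul, mul_one, LinearEquiv.apply_symm_apply]
  rw [Derivation.liftKaehlerDifferential_comp_D] at h1
  have h2 : D b = q.toCotangent ⟨b, hb⟩ := by
    refine congrArg q.toCotangent (Subtype.ext ?_)
    change b - algebraMap R S (σ b) = b
    rw [RingHom.mem_ker.mp hb, map_zero, sub_zero]
  rw [h2, Ideal.toCotangent_eq] at h1
  have h3 : b = c * t + (b - c * t) := by ring
  rw [h3]
  exact Submodule.add_mem_sup (Ideal.mul_mem_left _ _ (Ideal.mem_span_singleton_self _)) h1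

open IsLocalRing

/-- A generator of the cotangent space lifts along a surjection with nilpotent kernel. -/
lemma exists_maximalIdeal_le_of_surjective {A B : Type u} [CommRing A] [IsLocalRing A]
    [IsNoetherianRing A] [CommRing B] [IsLocalRing B] (φ : A →+* B) (hφ : Function.Surjective φ)
    (hker : RingHom.ker φ ≤ nilradical A) (t : B) (ht : t ∈ maximalIdeal B)
    (h : maximalIdeal B ≤ Ideal.span {t} ⊔ maximalIdeal B ^ 2) :
    ∃ t' ∈ maximalIdeal A, maximalIdeal A ≤ Ideal.span {t'} ⊔ nilradical A := by
  have hloc : IsLocalHom φ := hφ.isLocalHom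
  have hm : maximalIdeal B = (maximalIdeal A).map φ :=
    (map_maximalIdeal_of_surjective φ hφ).symm
  obtain ⟨t', rfl⟩ := hφ t
  refine ⟨t', fun h => ht (h.map φ), ?_⟩
  have h1 : maximalIdeal A ≤ (Ideal.span {t'} ⊔ nilradical A) ⊔ maximalIdeal A • maximalIdeal A := by
    intro a ha
    have h2 := h (hm ▸ Ideal.mem_map_of_mem φ ha)
    have h3 : Ideal.span {φ t'} ⊔ maximalIdeal B ^ 2 =
        (Ideal.span {t'} ⊔ maximalIdeal A ^ 2).map φ := by
      rw [Ideal.map_sup, Ideal.map_pow, ← hm, Ideal.map_span, Set.image_singleton]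
    rw [h3, Ideal.mem_map_iff_of_surjective φ hφ] at h2
    obtain ⟨b, hb, e⟩ := h2
    have h4 : a - b ∈ nilradical A := hker (by rw [RingHom.mem_ker, map_sub, e, sub_self])
    have h5 : a = (a - b) + b := by ring
    rw [h5, smul_eq_mul, ← pow_two, sup_comm (Ideal.span {t'}), sup_assoc]
    exact Submodule.add_mem_sup h4 hb
  exact Submodule.le_of_le_smul_of_le_jacobson_bot (IsNoetherian.noetherian _)
    (IsLocalRing.jacobson_eq_maximalIdeal ⊥ bot_ne_top).ge h1

section

variable {A : Type u} [CommRing A] [IsLocalRing A] [IsNoetherianRing A] {t : A}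
  (htm : t ∈ maximalIdeal A)
  (ht : maximalIdeal A ≤ Ideal.span {t} ⊔ nilradical A)

include htm ht

/-- If `t` is not in `p`, an element of `p` is `d * t` plus a nilpotent, which forces `d` into `p`.
So `p` is contained in the nilradical plus the maximal ideal times `p`, and Nakayama applies. -/
lemma prime_eq_nilradical_or (p : Ideal A) [hp : p.IsPrime] :
    p = nilradical A ∨ p = maximalIdeal A := by
  have hle : nilradical A ≤ p := nilradical_le_prime p
  by_cases h : t ∈ p
  · right
    refine le_antisymm (le_maximalIdeal hp.ne_top) (ht.trans ?_)
    exact sup_le ((Ideal.span_singleton_le_iff_mem _).mpr h) hle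
  · left
    refine le_antisymm ?_ hle
    have hfg : p.FG := IsNoetherian.noetherian _
    refine Submodule.le_of_le_smul_of_le_jacobson_bot hfg
      (IsLocalRing.jacobson_eq_maximalIdeal ⊥ bot_ne_top).ge fun a ha => ?_
    obtain ⟨b, hb, c, hc, rfl⟩ := Submodule.mem_sup.mp (ht (le_maximalIdeal hp.ne_top ha))
    obtain ⟨d, rfl⟩ := Ideal.mem_span_singleton'.mp hb
    have h1 : d * t ∈ p := by simpa using sub_mem ha (hle hc)
    rw [add_comm]
    refine Submodule.add_mem_sup hc ?_
    rw [smul_eq_mul, mul_comm d]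
    exact Ideal.mul_mem_mul htm ((hp.mem_or_mem h1).resolve_right h)

/-- The maximal ideal is the only prime that can contain `s`, so `f` lies in the radical of `(s)`.
-/
lemma dvd_pow_of_not_mem_nilradical {s f : A} (hs : s ∉ nilradical A) (hf : f ∈ maximalIdeal A) :
    ∃ k : ℕ, s ∣ f ^ k := by
  have h1 : f ∈ (Ideal.span {s}).radical := by
    rw [Ideal.radical_eq_sInf, Ideal.mem_sInf]
    rintro p ⟨hle, hp⟩
    rcases prime_eq_nilradical_or htm ht p with rfl | rfl
    · exact absurd (hle (Ideal.mem_span_singleton_self s)) hs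
    · exact hf
  obtain ⟨k, hk⟩ := h1
  exact ⟨k, Ideal.mem_span_singleton.mp hk⟩

variable [hP : (nilradical A).IsPrime]

/-- The quotient is a Noetherian local domain whose maximal ideal is generated by the class of `t`.
-/
lemma quotient_nilradical_valuationRing : ValuationRing (A ⧸ nilradical A) := by
  have : IsDomain (A ⧸ nilradical A) := Ideal.Quotient.isDomain _
  have hs : Function.Surjective (Ideal.Quotient.mk (nilradical A)) := Ideal.Quotient.mk_surjective
  have : IsLocalRing (A ⧸ nilradical A) := .of_surjective' _ hs
  refine ((tfae_of_isNoetherianRing_of_isLocalRing_of_isDomain (A ⧸ nilradical A)).out 4 1).mp ?_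
  refine ⟨⟨Ideal.Quotient.mk _ t, ?_⟩⟩
  have hloc : IsLocalHom (Ideal.Quotient.mk (nilradical A)) := hs.isLocalHom
  rw [← map_maximalIdeal_of_surjective _ hs]
  apply le_antisymm
  · refine (Ideal.map_mono ht).trans ?_
    rw [Ideal.map_sup, Ideal.map_span, Set.image_singleton, Ideal.map_quotient_self, sup_bot_eq]
  · exact (Ideal.span_singleton_le_iff_mem _).mpr (Ideal.mem_map_of_mem _ htm)

lemma exists_sub_mul_mem_nilradical (a b : A) :
    ∃ c, a - b * c ∈ nilradical A ∨ b - a * c ∈ nilradical A := by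
  have : IsDomain (A ⧸ nilradical A) := Ideal.Quotient.isDomain _
  have := quotient_nilradical_valuationRing htm ht
  obtain ⟨c, hc⟩ := ValuationRing.cond (Ideal.Quotient.mk (nilradical A) a)
    (Ideal.Quotient.mk (nilradical A) b)
  obtain ⟨c, rfl⟩ := Ideal.Quotient.mk_surjective c
  refine ⟨c, ?_⟩
  rw [← map_mul, ← map_mul, Ideal.Quotient.eq, Ideal.Quotient.eq] at hc
  rcases hc with h | h
  · exact Or.inr (by simpa using neg_mem h)
  · exact Or.inl (by simpa using neg_mem h)

/-- If `s` is neither a unit nor nilpotent, the nilradical and the maximal ideal are distinct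
primes, so the dimension is positive and the regular sequence has a first element `r`. Then `s`
divides a power of `r`, which is a nonzerodivisor. -/
lemma mem_nonZeroDivisors_of_isCohenMacaulay (hCM : IsCohenMacaulayLocalRing A) {s : A}
    (hs : s ∉ nilradical A) : s ∈ nonZeroDivisors A := by
  by_cases hsm : s ∈ maximalIdeal A
  swap
  · exact (not_not.mp hsm : IsUnit s).mem_nonZeroDivisors
  obtain ⟨rs, hreg, hdim⟩ := hCM
  cases rs with
  | nil =>
    exfalso
    have h1 : 0 < ringKrullDim A := by
      rw [ringKrullDim, Order.krullDim_pos_iff]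
      refine ⟨⟨_, hP⟩, ⟨maximalIdeal A, inferInstance⟩, lt_of_le_of_ne ?_ ?_⟩
      · exact le_maximalIdeal hP.ne_top
      · intro h
        have h2 : nilradical A = maximalIdeal A := congrArg PrimeSpectrum.asIdeal h
        exact hs (h2 ▸ hsm)
    rw [← hdim] at h1
    simp at h1
  | cons r rs =>
    have h1 : IsSMulRegular A r := ((RingTheory.Sequence.isRegular_cons_iff A r rs).mp hreg).1
    have hrm : r ∈ maximalIdeal A := fun hu => by
      refine hreg.top_ne_smul ?_
      rw [Ideal.ofList_cons, Ideal.span_singleton_eq_top.mpr hu, top_sup_eq, Submodule.top_smul]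
    obtain ⟨k, c, hc⟩ := dvd_pow_of_not_mem_nilradical htm ht hs hrm
    have h2 : r ^ k ∈ nonZeroDivisors A :=
      pow_mem (mem_nonZeroDivisors_iff_right.mpr fun z hz => h1 (by
        simpa [mul_comm] using hz)) k
    rw [hc] at h2
    exact (mul_mem_nonZeroDivisors.mp h2).1

end

end LocalAlgebra

end

/-! ### Smoothness of the reduced curve, seen in the stalks -/

section

open IsLocalRing

lemma appLE_of_eq_id {Y : Scheme.{u}} {h : Y ⟶ Y} (hh : h = 𝟙 _) (U : Y.Opens) (e : U ≤ h ⁻¹ᵁ U) :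
    h.appLE U U e = 𝟙 _ := by
  subst hh
  rw [Scheme.Hom.appLE]
  exact (Category.id_comp _).trans (Y.presheaf.map_id _)

/-- The cotangent space of a smooth curve at a closed point is generated by one element. -/
lemma exists_maximalIdeal_stalk_le {K : Type u} [Field K] [IsAlgClosed K] {C : Scheme.{u}}
    (g : C ⟶ Spec (CommRingCat.of K)) [LocallyOfFiniteType g] [hg : SmoothOfRelativeDimension 1 g]
    (c : C) (hc : IsClosed {c}) :
    ∃ t ∈ maximalIdeal (C.presheaf.stalk c),
      maximalIdeal (C.presheaf.stalk c) ≤ Ideal.span {t} ⊔ maximalIdeal (C.presheaf.stalk c) ^ 2 := by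
  obtain ⟨U, hU, V, hV, hcV, e, hstd⟩ := hg.exists_isStandardSmoothOfRelativeDimension c
  -- Over an algebraically closed field a closed point is a section of the structure morphism. On
  -- coordinate rings it gives a retraction `σ` whose kernel is the prime ideal of `c`.
  let p := pointOfClosedPoint g c hc
  have hp : ∀ u, p u = c := fun u =>
    (congrArg p (Subsingleton.elim u (IsLocalRing.closedPoint K))).trans
      (pointOfClosedPoint_apply g c hc _)
  have e' : U ≤ p ⁻¹ᵁ V := fun u _ => by
    change p u ∈ V
    rw [hp]; exact hcV
  have hσφ : g.appLE U V e ≫ p.appLE V U e' = 𝟙 _ := by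
    rw [Scheme.Hom.appLE_comp_appLE]
    exact appLE_of_eq_id (pointOfClosedPoint_comp g c hc) U _
  algebraize [(g.appLE U V e).hom]
  let σ : Γ(C, V) →ₐ[Γ(Spec (CommRingCat.of K), U)] Γ(Spec (CommRingCat.of K), U) :=
    { (p.appLE V U e').hom with
      commutes' := fun r => ConcreteCategory.congr_hom hσφ r }
  have hnt : Nontrivial Γ(C, V) := by
    have := ((C.presheaf.germ V c hcV).hom).domain_nontrivial
    exact this
  have hker : ∀ b : Γ(C, V), b ∈ RingHom.ker σ ↔
      C.presheaf.germ V c hcV b ∈ maximalIdeal (C.presheaf.stalk c) := by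
    intro b
    rw [mem_maximalIdeal, mem_nonunits_iff, ← Scheme.mem_basicOpen, RingHom.mem_ker]
    change p.appLE V U e' b = 0 ↔ _
    rw [← basicOpen_eq_bot_iff, Scheme.basicOpen_appLE]
    constructor
    · intro h hc'
      have key : p (g c) ∈ C.basicOpen b := by rwa [hp]
      have h2 : g c ∈ U ⊓ p ⁻¹ᵁ C.basicOpen b := ⟨e hcV, key⟩
      rw [h] at h2
      exact h2
    · intro h
      refine le_bot_iff.mp fun u hu => h ?_
      exact (hp u) ▸ hu.2
  obtain ⟨t, ht, h⟩ := exists_mem_ker_le_span_sup σ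
  refine ⟨_, (hker t).mp ht, ?_⟩
  let _ : Algebra Γ(C, V) (C.presheaf.stalk c) := (C.presheaf.germ V c hcV).hom.toAlgebra
  have hloc : IsLocalization.AtPrime (C.presheaf.stalk c) (hV.primeIdealOf ⟨c, hcV⟩).asIdeal :=
    hV.isLocalization_stalk ⟨c, hcV⟩
  have hq : (hV.primeIdealOf ⟨c, hcV⟩).asIdeal = RingHom.ker σ := by
    ext b
    rw [hker]
    exact (IsLocalization.AtPrime.to_map_mem_maximal_iff (C.presheaf.stalk c)
      (hV.primeIdealOf ⟨c, hcV⟩).asIdeal b).symm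
  have hm := IsLocalization.AtPrime.map_eq_maximalIdeal (hV.primeIdealOf ⟨c, hcV⟩).asIdeal
    (C.presheaf.stalk c)
  rw [hq] at hm
  have h1 := Ideal.map_mono (f := algebraMap Γ(C, V) (C.presheaf.stalk c)) h
  rw [Ideal.map_sup, Ideal.map_pow, Ideal.map_span, Set.image_singleton, hm] at h1
  exact h1

lemma mem_nilradical_ideal {X : Scheme.{u}} {U : X.affineOpens} {a : Γ(X, U.1)} :
    a ∈ X.nilradical.ideal U ↔ IsNilpotent a := Iff.rfl

/-- The kernel of the restriction to the reduced subscheme consists of nilpotents. -/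
lemma ker_stalkMap_subschemeι_le {X : Scheme.{u}} (c : X.nilradical.subscheme) :
    RingHom.ker (X.nilradical.subschemeι.stalkMap c).hom ≤
      nilradical (X.presheaf.stalk (X.nilradical.subschemeι c)) := by
  intro a ha
  let ι := X.nilradical.subschemeι
  obtain ⟨U, hcU, s, rfl⟩ := X.presheaf.exists_germ_eq a
  have h1 : X.nilradical.subscheme.presheaf.germ (ι ⁻¹ᵁ U) c hcU (ι.app U s) = 0 :=
    (Scheme.Hom.germ_stalkMap_apply ι U c hcU s).symm.trans ha
  rw [← map_zero (X.nilradical.subscheme.presheaf.germ (ι ⁻¹ᵁ U) c hcU).hom] at h1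
  obtain ⟨W, hcW, i, j, hW⟩ := X.nilradical.subscheme.presheaf.germ_eq c hcU hcU _ _ h1
  obtain ⟨W', hW', e⟩ := ι.isEmbedding.isOpen_iff.mp W.isOpen
  have hcW' : ι c ∈ W' := by
    have : c ∈ ι ⁻¹' W' := e ▸ hcW
    exact this
  obtain ⟨U', hU', hcU', hle⟩ := exists_isAffineOpen_mem_and_subset (U := ⟨W', hW'⟩ ⊓ U) (x := ι c)
    ⟨hcW', hcU⟩
  have hle1 : U' ≤ U := hle.trans inf_le_right
  have hle2 : ι ⁻¹ᵁ U' ≤ W := fun z hz => by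
    have h2 : z ∈ ι ⁻¹' W' := (hle hz).1
    rw [e] at h2
    exact h2
  have h2 : ι.app U' (X.presheaf.map (homOfLE hle1).op s) = 0 := by
    have h3 := congrArg (X.nilradical.subscheme.presheaf.map (homOfLE hle2).op) hW
    rw [map_zero, map_zero] at h3
    refine (ConcreteCategory.congr_hom (ι.naturality (homOfLE hle1).op) s).trans (Eq.trans ?_ h3)
    exact (ConcreteCategory.congr_hom
      (X.nilradical.subscheme.presheaf.map_comp i.op (homOfLE hle2).op) (ι.app U s))
  have h3 : IsNilpotent (X.presheaf.map (homOfLE hle1).op s) := by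
    rw [← mem_nilradical_ideal (U := ⟨U', hU'⟩), ← Scheme.IdealSheafData.ker_subschemeι_app]
    exact h2
  have h4 := h3.map (X.presheaf.germ U' (ι c) hcU').hom
  exact (X.presheaf.germ_res_apply (homOfLE hle1) _ hcU' s) ▸ h4

/-- Every point of the scheme lies on the reduced subscheme, and the surjection of stalks has
nilpotent kernel, so the generator of the cotangent space on the reduced curve lifts. -/
lemma exists_maximalIdeal_stalk_le_nilradical {K : Type u} [Field K] [IsAlgClosed K] {X : Scheme.{u}}
    (f : X ⟶ Spec (CommRingCat.of K)) [LocallyOfFiniteType f]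
    [SmoothOfRelativeDimension 1 (X.nilradical.subschemeι ≫ f)] [IsLocallyNoetherian X]
    (x : X) (hx : IsClosed {x}) :
    ∃ t ∈ maximalIdeal (X.presheaf.stalk x),
      maximalIdeal (X.presheaf.stalk x) ≤ Ideal.span {t} ⊔ nilradical _ := by
  let ι := X.nilradical.subschemeι
  obtain ⟨c, rfl⟩ : x ∈ Set.range ι := by
    rw [Scheme.IdealSheafData.range_subschemeι]
    rw [Scheme.support_nilradical]
    trivial
  have hc : IsClosed {c} := by
    have h1 := hx.preimage ι.continuous
    convert h1 using 1
    ext z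
    exact ι.isEmbedding.injective.eq_iff.symm
  obtain ⟨t, ht, h⟩ := exists_maximalIdeal_stalk_le (ι ≫ f) c hc
  exact exists_maximalIdeal_le_of_surjective _ (ι.stalkMap_surjective c)
    (ker_stalkMap_subschemeι_le c) t ht h

end

/-! ### Stalks inside the function ring, and the topology of the curve -/

section

open IsLocalRing

lemma exists_affine_germ {X : Scheme.{u}} {x : X} (a : X.presheaf.stalk x) {W : X.Opens} (hW : x ∈ W) :
    ∃ (U : X.Opens) (_ : IsAffineOpen U) (hx : x ∈ U) (_ : U ≤ W) (s : Γ(X, U)),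
      X.presheaf.germ U x hx s = a := by
  obtain ⟨U, hU, hx, s, rfl⟩ := X.presheaf.exists_le_germ_eq a hW
  obtain ⟨V, hV, hxV, hle⟩ := exists_isAffineOpen_mem_and_subset hx
  exact ⟨V, hV, hxV, hle.trans hU, X.presheaf.map (homOfLE hle).op s,
    X.presheaf.germ_res_apply (homOfLE hle) x hxV s⟩

lemma IsPrimitiveMultipleCurve.compactSpace {K : Type u} [Field K] {X : Scheme.{u}}
    {f : X ⟶ Spec (CommRingCat.of K)} {n : ℕ} (hX : IsPrimitiveMultipleCurve K X f n) :
    CompactSpace X := by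
  have := hX.quasiCompact
  exact QuasiCompact.compactSpace_of_compactSpace f

variable {X : Scheme.{u}} [IrreducibleSpace X]

/-- The map from the local ring at a point to the function ring. -/
def specMap (x : X) : X.presheaf.stalk x →+* X.functionField :=
  (X.presheaf.stalkSpecializes ((genericPoint_spec X).specializes (Set.mem_univ x))).hom

lemma mem_localRing {x : X} {k : X.functionField} : k ∈ localRing x ↔ ∃ a, specMap x a = k :=
  RingHom.mem_range

lemma specMap_mem (x : X) (a : X.presheaf.stalk x) : specMap x a ∈ localRing x :=
  mem_localRing.mpr ⟨a, rfl⟩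

lemma specMap_germ {U : X.Opens} {x : X} (hx : x ∈ U) (a : Γ(X, U)) :
    specMap x (X.presheaf.germ U x hx a) = gen U (generic_mem hx) a :=
  ConcreteCategory.congr_hom (X.presheaf.germ_stalkSpecializes hx
      ((genericPoint_spec X).specializes (Set.mem_univ x))) a

/-- By irreducibility the basic open set of `s` contains the generic point or is empty. -/
lemma isNilpotent_or_isUnit_gen {U : X.Opens} (hU : IsAffineOpen U) (h : genericPoint X ∈ U)
    (s : Γ(X, U)) : IsNilpotent s ∨ IsUnit (gen U h s) := by
  rw [Scheme.isNilpotent_iff_basicOpen_eq_bot_of_isCompact hU.isCompact]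
  by_cases hη : genericPoint X ∈ X.basicOpen s
  · exact Or.inr ((X.mem_basicOpen s _ h).mp hη)
  · left
    refine le_bot_iff.mp fun x hx => ?_
    exact absurd (generic_mem hx) hη

lemma isNilpotent_iff_specMap (x : X) (a : X.presheaf.stalk x) :
    IsNilpotent a ↔ ¬ IsUnit (specMap x a) := by
  constructor
  · intro h hu
    have h1 := h.map (specMap x)
    exact h1.not_isUnit hu
  · intro h
    obtain ⟨U, hU, hx, -, s, rfl⟩ := exists_affine_germ a (W := ⊤) trivial
    rw [specMap_germ] at h
    exact ((isNilpotent_or_isUnit_gen hU _ s).resolve_right h).map (X.presheaf.germ U x hx).hom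

/-- Irreducibility makes the nilradical the preimage of the maximal ideal of the function ring. -/
instance (x : X) : (nilradical (X.presheaf.stalk x)).IsPrime := by
  have h : nilradical (X.presheaf.stalk x) = (maximalIdeal X.functionField).comap (specMap x) := by
    ext a
    exact isNilpotent_iff_specMap x a
  rw [h]
  infer_instance

lemma isUnit_or_isNilpotent (k : X.functionField) : IsUnit k ∨ IsNilpotent k := by
  obtain ⟨U, hU, hx, -, s, rfl⟩ := exists_affine_germ (x := genericPoint X) k (W := ⊤) trivial
  rcases isNilpotent_or_isUnit_gen hU hx s with h | h
  · exact Or.inr (h.map (gen U hx))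
  · exact Or.inl h

/-- The points specializing to `y` are the primes of the stalk at `y`, and these are only the
nilradical and the maximal ideal. -/
lemma eq_genericPoint_of_specializes [IsLocallyNoetherian X] {x y : X}
    {t : X.presheaf.stalk y} (ht : t ∈ maximalIdeal (X.presheaf.stalk y))
    (ht' : maximalIdeal (X.presheaf.stalk y) ≤ Ideal.span {t} ⊔ nilradical _) (h : x ⤳ y) :
    x = genericPoint X ∨ x = y := by
  have hr : ∀ z : X, z ⤳ y → z = genericPoint X ∨ z = y := by
    have h1 : ∀ z : X, z ⤳ y → z = X.fromSpecStalk y ⟨nilradical _, inferInstance⟩ ∨ z = y := by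
      intro z hz
      have h2 : z ∈ Set.range (X.fromSpecStalk y) := by rw [Scheme.range_fromSpecStalk]; exact hz
      obtain ⟨p, rfl⟩ := h2
      have := p.isPrime
      rcases prime_eq_nilradical_or ht ht' p.asIdeal with h3 | h3
      · left
        congr 1
        exact PrimeSpectrum.ext h3
      · right
        have h4 : p = closedPoint _ := PrimeSpectrum.ext h3
        rw [h4]
        exact Scheme.fromSpecStalk_closedPoint
    have hη := (genericPoint_spec X).specializes (Set.mem_univ y)
    intro z hz
    rcases h1 z hz with h2 | h2
    · rcases h1 _ hη with h3 | h3
      · exact Or.inl (h2.trans h3.symm)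
      · left
        have h5 : y ⤳ z := h3 ▸ (genericPoint_spec X).specializes (Set.mem_univ z)
        exact (hz.antisymm h5).eq.trans h3.symm
    · exact Or.inr h2
  exact hr x h

variable (X) in
/-- The local rings of a curve: Noetherian, Cohen-Macaulay and regular modulo nilpotents. -/
structure CurveStalks : Prop where
  noeth : IsLocallyNoetherian X
  exists_generator : ∀ x : X, ∃ t ∈ maximalIdeal (X.presheaf.stalk x),
      maximalIdeal (X.presheaf.stalk x) ≤ Ideal.span {t} ⊔ nilradical _
  cohenMacaulay : ∀ x : X, IsCohenMacaulayLocalRing (X.presheaf.stalk x)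

section

variable (hX : CurveStalks X)

include hX

/-- A germ that vanishes at the generic point is killed by a power of some `g` that is a unit there.
Such a `g` is not nilpotent at `x`, hence a nonzerodivisor by the Cohen–Macaulay property. -/
lemma CurveStalks.specMap_injective (x : X) : Function.Injective (specMap x) := by
  have := hX.noeth
  refine (injective_iff_map_eq_zero _).mpr fun a ha => ?_
  obtain ⟨U, hU, hx, -, s, rfl⟩ := exists_affine_germ a (W := ⊤) trivial
  have hη := generic_mem hx
  rw [specMap_germ] at ha
  obtain ⟨V, hV, i, j, hij⟩ := X.presheaf.germ_eq (genericPoint X) hη hη s 0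
    (ha.trans (map_zero _).symm)
  obtain ⟨g, hgV, hg⟩ := hU.exists_basicOpen_le ⟨_, hV⟩ hη
  have h1 : X.presheaf.map (homOfLE (X.basicOpen_le g)).op s = 0 := by
    have h2 := congrArg (X.presheaf.map (homOfLE hgV).op) hij
    rw [map_zero, map_zero] at h2
    exact (ConcreteCategory.congr_hom (X.presheaf.map_comp i.op (homOfLE hgV).op) s).trans h2
  obtain ⟨m, hm⟩ := exists_pow_mul_eq_zero_of_res_basicOpen_eq_zero_of_isCompact X hU.isCompact s g h1
  obtain ⟨t, ht, ht'⟩ := hX.exists_generator x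
  have h3 : X.presheaf.germ U x hx g ∉ nilradical _ := by
    rw [mem_nilradical, isNilpotent_iff_specMap, not_not, specMap_germ]
    exact (X.mem_basicOpen g _ hη).mp hg
  have h4 := pow_mem (mem_nonZeroDivisors_of_isCohenMacaulay ht ht' (hX.cohenMacaulay x) h3) m
  refine (mem_nonZeroDivisors_iff.mp h4).1 _ ?_
  have h5 := congrArg (X.presheaf.germ U x hx) hm
  rwa [map_mul, map_pow, map_zero] at h5

lemma CurveStalks.genInjective : GenInjective X := by
  intro U h
  refine (injective_iff_map_eq_zero _).mpr fun s hs => ?_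
  refine TopCat.Presheaf.section_ext X.sheaf U s 0 fun x hx => ?_
  refine hX.specMap_injective x ?_
  refine (specMap_germ hx s).trans (hs.trans ?_)
  exact ((specMap_germ hx 0).trans (map_zero _)).symm

/-- By quasi-compactness the closure of `x` contains a closed point `y`, and only the generic point
and `y` itself specialize to `y`. -/
lemma CurveStalks.isClosed [CompactSpace X] (x : X) (hx : x ≠ genericPoint X) : IsClosed {x} := by
  obtain ⟨y, hy, hyc⟩ := (isClosed_closure (s := {x})).exists_closed_singleton
    ⟨x, subset_closure rfl⟩
  have := hX.noeth
  obtain ⟨t, ht, ht'⟩ := hX.exists_generator y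
  rcases eq_genericPoint_of_specializes ht ht' (specializes_iff_mem_closure.mpr hy) with h | h
  · exact absurd h hx
  · exact h ▸ hyc

/-- The complement is a finite union of irreducible closed sets. Their generic points differ from
that of `X`, hence are closed. -/
lemma CurveStalks.cofinite [CompactSpace X] (U : X.Opens) (hU : genericPoint X ∈ U) :
    ((U : Set X)ᶜ).Finite := by
  have := hX.noeth
  have : IsNoetherian X := {}
  obtain ⟨S, hS, hSc, hSi, e⟩ :=
    NoetherianSpace.exists_finite_set_isClosed_irreducible U.isOpen.isClosed_compl
  rw [e]
  refine hS.sUnion fun Z hZ => ?_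
  obtain ⟨z, hz⟩ := QuasiSober.sober (hSi Z hZ) (hSc Z hZ)
  have h1 : z ≠ genericPoint X := by
    rintro rfl
    have h2 : genericPoint X ∈ (U : Set X)ᶜ := e ▸ Set.mem_sUnion_of_mem hz.mem hZ
    exact h2 hU
  have h2 : closure {z} = Z := hz
  rw [(hX.isClosed z h1).closure_eq] at h2
  rw [← h2]
  exact Set.finite_singleton z

lemma CurveStalks.curveLike [CompactSpace X] : CurveLike X where
  genInjective := hX.genInjective
  isUnit_of_regular u hu := by
    refine (isUnit_or_isNilpotent u).resolve_right fun h => ?_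
    obtain ⟨m, hm⟩ := h
    have h1 : ∀ j : ℕ, u ^ j ≠ 0 := by
      intro j
      induction j with
      | zero => rw [pow_zero]; exact one_ne_zero
      | succ j ih => exact fun h => ih (hu _ (by rwa [pow_succ] at h))
    exact h1 m hm
  isClosed := hX.isClosed
  cofinite := hX.cofinite
  noeth := hX.noeth.component_noetherian

end

/-- Smoothness gives a generator at closed points. A point that is not closed specializes to a
closed one, hence is the generic point, where the maximal ideal is nilpotent and 0 serves as
generator. -/
lemma IsPrimitiveMultipleCurve.curveStalks {K : Type u} [Field K] [IsAlgClosed K]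
    {f : X ⟶ Spec (CommRingCat.of K)} {n : ℕ} (hX : IsPrimitiveMultipleCurve K X f n) :
    CurveStalks X := by
  have := hX.locallyOfFiniteType
  have := hX.smooth
  have hn : IsLocallyNoetherian X := LocallyOfFiniteType.isLocallyNoetherian f
  have := hX.compactSpace
  refine ⟨hn, fun x => ?_, hX.cohenMacaulay⟩
  obtain ⟨y, hy, hyc⟩ := (isClosed_closure (s := {x})).exists_closed_singleton
    ⟨x, subset_closure rfl⟩
  obtain ⟨t, ht, ht'⟩ := exists_maximalIdeal_stalk_le_nilradical f y hyc
  rcases eq_genericPoint_of_specializes ht ht' (specializes_iff_mem_closure.mpr hy) with rfl | rfl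
  · refine ⟨0, zero_mem _, fun a ha => Ideal.mem_sup_right ?_⟩
    exact (isUnit_or_isNilpotent a).resolve_left ha
  · exact ⟨t, ht, ht'⟩

end

/-! ### The local data at a point of a primitive multiple curve -/

section

open IsLocalRing

variable {X : Scheme.{u}} [IrreducibleSpace X]

/-- Elements of the function ring are fractions of sections over any affine open set. -/
lemma exists_fraction {U : X.Opens} (hU : IsAffineOpen U) (h : genericPoint X ∈ U)
    (k : X.functionField) : ∃ a b : Γ(X, U), IsUnit (gen U h b) ∧ k * gen U h b = gen U h a := by
  obtain ⟨W, -, hW, hWU, s, rfl⟩ := exists_affine_germ k h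
  obtain ⟨g, hgW, hg⟩ := hU.exists_basicOpen_le ⟨_, hW⟩ h
  obtain ⟨m, a, ha⟩ := exists_eq_pow_mul_of_isAffineOpen X U hU g
    (X.presheaf.map (homOfLE hgW).op s)
  refine ⟨a, g ^ m, ?_, ?_⟩
  · rw [map_pow]
    exact ((X.mem_basicOpen g _ h).mp hg).pow m
  · have h1 := congrArg (gen _ hg) ha
    rw [map_mul, map_pow] at h1
    have h2 : gen (X.basicOpen g) hg (X.presheaf.map (homOfLE hgW).op s) = gen W hW s :=
      gen_res (homOfLE hgW) hg s
    have h3 : ∀ z : Γ(X, U), gen (X.basicOpen g) hg (TopCat.Presheaf.restrictOpen z _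
      (X.basicOpen_le g)) = gen U h z := fun z => gen_res (homOfLE (X.basicOpen_le g)) hg z
    rw [h2, h3, h3] at h1
    rw [h1, map_pow, mul_comm]
    rfl

lemma exists_stalk_fraction (x : X) (k : X.functionField) :
    ∃ a b : X.presheaf.stalk x, IsUnit (specMap x b) ∧ k * specMap x b = specMap x a := by
  obtain ⟨U, hU, hx, -⟩ := exists_isAffineOpen_mem_and_subset (U := ⊤) (x := x) trivial
  obtain ⟨a, b, hb, e⟩ := exists_fraction hU (generic_mem hx) k
  refine ⟨X.presheaf.germ U x hx a, X.presheaf.germ U x hx b, ?_, ?_⟩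
  · rwa [specMap_germ]
  · rwa [specMap_germ, specMap_germ]

/-- A unit of the function ring that lies in the local ring is not nilpotent, so it divides a power
of every non-unit. At the points outside a basic open set this lets powers of the defining function
enter a given ideal. -/
lemma CurveStalks.exists_dvd_pow (hX : CurveStalks X) {x : X} {c f : X.functionField}
    (hc : c ∈ localRing x) (hcu : IsUnit c) (hf : f ∈ localRing x)
    (hfu : ∀ r ∈ localRing x, r * f ≠ 1) : ∃ m : ℕ, ∃ r ∈ localRing x, f ^ m = c * r := by
  have := hX.noeth
  obtain ⟨c, rfl⟩ := mem_localRing.mp hc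
  obtain ⟨f, rfl⟩ := mem_localRing.mp hf
  obtain ⟨t, ht, ht'⟩ := hX.exists_generator x
  have hc' : c ∉ nilradical _ := by
    rw [mem_nilradical, isNilpotent_iff_specMap, not_not]
    exact hcu
  have hf' : f ∈ maximalIdeal _ := fun h => by
    obtain ⟨r, hr⟩ := h.exists_left_inv
    exact hfu _ (specMap_mem x r) (by rw [← map_mul, hr, map_one])
  obtain ⟨m, r, hr⟩ := dvd_pow_of_not_mem_nilradical ht ht' hc' hf'
  exact ⟨m, _, specMap_mem x r, by rw [← map_pow, hr, map_mul]⟩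

/-- Nilpotent elements of the function ring, and of the local rings, are multiples of a local generator of
the nilradical. -/
lemma exists_mul_of_isNilpotent (hX : GenInjective X) {U : X.affineOpens} {x : X} (hx : x ∈ U.1)
    {a : Γ(X, U.1)} (ha : X.nilradical.ideal U = Ideal.span {a}) {r : X.functionField}
    (hr : r ∈ localRing x) (hn : IsNilpotent r) :
    ∃ s ∈ localRing x, r = gen U.1 (generic_mem hx) a * s := by
  obtain ⟨b, rfl⟩ := mem_localRing.mp hr
  obtain ⟨W, -, hxW, -, s, rfl⟩ := exists_affine_germ b hx
  obtain ⟨g, hgW, hg⟩ := U.2.exists_basicOpen_le ⟨_, hxW⟩ hx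
  let s' := X.presheaf.map (homOfLE hgW).op s
  have hη := generic_mem hg
  have h1 : gen (X.basicOpen g) hη s' = gen W (generic_mem hxW) s := gen_res (homOfLE hgW) hη s
  rw [specMap_germ, ← h1] at hn ⊢
  have h2 : IsNilpotent s' := by
    obtain ⟨m, hm⟩ := hn
    refine ⟨m, hX _ hη ?_⟩
    rw [map_pow, hm, map_zero]
  have h3 : s' ∈ X.nilradical.ideal (X.affineBasicOpen g) := h2
  rw [← Scheme.IdealSheafData.map_ideal_basicOpen, ha, Ideal.map_span, Set.image_singleton] at h3
  obtain ⟨c, hc⟩ := Ideal.mem_span_singleton'.mp h3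
  refine ⟨gen _ hη c, gen_mem_localRing hg c, ?_⟩
  rw [← hc, map_mul, mul_comm]
  exact congrArg (· * _) (gen_res (homOfLE (X.basicOpen_le g)) hη a)

lemma CurveStalks.localData (hX : CurveStalks X) {n : ℕ}
    (hn : IsLeast {k : ℕ | X.nilradical ^ k = ⊥} n) {U : X.affineOpens} {x : X} (hx : x ∈ U.1)
    {a : Γ(X, U.1)} (ha : X.nilradical.ideal U = Ideal.span {a}) :
    LocalData (localRing x) (gen U.1 (generic_mem hx) a) n := by
  have := hX.noeth
  have hη := generic_mem hx
  have han : IsNilpotent a := by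
    have : a ∈ X.nilradical.ideal U := ha ▸ Ideal.mem_span_singleton_self a
    exact this
  have hdvd : ∀ k : X.functionField, IsNilpotent k → gen U.1 hη a ∣ k := by
    intro k hk
    obtain ⟨s, -, hs⟩ := exists_mul_of_isNilpotent hX.genInjective hη ha (localRing_genericPoint k) hk
    exact ⟨s, hs⟩
  constructor
  · constructor
    · intro k
      exact (isUnit_or_isNilpotent k).imp_right (hdvd k)
    · have h1 : (X.nilradical ^ n).ideal U = ⊥ := by rw [hn.1]; rfl
      have h2 : a ^ n ∈ (X.nilradical ^ n).ideal U := by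
        change a ^ n ∈ X.nilradical.ideal U ^ n
        rw [ha]
        exact Ideal.pow_mem_pow (Ideal.mem_span_singleton_self a) n
      rw [h1, Ideal.mem_bot] at h2
      rw [← map_pow, h2, map_zero]
    -- If this power vanished, so would the same power of the ideal of nilpotents, all of which are
    -- multiples of the chosen generator at the generic point. Minimality then gives `n ≤ n - 1`, so
    -- `n = 0`, and the vanishing power is the zeroth one, which is 1.
    · intro h0
      have h1 : X.nilradical ^ (n - 1) = ⊥ := by
        refine le_bot_iff.mp fun W b hb => ?_
        rw [Scheme.IdealSheafData.ideal_bot]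
        change b = 0
        by_cases hW : genericPoint X ∈ W.1
        · refine hX.genInjective W.1 hW ?_
          have h2 : (X.nilradical ^ (n - 1)).ideal W ≤
              (Ideal.span {gen U.1 hη a} ^ (n - 1)).comap (gen W.1 hW) := by
            rw [Scheme.IdealSheafData.ideal_pow]
            refine (Ideal.pow_right_mono ?_ _).trans (Ideal.le_comap_pow _ _)
            intro c hc
            exact Ideal.mem_span_singleton.mpr
              (hdvd _ ((mem_nilradical_ideal.mp hc).map (gen W.1 hW)))
          have h3 := Ideal.mem_comap.mp (h2 hb)
          rw [Ideal.span_singleton_pow, h0, Ideal.span_singleton_zero] at h3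
          exact h3.trans (map_zero _).symm
        · exact @Subsingleton.elim _ (subsingleton_sections (structureSheaf X) hW) _ _
      have h2 : n ≤ n - 1 := hn.2 h1
      have h3 : n - 1 = 0 := by omega
      rw [h3, pow_zero] at h0
      exact one_ne_zero h0
  · have : Function.Surjective (specMap x).rangeRestrict := RingHom.rangeRestrict_surjective _
    exact isNoetherianRing_of_surjective _ _ _ this
  -- The element is a fraction of two stalk elements, which are compared in the valuation ring
  -- obtained modulo nilpotents.
  · intro k
    obtain ⟨α, β, ⟨u, hu⟩, e⟩ := exists_stalk_fraction x k
    obtain ⟨t, ht, ht'⟩ := hX.exists_generator x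
    obtain ⟨c, hc | hc⟩ := exists_sub_mul_mem_nilradical ht ht' α β
    · refine Or.inl ⟨_, specMap_mem x c, ?_⟩
      have h1 := hdvd _ ((mem_nilradical.mp hc).map (specMap x))
      rw [map_sub, map_mul, ← e, ← hu] at h1
      have h2 : k - specMap x c = (k * u - u * specMap x c) * (u⁻¹ : Units _) := by
        rw [sub_mul, mul_assoc, Units.mul_inv, mul_comm (u : X.functionField), mul_assoc, Units.mul_inv]
        ring
      rw [h2]
      exact h1.mul_right _
    · refine Or.inr ⟨_, specMap_mem x c, ?_⟩
      have h1 := hdvd _ ((mem_nilradical.mp hc).map (specMap x))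
      rw [map_sub, map_mul, ← e, ← hu] at h1
      have h2 : k * specMap x c - 1 = - ((u - k * u * specMap x c) * (u⁻¹ : Units _)) := by
        rw [sub_mul, Units.mul_inv, mul_right_comm k, mul_assoc _ (u : X.functionField), Units.mul_inv]
        ring
      rw [h2]
      exact (h1.mul_right _).neg_right
  · exact gen_mem_localRing hx a
  · intro r hr hd
    refine exists_mul_of_isNilpotent hX.genInjective hx ha hr ?_
    obtain ⟨z, rfl⟩ := hd
    exact (Commute.all _ _).isNilpotent_mul_right (han.map (gen U.1 hη))

end

/-! ### Ideal sheaves as families -/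

section

section Kernel

variable {Y : Scheme.{u}}

/-- The functor of sections over an open set. -/
def sectionsFunctor (U : Y.Opens) : Y.Modules ⥤ Ab.{u} :=
  Scheme.Modules.toPresheaf Y ⋙ (evaluation _ _).obj (op U)

instance (U : Y.Opens) : (sectionsFunctor U).Additive := ⟨rfl⟩

instance (U : Y.Opens) : Limits.PreservesFiniteLimits (sectionsFunctor U) :=
  have : Limits.PreservesFiniteLimits (Scheme.Modules.toPresheaf Y) := inferInstance
  have : Limits.PreservesFiniteLimits ((evaluation Y.Opensᵒᵖ Ab.{u}).obj (op U)) := inferInstance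
  Limits.comp_preservesFiniteLimits _ _

lemma exists_kernel_section {F G : Y.Modules} (φ : F ⟶ G) {U : Y.Opens} (a : Γ(F, U))
    (ha : φ.app U a = 0) : ∃ s : Γ(Limits.kernel φ, U), (Limits.kernel.ι φ).app U s = a := by
  have h := (ShortComplex.exact_kernel φ).map_of_mono_of_preservesKernel (sectionsFunctor U)
    inferInstance inferInstance
  exact (ShortComplex.ab_exact_iff _).mp h a ha

lemma kernel_section {F G : Y.Modules} (φ : F ⟶ G) {U : Y.Opens} (s : Γ(Limits.kernel φ, U)) :
    φ.app U ((Limits.kernel.ι φ).app U s) = 0 :=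
  congrArg (fun ψ : Limits.kernel φ ⟶ G => ψ.app U s) (Limits.kernel.condition φ)

/-- The restriction of functions to a closed subscheme. -/
def toPushforward (Z : Y.IdealSheafData) :
    structureSheaf Y ⟶ (Scheme.Modules.pushforward Z.subschemeι).obj
      (structureSheaf Z.subscheme) :=
  SheafOfModules.unitToPushforwardObjUnit Z.subschemeι.toRingCatSheafHom

/-- The inclusion of an ideal sheaf in the structure sheaf. -/
def idealModuleι (Z : Y.IdealSheafData) : idealModule Z ⟶ structureSheaf Y :=
  Limits.kernel.ι (toPushforward Z)

instance (Z : Y.IdealSheafData) : Mono (idealModuleι Z) :=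
  inferInstanceAs (Mono (Limits.kernel.ι (toPushforward Z)))

lemma idealModuleι_app_mem (Z : Y.IdealSheafData) (U : Y.affineOpens) (s : Γ(idealModule Z, U.1)) :
    (show Γ(Y, U.1) from (idealModuleι Z).app U.1 s) ∈ Z.ideal U := by
  rw [← Z.ker_subschemeι_app]
  exact kernel_section (toPushforward Z) s

lemma exists_idealModuleι_app (Z : Y.IdealSheafData) (U : Y.affineOpens) {a : Γ(Y, U.1)}
    (ha : a ∈ Z.ideal U) : ∃ s : Γ(idealModule Z, U.1), (idealModuleι Z).app U.1 s = a := by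
  rw [← Z.ker_subschemeι_app] at ha
  exact exists_kernel_section (toPushforward Z) (U := U.1) a ha

end Kernel

variable {X : Scheme.{u}} [IrreducibleSpace X] (hX : GenInjective X)

/-- The embedding of an ideal sheaf in the function ring. -/
def idealEmb (Z : X.IdealSheafData) : RatEmb (idealModule Z) :=
  (unitEmb hX).comp (idealModuleι Z) (app_injective_of_mono _)

/-- The family of an ideal sheaf. -/
def idealFam (Z : X.IdealSheafData) : Family X := (idealEmb hX Z).fam

/-- An ideal sheaf is the sheaf of its family. -/
def idealModuleIso (Z : X.IdealSheafData) : idealModule Z ≅ famSheaf (idealFam hX Z) :=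
  (idealEmb hX Z).isoFam

lemma mem_idealFam_iff {Z : X.IdealSheafData} {x : X} {k : X.functionField} :
    k ∈ idealFam hX Z x ↔ ∃ (U : X.affineOpens) (hx : x ∈ U.1), ∃ a ∈ Z.ideal U,
      gen U.1 (generic_mem hx) a = k := by
  constructor
  · rintro ⟨U, hx, s, rfl⟩
    obtain ⟨V, hV, hxV, hle⟩ := exists_isAffineOpen_mem_and_subset hx
    refine ⟨⟨V, hV⟩, hxV, _, idealModuleι_app_mem Z ⟨V, hV⟩
      ((idealModule Z).presheaf.map (homOfLE hle).op s), ?_⟩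
    exact (idealEmb hX Z).val_res U V (homOfLE hle) (generic_mem hxV) s
  · rintro ⟨U, hx, a, ha, rfl⟩
    obtain ⟨s, hs⟩ := exists_idealModuleι_app Z U ha
    exact ⟨U.1, hx, s, congrArg (gen U.1 (generic_mem hx)) hs⟩

lemma gen_mem_idealFam {Z : X.IdealSheafData} {U : X.affineOpens} {x : X} (hx : x ∈ U.1)
    {a : Γ(X, U.1)} (ha : a ∈ Z.ideal U) : gen U.1 (generic_mem hx) a ∈ idealFam hX Z x :=
  (mem_idealFam_iff hX).mpr ⟨U, hx, a, ha, rfl⟩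

/-- Membership in the family of an ideal sheaf, over a given affine open set. -/
lemma mem_idealFam_iff_of_mem {Z : X.IdealSheafData} {U : X.affineOpens} {x : X} (hx : x ∈ U.1)
    {k : X.functionField} : k ∈ idealFam hX Z x ↔ ∃ a ∈ Z.ideal U, ∃ b : Γ(X, U.1),
      x ∈ X.basicOpen b ∧ gen U.1 (generic_mem hx) b * k = gen U.1 (generic_mem hx) a := by
  constructor
  · rw [mem_idealFam_iff]
    rintro ⟨V, hxV, a, ha, rfl⟩
    obtain ⟨f, hfV, hxf⟩ := U.2.exists_basicOpen_le ⟨x, hxV⟩ hx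
    have hη := generic_mem hxf
    let a' := X.presheaf.map (homOfLE hfV).op a
    have h1 : a' ∈ Z.ideal (X.affineBasicOpen f) := 
      Z.ideal_le_comap_ideal (U := X.affineBasicOpen f) (V := V) hfV ha
    rw [← Z.map_ideal_basicOpen] at h1
    let _ : Algebra Γ(X, U.1) Γ(X, X.basicOpen f) :=
      (X.presheaf.map (homOfLE (X.basicOpen_le f)).op).hom.toAlgebra
    have hloc : IsLocalization.Away f Γ(X, X.basicOpen f) := U.2.isLocalization_basicOpen f
    obtain ⟨⟨⟨c, hc⟩, ⟨_, m, rfl⟩⟩, e⟩ :=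
      (IsLocalization.mem_map_algebraMap_iff (Submonoid.powers f) Γ(X, X.basicOpen f)).mp h1
    refine ⟨c, hc, f ^ m, ?_, ?_⟩
    · rw [X.mem_basicOpen _ _ hx, map_pow]
      exact ((X.mem_basicOpen _ _ hx).mp hxf).pow m
    · have h2 := congrArg (gen (X.basicOpen f) hη) e
      rw [map_mul] at h2
      have h3 : gen (X.basicOpen f) hη a' = gen V.1 (generic_mem hxV) a := gen_res (homOfLE hfV) hη a
      have h4 : ∀ z : Γ(X, U.1), gen (X.basicOpen f) hη (algebraMap Γ(X, U.1) Γ(X, X.basicOpen f) z) =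
        gen U.1 (generic_mem hx) z := fun z => gen_res (homOfLE (X.basicOpen_le f)) hη z
      rw [h4, h4, h3] at h2
      rw [mul_comm]
      exact h2
  · rintro ⟨a, ha, b, hb, e⟩
    obtain ⟨r, hr⟩ := isUnit_gen b hb (generic_mem hx)
    have h1 : k = r.1 * gen U.1 (generic_mem hx) a := by
      rw [← e, ← mul_assoc, hr, one_mul]
    rw [h1]
    exact (idealFam hX Z x).smul_mem r (gen_mem_idealFam hX hx ha)

end

/-! ### Operations on ideal families, and the locally principal ones -/

section

/-- Membership in a submodule is local over an affine open set. -/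
lemma mem_of_locally_mem {Y : Scheme.{u}} {U : Y.Opens} (hU : IsAffineOpen U) {M : Type*} [AddCommGroup M]
    [Module Γ(Y, U) M] (P : Submodule Γ(Y, U) M) (m : M)
    (h : ∀ x ∈ U, ∃ q : Γ(Y, U), x ∈ Y.basicOpen q ∧ q • m ∈ P) : m ∈ P := by
  let J : Ideal Γ(Y, U) := P.comap (LinearMap.toSpanSingleton Γ(Y, U) M m)
  have h1 : Ideal.span (J : Set Γ(Y, U)) = ⊤ := by
    rw [← hU.self_le_iSup_basicOpen_iff]
    intro x hx
    obtain ⟨q, hq, hqm⟩ := h x hx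
    exact Opens.mem_iSup.mpr ⟨⟨q, hqm⟩, hq⟩
  rw [Ideal.span_eq, Ideal.eq_top_iff_one] at h1
  have h2 : (1 : Γ(Y, U)) • m ∈ P := h1
  rwa [one_smul] at h2

variable {X : Scheme.{u}} [IrreducibleSpace X] (hX : GenInjective X)

lemma mem_ideal_iff {Z : X.IdealSheafData} {U : X.affineOpens} {a : Γ(X, U.1)} :
    a ∈ Z.ideal U ↔ ∀ (x : X) (hx : x ∈ U.1), gen U.1 (generic_mem hx) a ∈ idealFam hX Z x := by
  refine ⟨fun ha x hx => gen_mem_idealFam hX hx ha, fun h => ?_⟩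
  refine mem_of_locally_mem U.2 (Z.ideal U) a fun x hx => ?_
  obtain ⟨c, hc, b, hb, e⟩ := (mem_idealFam_iff_of_mem hX hx).mp (h x hx)
  rw [← map_mul] at e
  exact ⟨b, hb, by rw [smul_eq_mul, hX _ _ e]; exact hc⟩

lemma idealFam_le_iff {Z Z' : X.IdealSheafData} :
    (∀ x, idealFam hX Z x ≤ idealFam hX Z' x) ↔ Z ≤ Z' := by
  constructor
  · intro h U a ha
    rw [mem_ideal_iff hX] at ha ⊢
    exact fun x hx => h x (ha x hx)
  · intro h x k hk
    obtain ⟨U, hx, a, ha, rfl⟩ := (mem_idealFam_iff hX).mp hk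
    exact gen_mem_idealFam hX hx (h U ha)

lemma idealFam_injective : Function.Injective (idealFam hX) := fun Z Z' h =>
  le_antisymm ((idealFam_le_iff hX).mp fun x => by rw [h]) ((idealFam_le_iff hX).mp fun x => by rw [h])

lemma mem_localRing_of_mem_idealFam {Z : X.IdealSheafData} {x : X} {k : X.functionField}
    (h : k ∈ idealFam hX Z x) : k ∈ localRing x := by
  obtain ⟨U, hx, a, -, rfl⟩ := (mem_idealFam_iff hX).mp h
  exact gen_mem_localRing hx a

lemma idealFam_spread (Z : X.IdealSheafData) : Spread (idealFam hX Z) := (idealEmb hX Z).spread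

/-- A submodule contains the stalk of an ideal sheaf if it contains the sections over an affine
open set. -/
lemma idealFam_le_of_mem {Z : X.IdealSheafData} {U : X.affineOpens} {x : X} (hx : x ∈ U.1)
    {N : Submodule (localRing x) X.functionField}
    (h : ∀ a ∈ Z.ideal U, gen U.1 (generic_mem hx) a ∈ N) : idealFam hX Z x ≤ N := by
  intro k hk
  obtain ⟨a, ha, b, hb, e⟩ := (mem_idealFam_iff_of_mem hX hx).mp hk
  obtain ⟨r, hr⟩ := isUnit_gen b hb (generic_mem hx)
  have h1 : k = r • gen U.1 (generic_mem hx) a := by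
    rw [← e, Subring.smul_def, smul_eq_mul, ← mul_assoc, hr, one_mul]
  rw [h1]
  exact N.smul_mem r (h a ha)

lemma idealFam_mul (Z Z' : X.IdealSheafData) :
    idealFam hX (Z * Z') = idealFam hX Z * idealFam hX Z' := by
  funext x
  obtain ⟨U, hU, hx, -⟩ := exists_isAffineOpen_mem_and_subset (U := ⊤) (x := x) trivial
  apply le_antisymm
  · refine idealFam_le_of_mem hX (U := ⟨U, hU⟩) hx fun a ha => ?_
    rw [Scheme.IdealSheafData.ideal_mul] at ha
    refine Submodule.mul_induction_on ha (fun c hc d hd => ?_) (fun c d hc hd => ?_)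
    · rw [map_mul]
      exact Submodule.mul_mem_mul (gen_mem_idealFam hX (U := ⟨U, hU⟩) hx hc)
        (gen_mem_idealFam hX (U := ⟨U, hU⟩) hx hd)
    · rw [map_add]
      exact add_mem hc hd
  · refine Submodule.mul_le.mpr fun m hm m' hm' => ?_
    obtain ⟨a, ha, b, hb, e⟩ := (mem_idealFam_iff_of_mem hX (U := ⟨U, hU⟩) hx).mp hm
    obtain ⟨a', ha', b', hb', e'⟩ := (mem_idealFam_iff_of_mem hX (U := ⟨U, hU⟩) hx).mp hm'
    refine (mem_idealFam_iff_of_mem hX (U := ⟨U, hU⟩) hx).mpr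
      ⟨a * a', Ideal.mul_mem_mul ha ha', b * b', ?_, ?_⟩
    · rw [Scheme.basicOpen_mul]
      exact ⟨hb, hb'⟩
    · rw [map_mul, map_mul, ← e, ← e']
      ring

lemma idealFam_sup (Z Z' : X.IdealSheafData) (x : X) :
    idealFam hX (Z ⊔ Z') x = idealFam hX Z x ⊔ idealFam hX Z' x := by
  obtain ⟨U, hU, hx, -⟩ := exists_isAffineOpen_mem_and_subset (U := ⊤) (x := x) trivial
  apply le_antisymm
  · refine idealFam_le_of_mem hX (U := ⟨U, hU⟩) hx fun a ha => ?_
    obtain ⟨c, hc, d, hd, rfl⟩ := Submodule.mem_sup.mp ha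
    rw [map_add]
    exact Submodule.add_mem_sup (gen_mem_idealFam hX (U := ⟨U, hU⟩) hx hc)
        (gen_mem_idealFam hX (U := ⟨U, hU⟩) hx hd)
  · exact sup_le ((idealFam_le_iff hX).mpr le_sup_left x) ((idealFam_le_iff hX).mpr le_sup_right x)

lemma idealFam_eq_prin {Z : X.IdealSheafData} {U : X.affineOpens} {x : X} (hx : x ∈ U.1)
    {a : Γ(X, U.1)} (ha : Z.ideal U = Ideal.span {a}) :
    idealFam hX Z x = prin X (gen U.1 (generic_mem hx) a) x := by
  apply le_antisymm
  · refine idealFam_le_of_mem hX hx fun b hb => ?_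
    rw [ha] at hb
    obtain ⟨c, rfl⟩ := Ideal.mem_span_singleton'.mp hb
    rw [map_mul]
    exact Submodule.smul_mem _ (⟨_, gen_mem_localRing hx c⟩ : localRing x)
      (Submodule.mem_span_singleton_self _)
  · refine (Submodule.span_singleton_le_iff_mem _ _).mpr (gen_mem_idealFam hX hx ?_)
    rw [ha]
    exact Ideal.mem_span_singleton_self a

lemma mem_prin_iff {x : X} {w k : X.functionField} : k ∈ prin X w x ↔ ∃ r ∈ localRing x, k = w * r := by
  refine Submodule.mem_span_singleton.trans ⟨?_, ?_⟩
  · rintro ⟨r, rfl⟩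
    exact ⟨r.1, r.2, mul_comm _ _⟩
  · rintro ⟨r, hr, rfl⟩
    exact ⟨⟨r, hr⟩, mul_comm _ _⟩

lemma prin_mul (w w' : X.functionField) : prin X w * prin X w' = prin X (w * w') := by
  funext x
  exact (Submodule.span_mul_span _ _ _).trans (by rw [Set.singleton_mul_singleton]; rfl)

/-- A unit of the function ring is a unit of almost all local rings. -/
lemma exists_prin_eq_one (w : X.functionFieldˣ) :
    ∃ V : X.Opens, genericPoint X ∈ V ∧ ∀ x ∈ V, prin X w x = (1 : Family X) x := by
  obtain ⟨U, hU, a, ha⟩ := exists_gen_eq (w : X.functionField)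
  obtain ⟨U', hU', a', ha'⟩ := exists_gen_eq ((w⁻¹ : X.functionFieldˣ) : X.functionField)
  refine ⟨U ⊓ U', ⟨hU, hU'⟩, fun x hx => ?_⟩
  have h1 : (w : X.functionField) ∈ localRing x := ha ▸ gen_mem_localRing hx.1 a
  have h2 : ((w⁻¹ : X.functionFieldˣ) : X.functionField) ∈ localRing x :=
    ha' ▸ gen_mem_localRing hx.2 a'
  ext k
  rw [mem_prin_iff, mem_one_iff]
  constructor
  · rintro ⟨r, hr, rfl⟩
    exact mul_mem h1 hr
  · intro hk
    exact ⟨_, mul_mem h2 hk, by rw [Units.mul_inv_cancel_left]⟩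

lemma LocPrincipal.exists_eq_one {ℓ : Family X} (h : LocPrincipal ℓ) :
    ∃ V : X.Opens, genericPoint X ∈ V ∧ ∀ x ∈ V, ℓ x = (1 : Family X) x := by
  obtain ⟨U, hU, w, hw⟩ := h (genericPoint X)
  obtain ⟨V, hV, h1⟩ := exists_prin_eq_one w
  exact ⟨U ⊓ V, ⟨hU, hV⟩, fun x hx => (hw x hx.1).trans (h1 x hx.2)⟩

section Finite

variable (hC : CurveLike X)

include hC

/-- Points have neighbourhoods that avoid all other points of a finite set. -/
lemma CurveLike.exists_nhds {B : Set X} (hB : B.Finite) (hη : genericPoint X ∉ B) (x : X) :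
    ∃ W : X.Opens, x ∈ W ∧ ∀ x' ∈ W, x' ∈ B → x' = x := by
  have hc : IsClosed (B \ {x}) := by
    rw [← Set.biUnion_of_singleton (B \ {x})]
    refine (hB.subset Set.sdiff_subset).isClosed_biUnion fun b hb => hC.isClosed b ?_
    rintro rfl
    exact hη hb.1
  refine ⟨⟨(B \ {x})ᶜ, hc.isOpen_compl⟩, fun h => h.2 rfl, fun x' hx' hB => ?_⟩
  by_contra hne
  exact hx' ⟨hB, hne⟩

/-- Near `x` one removes the finitely many other points at which `ℓ` is not trivial or `w` is not a
unit of the local ring. What remains is generated by `w`. -/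
lemma locPrincipal_of_finite {ℓ : Family X} (h : ∀ x, ∃ w : X.functionFieldˣ, ℓ x = prin X w x)
    {V : X.Opens} (hV : genericPoint X ∈ V) (h1 : ∀ x ∈ V, ℓ x = (1 : Family X) x) :
    LocPrincipal ℓ := by
  intro x
  obtain ⟨w, hw⟩ := h x
  obtain ⟨V', hV', h2⟩ := exists_prin_eq_one w
  have hη : genericPoint X ∈ V ⊓ V' := ⟨hV, hV'⟩
  obtain ⟨W, hxW, hW⟩ := hC.exists_nhds (hC.cofinite _ hη) (fun h => h hη) x
  refine ⟨W, hxW, w, fun x' hx' => ?_⟩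
  by_cases hx : x' ∈ V ⊓ V'
  · exact (h1 x' hx.1).trans (h2 x' hx.2).symm
  · rw [hW x' hx' hx]
    exact hw

lemma spread_of_finite {I : Family X} (hI : ∀ x, I x ≤ (1 : Family X) x)
    {V : X.Opens} (hV : genericPoint X ∈ V) (h1 : ∀ x ∈ V, I x = (1 : Family X) x) : Spread I := by
  intro x k hk
  obtain ⟨U, hx, a, rfl⟩ := mem_localRing_iff.mp (mem_one_iff.mp (hI x hk))
  obtain ⟨W, hxW, hW⟩ := hC.exists_nhds (hC.cofinite _ hV) (fun h => h hV) x
  refine ⟨U ⊓ W, ⟨hx, hxW⟩, fun x' hx' => ?_⟩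
  by_cases h : x' ∈ V
  · rw [h1 x' h]
    exact mem_one_iff.mpr (gen_mem_localRing hx'.1 a)
  · obtain rfl := hW x' hx'.2 h
    exact hk

end Finite

lemma LocPrincipal.mul {ℓ ℓ' : Family X} (h : LocPrincipal ℓ) (h' : LocPrincipal ℓ') :
    LocPrincipal (ℓ * ℓ') := by
  intro x
  obtain ⟨U, hx, w, hw⟩ := h x
  obtain ⟨U', hx', w', hw'⟩ := h' x
  refine ⟨U ⊓ U', ⟨hx, hx'⟩, w * w', fun y hy => ?_⟩
  rw [Units.val_mul, ← prin_mul, Pi.mul_apply, Pi.mul_apply, hw y hy.1, hw' y hy.2]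

lemma locPrincipal_prin (w : X.functionFieldˣ) : LocPrincipal (prin X w) :=
  fun _ => ⟨⊤, trivial, w, fun _ _ => rfl⟩

lemma locPrincipal_one : LocPrincipal (1 : Family X) := by
  rw [one_eq_prin]
  exact locPrincipal_prin 1

/-- The inverses of the local generators are used: two units that generate the same module have
inverses that generate the same module, so these choices are compatible on neighbourhoods. -/
lemma LocPrincipal.exists_inv {ℓ : Family X} (h : LocPrincipal ℓ) :
    ∃ ℓ' : Family X, LocPrincipal ℓ' ∧ ℓ * ℓ' = 1 := by
  choose U hU w hw using h
  have key : ∀ x x', x' ∈ U x → prin X ((w x')⁻¹ : X.functionFieldˣ) x' =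
      prin X ((w x)⁻¹ : X.functionFieldˣ) x' := by
    intro x x' hx
    have h1 : ∀ v v' : X.functionFieldˣ, prin X v x' = prin X v' x' →
        prin X (v⁻¹ : X.functionFieldˣ) x' ≤ prin X (v'⁻¹ : X.functionFieldˣ) x' := by
      intro v v' h
      have h2 : (v' : X.functionField) ∈ prin X v x' := h ▸ Submodule.mem_span_singleton_self _
      obtain ⟨r, hr, e⟩ := mem_prin_iff.mp h2
      refine (Submodule.span_singleton_le_iff_mem _ _).mpr (mem_prin_iff.mpr ⟨r, hr, ?_⟩)
      have h3 : r = (v⁻¹ : X.functionFieldˣ) * v' := by rw [e, Units.inv_mul_cancel_left]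
      rw [h3, mul_left_comm, Units.inv_mul, mul_one]
    have h2 : prin X (w x') x' = prin X (w x) x' :=
      (hw x' x' (hU x')).symm.trans (hw x x' hx)
    exact le_antisymm (h1 _ _ h2) (h1 _ _ h2.symm)
  refine ⟨fun x => prin X ((w x)⁻¹ : X.functionFieldˣ) x, fun x => ⟨U x, hU x, (w x)⁻¹, key x⟩, ?_⟩
  funext x
  rw [Pi.mul_apply, hw x x (hU x), one_eq_prin]
  have h1 := congrFun (prin_mul (w x : X.functionField) ((w x)⁻¹ : X.functionFieldˣ)) x
  rw [Units.mul_inv] at h1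
  exact h1

end

/-! ### Gluing local ideals to ideal sheaves, and Cartier divisors -/

section

variable {X : Scheme.{u}} [IrreducibleSpace X]

/-- A family of ideals of the local rings that is trivial at almost all points. -/
structure IsIdealFamily (I : Family X) : Prop where
  le_one : ∀ x, I x ≤ (1 : Family X) x
  exists_unit : ∀ x, ∃ c : X.functionFieldˣ, (c : X.functionField) ∈ I x
  eq_one : ∃ V : X.Opens, genericPoint X ∈ V ∧ ∀ x ∈ V, I x = (1 : Family X) x

/-- The sections of a family of ideals over an affine open set. -/
def famIdeal (I : Family X) (U : X.Opens) : Ideal Γ(X, U) where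
  carrier := {a | ∀ (x : X) (hx : x ∈ U), gen U (generic_mem hx) a ∈ I x}
  add_mem' := fun ha hb x hx => by rw [map_add]; exact add_mem (ha x hx) (hb x hx)
  zero_mem' := fun x hx => by rw [map_zero]; exact zero_mem _
  smul_mem' := fun c a ha x hx => by
    rw [smul_eq_mul, map_mul]
    exact (I x).smul_mem (⟨_, gen_mem_localRing hx c⟩ : localRing x) (ha x hx)

/-- This is the quasi-coherence of the ideal. After multiplication by a power of `f`, a section over
the basic open set extends to a function `b` on `U`. At the points outside the basic open set `b`
may fail to lie in the ideal. Only finitely many of them carry a nontrivial ideal, and there a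
further power of `f` belongs to it. -/
lemma famIdeal_basicOpen (hX : CurveStalks X) (hC : CurveLike X) {I : Family X}
    (hI : IsIdealFamily I) (U : X.affineOpens) (f : Γ(X, U.1)) :
    (famIdeal I U.1).map (X.presheaf.map (homOfLE (X.basicOpen_le f)).op).hom =
      famIdeal I (X.basicOpen f) := by
  apply le_antisymm
  · refine Ideal.map_le_iff_le_comap.mpr fun a ha x hx => ?_
    have h1 := ha x (X.basicOpen_le f hx)
    rwa [← gen_res (homOfLE (X.basicOpen_le f)) (generic_mem hx)] at h1
  · intro s hs
    by_cases hη : genericPoint X ∈ X.basicOpen f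
    swap
    · have := subsingleton_sections (structureSheaf X) hη
      have h0 : s = 0 := @Subsingleton.elim _ this _ _
      rw [h0]
      exact zero_mem _
    have hηU : genericPoint X ∈ U.1 := X.basicOpen_le f hη
    have hres : ∀ z : Γ(X, U.1), gen (X.basicOpen f) hη
        (X.presheaf.map (homOfLE (X.basicOpen_le f)).op z) = gen U.1 hηU z :=
      fun z => gen_res (homOfLE (X.basicOpen_le f)) hη z
    obtain ⟨m, b, hb⟩ := exists_eq_pow_mul_of_isAffineOpen X U.1 U.2 f s
    have hb' : gen U.1 hηU b = gen U.1 hηU f ^ m * gen _ hη s := by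
      have h1 := congrArg (gen _ hη) hb
      rw [map_mul, map_pow] at h1
      exact (hres b).symm.trans (h1.trans (congrArg (fun z => z ^ m * _) (hres f)))
    obtain ⟨V, hV, hV1⟩ := hI.eq_one
    have hfin := hC.cofinite V hV
    -- Outside the basic open set `f` is a non-unit of the local ring, so a unit `c` of the function
    -- ring that lies in the ideal divides one of its powers.
    have hbad : ∀ x : X, ∃ j : ℕ, ∀ hx : x ∈ U.1, x ∉ X.basicOpen f → ∀ z ∈ localRing x,
        gen U.1 hηU f ^ j * z ∈ I x := by
      intro x
      by_cases hx : x ∈ U.1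
      swap
      · exact ⟨0, fun h => absurd h hx⟩
      by_cases hxf : x ∈ X.basicOpen f
      · exact ⟨0, fun _ h => absurd hxf h⟩
      obtain ⟨c, hc⟩ := hI.exists_unit x
      obtain ⟨j, r, hr, e⟩ := hX.exists_dvd_pow (x := x) (mem_one_iff.mp (hI.le_one x hc)) c.isUnit
        (gen_mem_localRing hx f) (fun r hr e => by
          obtain ⟨r, rfl⟩ := mem_localRing.mp hr
          rw [← specMap_germ hx, ← map_mul, ← map_one (specMap x)] at e
          have h1 := hX.specMap_injective x e
          exact hxf ((X.mem_basicOpen f x hx).mpr (IsUnit.of_mul_eq_one_right _ h1)))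
      refine ⟨j, fun _ _ z hz => ?_⟩
      have h1 : gen U.1 hηU f ^ j * z = r * z * c := by
        rw [e]; ring
      rw [h1]
      exact (I x).smul_mem (⟨_, mul_mem hr hz⟩ : localRing x) hc
    choose j hj using hbad
    let J := hfin.toFinset.sup j
    have hmem : f ^ J * b ∈ famIdeal I U.1 := by
      intro x hx
      rw [map_mul, map_pow]
      by_cases hxf : x ∈ X.basicOpen f
      · rw [hb', ← mul_assoc, ← pow_add, ← map_pow]
        exact (I x).smul_mem (⟨_, gen_mem_localRing hx _⟩ : localRing x) (hs x hxf)
      · by_cases hxV : x ∈ V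
        · rw [hV1 x hxV, mem_one_iff, ← map_pow]
          exact mul_mem (gen_mem_localRing hx _) (gen_mem_localRing hx b)
        · have hle : j x ≤ J := Finset.le_sup (f := j) (hfin.mem_toFinset.mpr hxV)
          obtain ⟨i, hi⟩ := Nat.exists_eq_add_of_le hle
          rw [hi, pow_add, mul_assoc]
          refine hj x hx hxf _ ?_
          rw [← map_pow]
          exact mul_mem (gen_mem_localRing hx _) (gen_mem_localRing hx b)
    have hu : IsUnit (X.presheaf.map (homOfLE (X.basicOpen_le f)).op f) :=
      X.toRingedSpace.isUnit_res_basicOpen f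
    obtain ⟨v, hv⟩ := (hu.pow (J + m)).exists_left_inv
    have h1 : s = v * X.presheaf.map (homOfLE (X.basicOpen_le f)).op (f ^ J * b) := by
      refine hX.genInjective _ hη ?_
      have h2 := congrArg (gen _ hη) hv
      rw [map_mul, map_one, map_pow, hres] at h2
      rw [map_mul, hres, map_mul, hb', map_pow, ← mul_assoc (gen U.1 hηU f ^ J), ← pow_add,
        ← mul_assoc, h2, one_mul]
    rw [h1]
    exact Ideal.mul_mem_left _ _ (Ideal.mem_map_of_mem _ hmem)

/-- The ideal sheaf of a family of ideals. -/
lemma IsIdealFamily.exists_idealSheaf (hX : CurveStalks X) (hC : CurveLike X) {I : Family X}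
    (hI : IsIdealFamily I) : ∃ Z : X.IdealSheafData, idealFam hX.genInjective Z = I := by
  refine ⟨⟨fun U => famIdeal I U.1, famIdeal_basicOpen hX hC hI, _, rfl⟩, ?_⟩
  obtain ⟨V, hV, hV1⟩ := hI.eq_one
  have hs := spread_of_finite hC hI.le_one hV hV1
  funext x
  apply le_antisymm
  · intro k hk
    obtain ⟨U, hx, a, ha, rfl⟩ := (mem_idealFam_iff _).mp hk
    exact ha x hx
  · intro k hk
    obtain ⟨W, hxW, hW⟩ := hs x k hk
    obtain ⟨U, hU, hx, hle⟩ := exists_isAffineOpen_mem_and_subset hxW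
    obtain ⟨a, rfl⟩ := hX.genInjective.sectionsRegular U (generic_mem hx) k fun x' hx' =>
      mem_one_iff.mp (hI.le_one x' (hW x' (hle hx')))
    exact (mem_idealFam_iff _).mpr ⟨⟨U, hU⟩, hx, a, fun x' hx' => hW x' (hle hx'), rfl⟩

/-- A nonzerodivisor on a nonempty affine open set is not nilpotent, hence is a unit at the generic
point. Conversely a unit that generates the ideals at all points of an affine open set is a function
there, and generates the ideal of sections. -/
lemma isEffectiveCartier_iff (hX : CurveStalks X) {D : X.IdealSheafData} :
    IsEffectiveCartier D ↔ LocPrincipal (idealFam hX.genInjective D) := by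
  constructor
  · intro h x
    obtain ⟨U, hx, f, hf, e⟩ := h x
    have hη := generic_mem hx
    have hu : IsUnit (gen U.1 hη f) := by
      refine (isNilpotent_or_isUnit_gen U.2 hη f).resolve_left fun hn => ?_
      have hnt : Nontrivial Γ(X, U.1) := (gen U.1 hη).domain_nontrivial
      obtain ⟨m, hm⟩ := hn
      exact nonZeroDivisors.ne_zero (pow_mem hf m) hm
    obtain ⟨w, hw⟩ := hu
    refine ⟨U.1, hx, w, fun x' hx' => ?_⟩
    rw [idealFam_eq_prin hX.genInjective hx' e, hw]
  · intro h x
    obtain ⟨W, hxW, w, hw⟩ := h x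
    obtain ⟨U, hU, hx, hle⟩ := exists_isAffineOpen_mem_and_subset hxW
    have hη := generic_mem hx
    obtain ⟨f, hf⟩ := hX.genInjective.sectionsRegular U hη w fun x' hx' => by
      refine mem_localRing_of_mem_idealFam hX.genInjective (Z := D) ?_
      rw [hw x' (hle hx')]
      exact Submodule.mem_span_singleton_self _
    refine ⟨⟨U, hU⟩, hx, f, ?_, ?_⟩
    · refine mem_nonZeroDivisors_iff_right.mpr fun z hz => hX.genInjective U hη ?_
      have h1 := congrArg (gen U hη) hz
      rw [map_mul, map_zero, hf] at h1
      rw [map_zero]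
      exact (w.isUnit.mul_left_eq_zero).mp h1
    · ext a
      rw [mem_ideal_iff hX.genInjective, Ideal.mem_span_singleton']
      constructor
      · intro ha
        obtain ⟨c, hc⟩ := hX.genInjective.sectionsRegular U hη
          ((w⁻¹ : X.functionFieldˣ) * gen U hη a) fun x' hx' => by
            have h1 := ha x' hx'
            rw [hw x' (hle hx')] at h1
            obtain ⟨r, hr, e⟩ := mem_prin_iff.mp h1
            rwa [e, Units.inv_mul_cancel_left]
        refine ⟨c, hX.genInjective U hη ?_⟩
        rw [map_mul, hc, hf, mul_comm, Units.mul_inv_cancel_left]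
      · rintro ⟨c, rfl⟩ x' hx'
        rw [hw x' (hle hx')]
        exact mem_prin_iff.mpr ⟨gen U hη c, gen_mem_localRing hx' c, by rw [map_mul, hf, mul_comm]⟩

/-- Locally principal families play the role of invertible fractional ideals. From left to right one
divides by the family of `D₁`. From right to left one clears the denominators of `ℓ` at the finitely
many points where it is not trivial: the denominators define `D₁`, and their product with `ℓ`
defines `D₂`. -/
lemma differByCartier_iff (hX : CurveStalks X) (hC : CurveLike X) {Z Z' : X.IdealSheafData} :
    DifferByCartier Z Z' ↔ ∃ ℓ : Family X, LocPrincipal ℓ ∧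
      idealFam hX.genInjective Z' = idealFam hX.genInjective Z * ℓ := by
  constructor
  · rintro ⟨D₁, D₂, h₁, h₂, e⟩
    rw [isEffectiveCartier_iff hX] at h₁ h₂
    obtain ⟨ℓ, hℓ, e'⟩ := h₁.exists_inv
    refine ⟨_, h₂.mul hℓ, ?_⟩
    have h := congrArg (idealFam hX.genInjective) e
    rw [idealFam_mul, idealFam_mul] at h
    rw [← mul_assoc, ← h, mul_assoc, e', mul_one]
  · rintro ⟨ℓ, hℓ, e⟩
    obtain ⟨V, hV, hV1⟩ := hℓ.exists_eq_one
    have hd : ∀ x, ∃ d : X.functionFieldˣ, (x ∈ V → d = 1) ∧ (d : X.functionField) ∈ localRing x ∧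
        ∀ k ∈ ℓ x, d * k ∈ localRing x := by
      intro x
      by_cases hx : x ∈ V
      · refine ⟨1, fun _ => rfl, one_mem _, fun k hk => ?_⟩
        rw [hV1 x hx, mem_one_iff] at hk
        rwa [Units.val_one, one_mul]
      · obtain ⟨U, hxU, w, hw⟩ := hℓ x
        obtain ⟨a, b, ⟨d, hd⟩, e⟩ := exists_stalk_fraction x (w : X.functionField)
        refine ⟨d, fun h => absurd h hx, hd ▸ specMap_mem x b, fun k hk => ?_⟩
        rw [hw x hxU] at hk
        obtain ⟨r, hr, rfl⟩ := mem_prin_iff.mp hk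
        rw [← mul_assoc, mul_comm (d : X.functionField), hd, e]
        exact mul_mem (specMap_mem x a) hr
    choose d hd1 hdm hdl using hd
    let ℓ₁ : Family X := fun x => prin X (d x) x
    have h₁ : LocPrincipal ℓ₁ := locPrincipal_of_finite hC (fun x => ⟨d x, rfl⟩) hV fun x hx => by
      rw [one_eq_prin]
      change prin X (d x) x = _
      rw [hd1 x hx, Units.val_one]
    have hideal : ∀ ℓ' : Family X, LocPrincipal ℓ' → (∀ x, ℓ' x ≤ (1 : Family X) x) →
        IsIdealFamily ℓ' := fun ℓ' h h1 => ⟨h1, fun x => by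
          obtain ⟨U, hx, w, hw⟩ := h x
          exact ⟨w, hw x hx ▸ Submodule.mem_span_singleton_self _⟩, h.exists_eq_one⟩
    obtain ⟨D₁, e₁⟩ := (hideal ℓ₁ h₁ fun x =>
      (Submodule.span_singleton_le_iff_mem _ _).mpr (mem_one_iff.mpr (hdm x))).exists_idealSheaf hX hC
    obtain ⟨D₂, e₂⟩ := (hideal (ℓ₁ * ℓ) (h₁.mul hℓ) fun x k hk => by
      obtain ⟨m, hm, rfl⟩ := Submodule.mem_span_singleton_mul.mp hk
      exact mem_one_iff.mpr (hdl x m hm)).exists_idealSheaf hX hC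
    refine ⟨D₁, D₂, ?_, ?_, idealFam_injective hX.genInjective ?_⟩
    · rw [isEffectiveCartier_iff hX, e₁]
      exact h₁
    · rw [isEffectiveCartier_iff hX, e₂]
      exact h₁.mul hℓ
    · rw [idealFam_mul, idealFam_mul, e, e₁, e₂, mul_assoc, mul_comm ℓ]

end

/-! ### The torsion sheaf and its schematic support -/

section

lemma ideal_pow_eq_bot {Y : Scheme.{u}} {U : Y.affineOpens} {n : ℕ} (hn : Y.nilradical ^ n = ⊥) : Y.nilradical.ideal U ^ n = ⊥ := by
  have h : (Y.nilradical ^ n).ideal U = ⊥ := by rw [hn]; rfl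
  exact h

variable {X : Scheme.{u}} [IrreducibleSpace X]

/-- A germ of a quasi-coherent sheaf is a fraction of a section over an affine open set. -/
lemma RatEmb.exists_mul_eq_val {F : X.Modules} (χ : RatEmb F) (hF : IsCoherent F) {U : X.Opens}
    (hU : IsAffineOpen U) {x : X} (hx : x ∈ U) {k : X.functionField} (hk : k ∈ χ.fam x) :
    ∃ (q : Γ(X, U)) (_ : x ∈ X.basicOpen q) (s : Γ(F, U)),
      gen U (generic_mem hx) q * k = χ.val U (generic_mem hx) s := by
  obtain ⟨V, hxV, s, rfl⟩ := hk
  obtain ⟨f, hfV, hxf⟩ := hU.exists_basicOpen_le ⟨x, hxV⟩ hx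
  have hη := generic_mem hxf
  obtain ⟨m, t, ht⟩ := (basicExtends_of_isQuasicoherent hF.1 hU f).exists_lift
    (F.presheaf.map (homOfLE hfV).op s)
  refine ⟨f ^ m, ?_, t, ?_⟩
  · rw [X.mem_basicOpen _ _ hx, map_pow]
    exact ((X.mem_basicOpen _ _ hx).mp hxf).pow m
  · have h1 := congrArg (χ.val _ hη) ht
    rw [χ.val_smul, χ.val_res, χ.val_res, gen_res] at h1
    exact h1.symm

section

variable (hX : GenInjective X) {F : X.Modules} (χ : RatEmb F) (hF : IsCoherent F) {U : X.affineOpens}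
  (hη : genericPoint X ∈ U.1) {n : ℕ} {y : X.functionField} (hy : NilpotentGenerator y n)

include hF in
/-- The sections of a coherent sheaf over an affine open set have a common denominator. -/
lemma RatEmb.exists_common_denominator : ∃ d : Γ(X, U.1), IsUnit (gen U.1 hη d) ∧
    ∀ s : Γ(F, U.1), ∃ p : Γ(X, U.1), gen U.1 hη d * χ.val U.1 hη s = gen U.1 hη p := by
  have key : ∀ N : Submodule Γ(X, U.1) Γ(F, U.1), N.FG → ∃ d : Γ(X, U.1), IsUnit (gen U.1 hη d) ∧
      ∀ s ∈ N, ∃ p : Γ(X, U.1), gen U.1 hη d * χ.val U.1 hη s = gen U.1 hη p := by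
    intro N hN
    induction N, hN using Submodule.fg_induction with
    | singleton s =>
      obtain ⟨a, b, hb, e⟩ := exists_fraction U.2 hη (χ.val U.1 hη s)
      refine ⟨b, hb, fun t ht => ?_⟩
      obtain ⟨r, rfl⟩ := Submodule.mem_span_singleton.mp ht
      exact ⟨r * a, by rw [χ.val_smul, map_mul, ← e]; ring⟩
    | sup N₁ N₂ _ _ h₁ h₂ =>
      obtain ⟨d₁, hd₁, h₁⟩ := h₁
      obtain ⟨d₂, hd₂, h₂⟩ := h₂
      refine ⟨d₁ * d₂, by rw [map_mul]; exact hd₁.mul hd₂, fun s hs => ?_⟩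
      obtain ⟨s₁, hs₁, s₂, hs₂, rfl⟩ := Submodule.mem_sup.mp hs
      obtain ⟨p₁, hp₁⟩ := h₁ s₁ hs₁
      obtain ⟨p₂, hp₂⟩ := h₂ s₂ hs₂
      exact ⟨d₂ * p₁ + d₁ * p₂, by rw [map_add, map_add, map_mul, map_mul, map_mul, ← hp₁, ← hp₂]; ring⟩
  have := hF.2 U
  obtain ⟨d, hd, h⟩ := key ⊤ (this.fg_top)
  exact ⟨d, hd, fun s => h s trivial⟩

include hX hy in
lemma exists_gen_eq_mul_unit : ∃ a ∈ X.nilradical.ideal U, ∃ u : X.functionFieldˣ,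
    gen U.1 hη a = y * u := by
  obtain ⟨a, b, ⟨u, hu⟩, e⟩ := exists_fraction U.2 hη y
  refine ⟨a, ?_, u, by rw [← e, hu]⟩
  refine mem_nilradical_ideal.mpr ⟨n, hX _ hη ?_⟩
  rw [map_pow, ← e, mul_pow, hy.pow_eq_zero, zero_mul, map_zero]

include hX hF hy in
/-- A section is torsion on the subscheme of multiplicity `n - 1` if and only if it is a multiple of
the highest power of the generator of the nilradical. -/
lemma RatEmb.mk_mem_torsionPart_iff (hn : X.nilradical ^ n = ⊥)
    (hu : ∃ s : Γ(F, U.1), IsUnit (χ.val U.1 hη s)) (m : Γ(F, U.1)) :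
    Submodule.Quotient.mk m ∈ torsionSections F (n - 1) U ↔ y ^ (n - 1) ∣ χ.val U.1 hη m := by
  have hn1 := hy.one_le
  obtain ⟨a, ha, u, hau⟩ := exists_gen_eq_mul_unit hX hη hy
  have hbot := ideal_pow_eq_bot (U := U) hn
  rw [torsionSections, torsionPart, LinearMap.mem_ker]
  constructor
  · intro h
    obtain ⟨d, hd, hp⟩ := χ.exists_common_denominator hF hη
    choose p hp using hp
    -- The test form is multiplication by `a * d`, with `d` a common denominator and `a` a nilpotent
    -- whose generic value is `y` times a unit. It kills the multiples of the power `n - 1` of the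
    -- nilradical, since the `n`-th power is zero. Its vanishing on `m` means that `y` kills `m`.
    let φ : Γ(F, U.1) →ₗ[Γ(X, U.1)] Γ(X, U.1) :=
      { toFun := fun s => a * p s
        map_add' := fun s t => hX _ hη (by
          rw [map_mul, map_add, map_mul, map_mul, ← hp, ← hp, ← hp, map_add]; ring)
        map_smul' := fun c s => hX _ hη (by
          rw [RingHom.id_apply, smul_eq_mul, map_mul, map_mul, map_mul, ← hp, ← hp, χ.val_smul]; ring) }
    have hφ : X.nilradical.ideal U ^ (n - 1) • (⊤ : Submodule Γ(X, U.1) Γ(F, U.1)) ≤ LinearMap.ker φ := by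
      refine Submodule.smul_le.mpr fun c hc s _ => ?_
      rw [LinearMap.mem_ker, map_smul]
      have h1 : c * a ∈ X.nilradical.ideal U ^ n := by
        have h2 := Ideal.mul_mem_mul hc ha
        rwa [← pow_succ, Nat.sub_add_cancel hn1] at h2
      rw [hbot, Ideal.mem_bot] at h1
      change c * (a * p s) = 0
      rw [← mul_assoc, h1, zero_mul]
    have h1 := LinearMap.congr_fun h (Submodule.liftQ _ φ hφ)
    have h2 : a * p m = 0 := h1
    have h3 := congrArg (gen U.1 hη) h2
    rw [map_mul, map_zero, ← hp, hau] at h3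
    have h4 : y ^ 1 * χ.val U.1 hη m = 0 := by
      have h5 : (u * gen U.1 hη d) * (y ^ 1 * χ.val U.1 hη m) = 0 := by rw [← h3]; ring
      exact ((u.isUnit.mul hd).mul_right_eq_zero).mp h5
    exact hy.dvd_of_pow_mul_eq_zero h4
  · rintro ⟨z, hz⟩
    refine LinearMap.ext fun ψ => ?_
    obtain ⟨s₁, hs₁⟩ := hu
    let φ : Γ(F, U.1) →ₗ[Γ(X, U.1)] Γ(X, U.1) := ψ.comp (Submodule.mkQ _)
    have hφ : ∀ c ∈ X.nilradical.ideal U ^ (n - 1), ∀ s, c * φ s = 0 := by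
      intro c hc s
      have h1 : φ (c • s) = 0 := by
        have h2 : c • s ∈ X.nilradical.ideal U ^ (n - 1) • (⊤ : Submodule Γ(X, U.1) Γ(F, U.1)) :=
          Submodule.smul_mem_smul hc trivial
        have h3 : Submodule.mkQ (X.nilradical.ideal U ^ (n - 1) •
            (⊤ : Submodule Γ(X, U.1) Γ(F, U.1))) (c • s) = 0 :=
          (Submodule.Quotient.mk_eq_zero _).mpr h2
        exact (congrArg ψ h3).trans (map_zero ψ)
      rwa [map_smul] at h1
    change φ m = 0
    refine hX _ hη ?_
    rw [map_zero]
    -- The values of a form on the quotient are killed by the power `n - 1` of the nilradical.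
    -- Generically the form is multiplication by `φ s₁` divided by the value of `s₁`, so it vanishes
    -- on multiples of `y ^ (n - 1)`.
    have h1 : y ^ (n - 1) * gen U.1 hη (φ s₁) = 0 := by
      have h2 := congrArg (gen U.1 hη) (hφ _ (Ideal.pow_mem_pow ha (n - 1)) s₁)
      rw [map_mul, map_pow, hau, mul_pow, map_zero] at h2
      have h3 : (u : X.functionField) ^ (n - 1) * (y ^ (n - 1) * gen U.1 hη (φ s₁)) = 0 := by
        rw [← h2]; ring
      exact ((u.isUnit.pow _).mul_right_eq_zero).mp h3
    obtain ⟨v, hv⟩ := hs₁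
    obtain ⟨p, q, hq, e⟩ := exists_fraction U.2 hη (χ.val U.1 hη m * (v⁻¹ : X.functionFieldˣ))
    have h2 : q • m = p • s₁ := χ.val_inj U.1 hη (by
      rw [χ.val_smul, χ.val_smul, ← e, ← hv]
      have := Units.inv_mul v
      linear_combination - (χ.val U.1 hη m * gen U.1 hη q) * this)
    have h3 := congrArg (fun t => gen U.1 hη (φ t)) h2
    simp only [map_smul, smul_eq_mul, map_mul] at h3
    have h4 : gen U.1 hη q * gen U.1 hη (φ m) = 0 := by
      rw [h3, ← e, hz]
      linear_combination (z * (v⁻¹ : X.functionFieldˣ) * gen U.1 hη q) * h1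
    exact (hq.mul_right_eq_zero).mp h4

end

lemma CurveStalks.exists_localData (hX : CurveStalks X) {n : ℕ}
    (hn : IsLeast {k : ℕ | X.nilradical ^ k = ⊥} n) (hp : ∀ x : X, ∃ U : X.affineOpens, x ∈ U.1 ∧
    (X.nilradical.ideal U).IsPrincipal) (x : X) : ∃ y : X.functionField,
      LocalData (localRing x) y n ∧ idealFam hX.genInjective X.nilradical x = prin X y x := by
  obtain ⟨U, hx, ⟨a, ha⟩⟩ := hp x
  exact ⟨_, hX.localData hn hx ha, idealFam_eq_prin hX.genInjective hx ha⟩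

lemma NilpotentGenerator.dvd {K : Type u} [CommRing K] [Nontrivial K] {y y' : K} {n n' : ℕ}
    (hy : NilpotentGenerator y n) (hy' : NilpotentGenerator y' n') : y ∣ y' :=
  (hy.isUnit_or y').resolve_left fun h => (hy'.isUnit_iff y').mp h dvd_rfl

section

variable (hX : GenInjective X) {F : X.Modules} (χ : RatEmb F) (hF : IsCoherent F) {n : ℕ}

include hF

lemma RatEmb.exists_isUnit_val (h1 : (1 : X.functionField) ∈ χ.fam (genericPoint X)) {U : X.affineOpens}
    (hη : genericPoint X ∈ U.1) : ∃ s : Γ(F, U.1), IsUnit (χ.val U.1 hη s) := by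
  obtain ⟨q, hq, s, e⟩ := χ.exists_mul_eq_val hF U.2 hη h1
  refine ⟨s, ?_⟩
  rw [← e, mul_one]
  exact (X.mem_basicOpen q _ hη).mp hq

include hX in
lemma RatEmb.mem_annihilator_iff {U : X.affineOpens} (hη : genericPoint X ∈ U.1)
    {y : X.functionField} (hy : NilpotentGenerator y n) (hn : X.nilradical ^ n = ⊥)
    (h1 : (1 : X.functionField) ∈ χ.fam (genericPoint X)) (b : Γ(X, U.1)) :
    b ∈ Module.annihilator Γ(X, U.1) (torsionSections F (n - 1) U) ↔
      ∀ m : Γ(F, U.1), y ^ (n - 1) ∣ χ.val U.1 hη m →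
        b • m ∈ X.nilradical.ideal U ^ (n - 1) • (⊤ : Submodule Γ(X, U.1) Γ(F, U.1)) := by
  have hmem := χ.mk_mem_torsionPart_iff hX hF hη hy hn (χ.exists_isUnit_val hF h1 hη)
  rw [Module.mem_annihilator]
  constructor
  · intro h m hm
    have h2 := congrArg Subtype.val (h ⟨_, (hmem m).mpr hm⟩)
    exact (Submodule.Quotient.mk_eq_zero _).mp h2
  · rintro h ⟨t, ht⟩
    obtain ⟨m, rfl⟩ := Submodule.Quotient.mk_surjective _ t
    refine Subtype.ext ?_
    exact (Submodule.Quotient.mk_eq_zero _).mpr (h m ((hmem m).mp ht))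

/-- The support of the torsion of a generalized line bundle, in terms of a family of ideals. -/
lemma RatEmb.isSupportOfTorsion (hn : X.nilradical ^ n = ⊥)
    (h1 : (1 : X.functionField) ∈ χ.fam (genericPoint X)) {y : X → X.functionField}
    (hy : ∀ x, LocalData (localRing x) (y x) n) (hN : ∀ x, idealFam hX X.nilradical x = prin X (y x) x)
    {g : X → X.functionFieldˣ} (hg : ∀ x, ∀ k ∈ χ.fam x, g x * k ∈ localRing x)
    (hg' : ∀ x, ∃ k ∈ χ.fam x, g x * k = y x ^ (n - 1)) {Z : X.IdealSheafData}
    (hZ : ∀ x, idealFam hX Z x = (prin X (g x) * χ.fam) x) :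
    IsSupportOfTorsion F (n - 1) (Z ⊔ X.nilradical) := by
  intro U
  by_cases hη : genericPoint X ∈ U.1
  swap
  · have h0 : Subsingleton Γ(X, U.1) := subsingleton_sections (structureSheaf X) hη
    ext b
    rw [Subsingleton.elim b 0]
    exact ⟨fun _ => zero_mem _, fun _ => zero_mem _⟩
  ext b
  -- All the `y x` generate the maximal ideal of the function ring, so divisibility by the power `n
  -- - 1` in that ring does not depend on the point.
  have hyy : ∀ x x', y x ^ (n - 1) ∣ y x' ^ (n - 1) := fun x x' =>
    pow_dvd_pow_of_dvd ((hy x).toNilpotentGenerator.dvd (hy x').toNilpotentGenerator) _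
  have hgenN : ∀ (x : X) (hx : x ∈ U.1), ∀ c ∈ X.nilradical.ideal U ^ (n - 1),
      gen U.1 hη c ∈ prin X (y x ^ (n - 1)) x := by
    intro x hx
    have h2 : ∀ j : ℕ, ∀ c ∈ X.nilradical.ideal U ^ j, gen U.1 hη c ∈ prin X (y x ^ j) x := by
      intro j
      induction j with
      | zero =>
        intro c _
        rw [pow_zero]
        exact mem_prin_iff.mpr ⟨_, gen_mem_localRing hx c, (one_mul _).symm⟩
      | succ j ih =>
        intro c hc
        rw [pow_succ] at hc
        refine Submodule.mul_induction_on hc (fun c hc d hd => ?_) (fun c d hc hd => ?_)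
        · obtain ⟨r, hr, e⟩ := mem_prin_iff.mp (ih c hc)
          have h3 := gen_mem_idealFam hX hx hd
          rw [hN] at h3
          obtain ⟨r', hr', e'⟩ := mem_prin_iff.mp h3
          refine mem_prin_iff.mpr ⟨r * r', mul_mem hr hr', ?_⟩
          rw [map_mul, e, e', pow_succ]; ring
        · rw [map_add]
          exact add_mem hc hd
    exact h2 (n - 1)
  rw [mem_ideal_iff hX, χ.mem_annihilator_iff hX hF hη (hy (genericPoint X)).toNilpotentGenerator hn h1]
  -- The local criterion for annihilating the torsion. What remains is to pass between germs and
  -- sections over `U` by clearing denominators.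
  have hloc : ∀ (x : X) (hx : x ∈ U.1),
      gen U.1 (generic_mem hx) b ∈ idealFam hX (Z ⊔ X.nilradical) x ↔
        ∀ k ∈ χ.fam x, y x ^ (n - 1) ∣ k → ∃ m ∈ χ.fam x, gen U.1 hη b * k = y x ^ (n - 1) * m := by
    intro x hx
    rw [(hy x).annihilates_iff (hg x) (hg' x) (gen_mem_localRing hx b), idealFam_sup, hN, hZ,
      Submodule.mem_sup]
    constructor
    · rintro ⟨_, hc, _, hd, e⟩
      obtain ⟨m, hm, rfl⟩ := mem_prin_mul.mp hc
      obtain ⟨s, hs, rfl⟩ := mem_prin_iff.mp hd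
      exact ⟨m, hm, s, hs, e.symm⟩
    · rintro ⟨m, hm, s, hs, e⟩
      exact ⟨_, mem_prin_mul.mpr ⟨m, hm, rfl⟩, _, mem_prin_iff.mpr ⟨s, hs, rfl⟩, e.symm⟩
  constructor
  · intro h m hm
    refine mem_of_locally_mem U.2 _ _ fun x hx => ?_
    obtain ⟨m', hm', e⟩ := (hloc x hx).mp (h x hx) (χ.val U.1 hη m) ⟨U.1, hx, m, rfl⟩
      ((hyy _ _).trans hm)
    obtain ⟨q, hq, s, hs⟩ := χ.exists_mul_eq_val hF U.2 hx hm'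
    have h2 : y x ∈ idealFam hX X.nilradical x := by
      rw [hN]; exact Submodule.mem_span_singleton_self _
    obtain ⟨c, hc, q', hq', e'⟩ := (mem_idealFam_iff_of_mem hX hx).mp h2
    -- Here `q` is a denominator of `m'` and `q'` one of `y x`, which occurs to the power `n - 1`.
    refine ⟨q * q' ^ (n - 1), ?_, ?_⟩
    · rw [X.mem_basicOpen _ _ hx, map_mul, map_pow]
      exact ((X.mem_basicOpen _ _ hx).mp hq).mul (((X.mem_basicOpen _ _ hx).mp hq').pow _)
    · have h3 : (q * q' ^ (n - 1)) • b • m = c ^ (n - 1) • s := χ.val_inj U.1 hη (by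
        rw [χ.val_smul, χ.val_smul, χ.val_smul, map_mul, map_pow, map_pow, ← e', ← hs, mul_assoc, e]
        ring)
      rw [h3]
      exact Submodule.smul_mem_smul (Ideal.pow_mem_pow hc _) trivial
  · intro h x hx
    refine (hloc x hx).mpr fun k hk hd => ?_
    obtain ⟨q, hq, s, hs⟩ := χ.exists_mul_eq_val hF U.2 hx hk
    have h2 : y (genericPoint X) ^ (n - 1) ∣ χ.val U.1 hη s := by
      rw [← hs]
      exact ((hyy _ _).trans hd).mul_left _
    have h3 := h s h2
    have h4 : ∀ t ∈ X.nilradical.ideal U ^ (n - 1) • (⊤ : Submodule Γ(X, U.1) Γ(F, U.1)),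
        ∃ m ∈ χ.fam x, χ.val U.1 hη t = y x ^ (n - 1) * m := by
      intro t ht
      refine Submodule.smul_induction_on ht (fun c hc t _ => ?_) (fun t t' ht ht' => ?_)
      · obtain ⟨r, hr, e⟩ := mem_prin_iff.mp (hgenN x hx c hc)
        have ht : χ.val U.1 hη t ∈ χ.fam x := ⟨U.1, hx, t, rfl⟩
        exact ⟨_, (χ.fam x).smul_mem (⟨r, hr⟩ : localRing x) ht, by
          rw [χ.val_smul, e, Subring.smul_def, smul_eq_mul, mul_assoc]⟩
      · obtain ⟨m, hm, e⟩ := ht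
        obtain ⟨m', hm', e'⟩ := ht'
        exact ⟨m + m', add_mem hm hm', by rw [map_add, e, e', mul_add]⟩
    obtain ⟨m, hm, e⟩ := h4 _ h3
    obtain ⟨r, hr⟩ := isUnit_gen q hq hη
    refine ⟨r • m, (χ.fam x).smul_mem r hm, ?_⟩
    rw [χ.val_smul, ← hs] at e
    rw [Subring.smul_def, smul_eq_mul]
    linear_combination r.1 * e - gen U.1 hη b * k * hr

end

end

/-! ### Twists, local isomorphism and the action of the Picard group -/

section

lemma IsLineBundle.of_iso {Y : Scheme.{u}} {L L' : Y.Modules} (hL : IsLineBundle L) (e : L' ≅ L) :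
    IsLineBundle L' := by
  intro x
  obtain ⟨U, hx, ⟨i⟩⟩ := hL x
  exact ⟨U, hx, ⟨(Scheme.Modules.restrictFunctor U.ι).mapIso e ≪≫ i⟩⟩

variable {X : Scheme.{u}} [IrreducibleSpace X]

lemma prin_inv_mul (w : X.functionFieldˣ) :
    prin X (w⁻¹ : X.functionFieldˣ) * prin X w = (1 : Family X) := by
  rw [prin_mul, Units.inv_mul, one_eq_prin]

/-- Where `ℓ` is generated by `w`, multiplication by `w` is the isomorphism. -/
lemma locallyIsomorphic_of_family {M ℓ : Family X} (hℓ : LocPrincipal ℓ) {F F' : X.Modules}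
    (e : F ≅ famSheaf M) (e' : F' ≅ famSheaf (M * ℓ)) : LocallyIsomorphic F F' := by
  intro x
  obtain ⟨U, hx, w, hw⟩ := hℓ x
  refine ⟨U, hx, ⟨(Scheme.Modules.restrictFunctor U.ι).mapIso (e ≪≫ famMulIso w M) ≪≫
    famRestrictIso U (fun x' hx' => ?_) ≪≫ (Scheme.Modules.restrictFunctor U.ι).mapIso e'.symm⟩⟩
  rw [Pi.mul_apply, Pi.mul_apply, mul_comm, hw x' hx']

section

variable (hC : CurveLike X)

include hC

/-- A twist of the ideal sheaf corresponds to the product with a locally principal family, up to one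
global unit of the function ring, which is absorbed into that family. -/
lemma IsTwistOfIdeal.iff_family {M : Family X} (hM : IsGood M) {F : X.Modules} (e : F ≅ famSheaf M)
    {Z : X.IdealSheafData} : IsTwistOfIdeal F Z ↔
      ∃ ℓ : Family X, LocPrincipal ℓ ∧ M = idealFam hC.genInjective Z * ℓ := by
  constructor
  · rintro ⟨G, hG, ⟨i⟩⟩
    obtain ⟨ℓ, hℓ, ⟨j⟩⟩ := hG.exists_fam hC.genInjective hC.isUnit_of_regular
    let e' : famSheaf M ≅ famSheaf (idealFam hC.genInjective Z * ℓ) :=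
      e.symm ≪≫ i ≪≫ tensorIso (idealModuleIso hC.genInjective Z) j ≪≫
        famTensorIso hℓ hC.genInjective.sectionsRegular
    obtain ⟨w, hw⟩ := exists_unit_of_iso hC.isUnit_of_regular hM.spread
      ((idealFam_spread hC.genInjective Z).mul hℓ.spread) (hM.mem_genericPoint 1) e'
    refine ⟨ℓ * prin X (w⁻¹ : X.functionFieldˣ), hℓ.mul (locPrincipal_prin _), ?_⟩
    rw [← mul_assoc, hw, mul_comm, ← mul_assoc, prin_inv_mul, one_mul]
  · rintro ⟨ℓ, hℓ, rfl⟩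
    exact ⟨famSheaf ℓ, hℓ.isLineBundle hC.genInjective, ⟨e ≪≫
      (tensorIso (idealModuleIso hC.genInjective Z) (Iso.refl _) ≪≫
        famTensorIso hℓ hC.genInjective.sectionsRegular).symm⟩⟩

/-- The passage from local to global. Near each point the isomorphism is multiplication by a unit,
and where both families are trivial this unit may be replaced by 1. The chosen units need not be
compatible: they differ from 1 at finitely many points only, so they generate a locally principal
family. -/
lemma exists_mul_eq_of_locallyIsomorphic {M M' : Family X} (hM : IsGood M) (hM' : IsGood M')
    {F F' : X.Modules} (e : F ≅ famSheaf M) (e' : F' ≅ famSheaf M') (h : LocallyIsomorphic F F') :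
    ∃ ℓ : Family X, LocPrincipal ℓ ∧ M' = M * ℓ := by
  obtain ⟨V, hV, hV1⟩ := hM.eq_one
  obtain ⟨V', hV', hV1'⟩ := hM'.eq_one
  have key : ∀ x, ∃ w : X.functionFieldˣ, (x ∈ V ⊓ V' → w = 1) ∧ M' x = (prin X w * M) x := by
    intro x
    by_cases hx : x ∈ V ⊓ V'
    · refine ⟨1, fun _ => rfl, ?_⟩
      rw [Units.val_one, ← one_eq_prin, one_mul, hV1 x hx.1, hV1' x hx.2]
    · obtain ⟨U, hxU, ⟨i⟩⟩ := h x
      obtain ⟨w, hw⟩ := exists_unit_of_restrictIso hC.isUnit_of_regular hM.spread hM'.spread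
        (hM.mem_genericPoint 1) (generic_mem hxU)
        (((Scheme.Modules.restrictFunctor U.ι).mapIso e).symm ≪≫ i ≪≫
          (Scheme.Modules.restrictFunctor U.ι).mapIso e')
      exact ⟨w, fun h => absurd h hx, hw x hxU⟩
  choose w hw1 hw using key
  have hη : genericPoint X ∈ V ⊓ V' := ⟨hV, hV'⟩
  refine ⟨fun x => prin X (w x) x, locPrincipal_of_finite hC (fun x => ⟨w x, rfl⟩) hη fun x hx => ?_, ?_⟩
  · rw [hw1 x hx, Units.val_one, one_eq_prin]
  · funext x
    rw [hw x, mul_comm]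
    rfl

/-- The tensor product of the sheaf of a family with a line bundle. -/
lemma exists_tensor_iso {L : X.Modules} (hL : IsLineBundle L) :
    ∃ ℓ : Family X, LocPrincipal ℓ ∧ Nonempty (L ≅ famSheaf ℓ) ∧ ∀ (M : Family X) (F : X.Modules)
      (_ : F ≅ famSheaf M), Nonempty (tensor F L ≅ famSheaf (M * ℓ)) := by
  obtain ⟨ℓ, hℓ, ⟨j⟩⟩ := hL.exists_fam hC.genInjective hC.isUnit_of_regular
  exact ⟨ℓ, hℓ, ⟨j⟩, fun M F e => ⟨tensorIso e j ≪≫ famTensorIso hℓ hC.genInjective.sectionsRegular⟩⟩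

lemma IsLineBundle.tensor {L L' : X.Modules} (hL : IsLineBundle L) (hL' : IsLineBundle L') :
    IsLineBundle (tensor L L') := by
  obtain ⟨ℓ, hℓ, ⟨e⟩⟩ := hL.exists_fam hC.genInjective hC.isUnit_of_regular
  obtain ⟨ℓ', hℓ', -, h⟩ := exists_tensor_iso hC hL'
  obtain ⟨i⟩ := h ℓ L e
  exact ((hℓ.mul hℓ').isLineBundle hC.genInjective).of_iso i

lemma IsGeneralizedLineBundle.tensor {F L : X.Modules} (hF : IsGeneralizedLineBundle F)
    (hL : IsLineBundle L) : IsGeneralizedLineBundle (tensor F L) ∧ LocallyIsomorphic F (tensor F L) := by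
  obtain ⟨M, hM, ⟨e⟩⟩ := hF.exists_fam hC
  obtain ⟨ℓ, hℓ, -, h⟩ := exists_tensor_iso hC hL
  obtain ⟨i⟩ := h M F e
  have hloc : LocallyIsomorphic F (GLB.tensor F L) := locallyIsomorphic_of_family hℓ e i
  have hg : IsGood (M * ℓ) := by
    obtain ⟨V, hV, hV1⟩ := hM.eq_one
    obtain ⟨V', hV', hV1'⟩ := hℓ.exists_eq_one
    refine ⟨hM.spread.mul hℓ.spread, fun x => ?_, V ⊓ V', ⟨hV, hV'⟩, fun x hx => ?_⟩
    · obtain ⟨U, hx, w, hw⟩ := hℓ x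
      rw [Pi.mul_apply, hw x hx]
      exact (hM.fg x).mul (Submodule.fg_span_singleton _)
    · rw [Pi.mul_apply, hV1 x hx.1, hV1' x hx.2, ← Pi.mul_apply, one_mul]
  exact ⟨hg.isGeneralizedLineBundle hF hC (hF.pure.coherent.of_locallyIsomorphic hloc) i, hloc⟩

lemma IsGeneralizedLineBundle.exists_locallyIsomorphic_iso {F F' : X.Modules}
    (hF : IsGeneralizedLineBundle F) (hF' : IsGeneralizedLineBundle F') (h : LocallyIsomorphic F F') :
    ∃ (M : Family X) (ℓ : Family X), IsGood M ∧ LocPrincipal ℓ ∧ Nonempty (F ≅ famSheaf M) ∧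
      Nonempty (F' ≅ famSheaf (M * ℓ)) := by
  obtain ⟨M, hM, ⟨e⟩⟩ := hF.exists_fam hC
  obtain ⟨M', hM', ⟨e'⟩⟩ := hF'.exists_fam hC
  obtain ⟨ℓ, hℓ, rfl⟩ := exists_mul_eq_of_locallyIsomorphic hC hM hM' e e' h
  exact ⟨M, ℓ, hM, hℓ, ⟨e⟩, ⟨e'⟩⟩

lemma IsGeneralizedLineBundle.tensor_mem {F F' L : X.Modules} (hF : IsGeneralizedLineBundle F)
    (hF' : IsGeneralizedLineBundle F' ∧ LocallyIsomorphic F F') (hL : IsLineBundle L) :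
    IsGeneralizedLineBundle (GLB.tensor F' L) ∧ LocallyIsomorphic F (GLB.tensor F' L) := by
  refine ⟨(hF'.1.tensor hC hL).1, ?_⟩
  obtain ⟨M, μ, -, hμ, ⟨e⟩, ⟨e'⟩⟩ := hF.exists_locallyIsomorphic_iso hC hF'.1 hF'.2
  obtain ⟨ℓ, hℓ, -, h⟩ := exists_tensor_iso hC hL
  obtain ⟨i⟩ := h _ _ e'
  rw [mul_assoc] at i
  exact locallyIsomorphic_of_family (hμ.mul hℓ) e i

lemma IsGeneralizedLineBundle.exists_tensor_iso {F F' : X.Modules} (hF : IsGeneralizedLineBundle F)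
    (hF' : IsGeneralizedLineBundle F') (h : LocallyIsomorphic F F') :
    ∃ E : X.Modules, IsLineBundle E ∧ Nonempty (F ≅ GLB.tensor F' E) := by
  obtain ⟨M, ℓ, -, hℓ, ⟨e⟩, ⟨e'⟩⟩ := hF.exists_locallyIsomorphic_iso hC hF' h
  obtain ⟨ℓ', hℓ', he⟩ := hℓ.exists_inv
  refine ⟨famSheaf ℓ', hℓ'.isLineBundle hC.genInjective, ⟨e ≪≫ eqToIso ?_ ≪≫
    (tensorIso e' (Iso.refl _) ≪≫ famTensorIso hℓ' hC.genInjective.sectionsRegular).symm⟩⟩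
  rw [mul_assoc, he, mul_one]

end

section Picard

variable (hC : CurveLike X)

/-- The class of the line bundle of a locally principal family. -/
def picOfFam {ℓ : Family X} (hℓ : LocPrincipal ℓ) : Pic X :=
  Pic.mk (famSheaf ℓ) (hℓ.isLineBundle hC.genInjective)

lemma exists_picOfFam_eq (p : Pic X) : ∃ (ℓ : Family X) (hℓ : LocPrincipal ℓ), p = picOfFam hC hℓ := by
  obtain ⟨⟨L, hL⟩, rfl⟩ := Quotient.exists_rep p
  obtain ⟨ℓ, hℓ, ⟨e⟩⟩ := hL.exists_fam hC.genInjective hC.isUnit_of_regular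
  exact ⟨ℓ, hℓ, Quotient.sound ⟨e⟩⟩

lemma picOfFam_congr {ℓ ℓ' : Family X} {hℓ : LocPrincipal ℓ} {hℓ' : LocPrincipal ℓ'} (h : ℓ = ℓ') :
    picOfFam hC hℓ = picOfFam hC hℓ' := by
  subst h; rfl

/-- The product of classes of line bundles. -/
def picMul : Pic X → Pic X → Pic X :=
  Quotient.map₂ (fun L L' => ⟨GLB.tensor L.1 L'.1, L.2.tensor hC L'.2⟩)
    (fun _ _ ⟨e⟩ _ _ ⟨e'⟩ => ⟨tensorIso e e'⟩)

lemma picMul_picOfFam {ℓ ℓ' : Family X} (hℓ : LocPrincipal ℓ) (hℓ' : LocPrincipal ℓ') :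
    picMul hC (picOfFam hC hℓ) (picOfFam hC hℓ') = picOfFam hC (hℓ.mul hℓ') :=
  Quotient.sound ⟨famTensorIso hℓ' hC.genInjective.sectionsRegular⟩

lemma exists_picMul_eq_one (p : Pic X) : ∃ q, picMul hC q p = picOfFam hC locPrincipal_one := by
  obtain ⟨ℓ, hℓ, rfl⟩ := exists_picOfFam_eq hC p
  obtain ⟨ℓ', hℓ', h⟩ := hℓ.exists_inv
  refine ⟨picOfFam hC hℓ', ?_⟩
  rw [picMul_picOfFam]
  exact picOfFam_congr hC (by rw [mul_comm, h])

/-- The Picard group. -/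
@[reducible]
def picCommGroup : CommGroup (Pic X) where
  mul := picMul hC
  one := picOfFam hC locPrincipal_one
  inv p := (exists_picMul_eq_one hC p).choose
  mul_assoc p q r := by
    obtain ⟨ℓ, hℓ, rfl⟩ := exists_picOfFam_eq hC p
    obtain ⟨ℓ', hℓ', rfl⟩ := exists_picOfFam_eq hC q
    obtain ⟨ℓ'', hℓ'', rfl⟩ := exists_picOfFam_eq hC r
    change picMul hC (picMul hC _ _) _ = picMul hC _ (picMul hC _ _)
    rw [picMul_picOfFam, picMul_picOfFam, picMul_picOfFam, picMul_picOfFam]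
    exact picOfFam_congr hC (mul_assoc _ _ _)
  one_mul p := by
    obtain ⟨ℓ, hℓ, rfl⟩ := exists_picOfFam_eq hC p
    exact (picMul_picOfFam hC _ _).trans (picOfFam_congr hC (one_mul _))
  mul_one p := by
    obtain ⟨ℓ, hℓ, rfl⟩ := exists_picOfFam_eq hC p
    exact (picMul_picOfFam hC _ _).trans (picOfFam_congr hC (mul_one _))
  inv_mul_cancel p := (exists_picMul_eq_one hC p).choose_spec
  mul_comm p q := by
    obtain ⟨ℓ, hℓ, rfl⟩ := exists_picOfFam_eq hC p
    obtain ⟨ℓ', hℓ', rfl⟩ := exists_picOfFam_eq hC q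
    change picMul hC _ _ = picMul hC _ _
    rw [picMul_picOfFam, picMul_picOfFam]
    exact picOfFam_congr hC (mul_comm _ _)

variable {F : X.Modules} (hF : IsGeneralizedLineBundle F)

/-- The action of the Picard group on the classes of generalized line bundles. -/
def locIsoSMul : Pic X → LocIsoClass F → LocIsoClass F :=
  Quotient.map₂ (fun L F' => ⟨GLB.tensor F'.1 L.1, hF.tensor_mem hC F'.2 L.2⟩)
    (fun _ _ ⟨e⟩ _ _ ⟨e'⟩ => ⟨tensorIso e' e⟩)

lemma locIsoSMul_mk {ℓ : Family X} (hℓ : LocPrincipal ℓ) {M : Family X} {F' F'' : X.Modules}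
    (hF' : IsGeneralizedLineBundle F' ∧ LocallyIsomorphic F F')
    (hF'' : IsGeneralizedLineBundle F'' ∧ LocallyIsomorphic F F'')
    (e' : F' ≅ famSheaf M) (e'' : F'' ≅ famSheaf (M * ℓ)) :
    locIsoSMul hC hF (picOfFam hC hℓ) (LocIsoClass.mk F' hF') = LocIsoClass.mk F'' hF'' :=
  Quotient.sound ⟨tensorIso e' (Iso.refl _) ≪≫
    famTensorIso hℓ hC.genInjective.sectionsRegular ≪≫ e''.symm⟩

lemma LocIsoClass.exists_mk_eq (c : LocIsoClass F) : ∃ (F' : X.Modules)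
    (hF' : IsGeneralizedLineBundle F' ∧ LocallyIsomorphic F F'), c = LocIsoClass.mk F' hF' := by
  obtain ⟨⟨F', hF'⟩, rfl⟩ := Quotient.exists_rep c
  exact ⟨F', hF', rfl⟩

/-- The action of the Picard group on the classes of generalized line bundles. -/
@[reducible]
def locIsoMulAction : @MulAction (Pic X) (LocIsoClass F) (picCommGroup hC).toMonoid :=
  letI := picCommGroup hC
  { smul := locIsoSMul hC hF
    one_smul := fun c => by
      obtain ⟨F', hF', rfl⟩ := c.exists_mk_eq
      obtain ⟨M, -, ⟨e⟩⟩ := hF'.1.exists_fam hC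
      exact locIsoSMul_mk hC hF locPrincipal_one hF' hF' e (e ≪≫ eqToIso (by rw [mul_one]))
    mul_smul := fun p q c => by
      obtain ⟨F', hF', rfl⟩ := c.exists_mk_eq
      obtain ⟨M, -, ⟨e⟩⟩ := hF'.1.exists_fam hC
      obtain ⟨ℓ, hℓ, rfl⟩ := exists_picOfFam_eq hC p
      obtain ⟨ℓ', hℓ', rfl⟩ := exists_picOfFam_eq hC q
      let i : GLB.tensor F' (famSheaf ℓ') ≅ famSheaf (M * ℓ') :=
        tensorIso e (Iso.refl _) ≪≫ famTensorIso hℓ' hC.genInjective.sectionsRegular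
      let j : GLB.tensor (GLB.tensor F' (famSheaf ℓ')) (famSheaf ℓ) ≅ famSheaf (M * ℓ' * ℓ) :=
        tensorIso i (Iso.refl _) ≪≫ famTensorIso hℓ hC.genInjective.sectionsRegular
      change locIsoSMul hC hF (picMul hC _ _) _ = locIsoSMul hC hF _ (locIsoSMul hC hF _ _)
      rw [picMul_picOfFam]
      refine (locIsoSMul_mk hC hF (hℓ.mul hℓ') hF' ?_ e (j ≪≫ eqToIso ?_)).trans rfl
      · exact hF.tensor_mem hC (hF.tensor_mem hC hF' (hℓ'.isLineBundle hC.genInjective))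
          (hℓ.isLineBundle hC.genInjective)
      · rw [mul_assoc, mul_comm ℓ'] }

end Picard

end

/-! ### Existence and uniqueness of the associated subscheme -/

section

variable {X : Scheme.{u}} [IrreducibleSpace X]

lemma idealFam_pow_le (hX : GenInjective X) {Z : X.IdealSheafData} {x : X} {y : X.functionField}
    (h : idealFam hX Z x = prin X y x) (j : ℕ) : idealFam hX (Z ^ j) x ≤ prin X (y ^ j) x := by
  induction j with
  | zero =>
    intro k hk
    rw [pow_zero]
    exact mem_prin_iff.mpr ⟨k, mem_localRing_of_mem_idealFam hX hk, (one_mul _).symm⟩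
  | succ j ih =>
    rw [pow_succ, idealFam_mul, pow_succ, ← prin_mul, Pi.mul_apply, Pi.mul_apply, h]
    exact mul_le_mul' ih le_rfl

lemma support_subset_of_idealFam_eq_one (hX : GenInjective X) {Z : X.IdealSheafData} {V : X.Opens}
    (h : ∀ x ∈ V, idealFam hX Z x = (1 : Family X) x) : (Z.support : Set X) ⊆ (V : Set X)ᶜ := by
  intro x hx hxV
  obtain ⟨U, hU, hxU, -⟩ := exists_isAffineOpen_mem_and_subset (U := ⊤) (x := x) trivial
  have h1 : (1 : X.functionField) ∈ idealFam hX Z x := by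
    rw [h x hxV, mem_one_iff]
    exact one_mem _
  obtain ⟨a, ha, b, hb, e⟩ := (mem_idealFam_iff_of_mem hX (U := ⟨U, hU⟩) hxU).mp h1
  rw [mul_one] at e
  obtain rfl := hX U (generic_mem hxU) e
  have h2 := (Scheme.IdealSheafData.mem_support_iff_of_mem (U := ⟨U, hU⟩) hxU).mp hx
  exact (Scheme.mem_zeroLocus_iff _ _ _).mp h2 b ha hb

lemma DifferByCartier.of_family (hX : CurveStalks X) (hC : CurveLike X) {Z Z' : X.IdealSheafData}
    {M ℓ ℓ' : Family X} (hℓ : LocPrincipal ℓ) (hℓ' : LocPrincipal ℓ')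
    (h : M = idealFam hX.genInjective Z * ℓ) (h' : M = idealFam hX.genInjective Z' * ℓ') :
    DifferByCartier Z Z' := by
  obtain ⟨μ, hμ, e⟩ := hℓ'.exists_inv
  refine (differByCartier_iff hX hC).mpr ⟨ℓ * μ, hℓ.mul hμ, ?_⟩
  rw [← mul_assoc, ← h, h', mul_assoc, e, mul_one]

/-- With `M` the family of `F`, both sides say that the ideal families of `Z` and `Z'` agree up to
an invertible factor. -/
lemma IsTwistOfIdeal.iff_differByCartier (hX : CurveStalks X) (hC : CurveLike X) {F : X.Modules}
    (hF : IsGeneralizedLineBundle F) {Z Z' : X.IdealSheafData} (h : IsTwistOfIdeal F Z) :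
    IsTwistOfIdeal F Z' ↔ DifferByCartier Z Z' := by
  obtain ⟨M, hM, ⟨e⟩⟩ := hF.exists_fam hC
  obtain ⟨ℓ, hℓ, h1⟩ := (IsTwistOfIdeal.iff_family hC hM e).mp h
  constructor
  · intro h'
    obtain ⟨ℓ', hℓ', h2⟩ := (IsTwistOfIdeal.iff_family hC hM e).mp h'
    exact .of_family hX hC hℓ hℓ' h1 h2
  · intro h'
    obtain ⟨μ, hμ, h2⟩ := (differByCartier_iff hX hC).mp h'
    obtain ⟨ν, hν, h3⟩ := hμ.exists_inv
    refine (IsTwistOfIdeal.iff_family hC hM e).mpr ⟨ν * ℓ, hν.mul hℓ, ?_⟩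
    rw [h2, h1, mul_assoc, ← mul_assoc μ, h3, one_mul]

lemma IsTwistOfIdeal.differByCartier_of_locallyIsomorphic (hX : CurveStalks X) (hC : CurveLike X)
    {F F' : X.Modules} (hF : IsGeneralizedLineBundle F) (hF' : IsGeneralizedLineBundle F')
    (hl : LocallyIsomorphic F F') {Z Z' : X.IdealSheafData} (h : IsTwistOfIdeal F Z)
    (h' : IsTwistOfIdeal F' Z') : DifferByCartier Z Z' := by
  obtain ⟨M, hM, ⟨e⟩⟩ := hF.exists_fam hC
  obtain ⟨M', hM', ⟨e'⟩⟩ := hF'.exists_fam hC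
  obtain ⟨μ, hμ, h0⟩ := exists_mul_eq_of_locallyIsomorphic hC hM hM' e e' hl
  obtain ⟨ℓ, hℓ, h1⟩ := (IsTwistOfIdeal.iff_family hC hM e).mp h
  obtain ⟨ℓ', hℓ', h2⟩ := (IsTwistOfIdeal.iff_family hC hM' e').mp h'
  exact .of_family hX hC (hℓ.mul hμ) hℓ' (by rw [h0, h1, mul_assoc]) h2

/-- A generalized line bundle has an associated subscheme. -/
lemma IsGeneralizedLineBundle.exists_isAssociatedSubscheme (hX : CurveStalks X) (hC : CurveLike X)
    {n : ℕ} (hn : IsLeast {k : ℕ | X.nilradical ^ k = ⊥} n)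
    (hp : ∀ x : X, ∃ U : X.affineOpens, x ∈ U.1 ∧ (X.nilradical.ideal U).IsPrincipal)
    {F : X.Modules} (hF : IsGeneralizedLineBundle F) :
    ∃ Z : X.IdealSheafData, IsAssociatedSubscheme n F Z := by
  obtain ⟨M, hM, ⟨e⟩⟩ := hF.exists_fam hC
  obtain ⟨χ, rfl⟩ := exists_ratEmb_of_iso hM.spread e
  obtain ⟨V, hV, hV1⟩ := hM.eq_one
  choose y hy hN using hX.exists_localData hn hp
  have hcoh := hF.pure.coherent
  -- The germ 1 at the generic point, multiplied by a denominator, is a section near `x` whose value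
  -- is a unit.
  have hunit : ∀ x, ∃ w : X.functionFieldˣ, (w : X.functionField) ∈ χ.fam x := by
    intro x
    obtain ⟨U, hU, hx, -⟩ := exists_isAffineOpen_mem_and_subset (U := ⊤) (x := x) trivial
    obtain ⟨s, w, hw⟩ := χ.exists_isUnit_val hcoh (hM.mem_genericPoint 1) (U := ⟨U, hU⟩) (generic_mem hx)
    exact ⟨w, U, hx, s, hw.symm⟩
  -- The normalizing unit is forced to be 1 on `V`, where the family is already trivial, so that
  -- only finitely many points are modified.
  have key : ∀ x, ∃ g : X.functionFieldˣ, (x ∈ V → g = 1) ∧ (∀ k ∈ χ.fam x, g * k ∈ localRing x) ∧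
      ∃ k ∈ χ.fam x, g * k = y x ^ (n - 1) := by
    intro x
    by_cases hx : x ∈ V
    · refine ⟨1, fun _ => rfl, fun k hk => ?_, y x ^ (n - 1), ?_, by rw [Units.val_one, one_mul]⟩
      · rw [hV1 x hx] at hk
        rw [Units.val_one, one_mul]
        exact mem_one_iff.mp hk
      · rw [hV1 x hx, mem_one_iff]
        refine pow_mem (mem_localRing_of_mem_idealFam hX.genInjective (Z := X.nilradical) ?_) _
        rw [hN]
        exact Submodule.mem_span_singleton_self _
    · obtain ⟨w, hw⟩ := hunit x
      obtain ⟨g, h1, h2⟩ := (hy x).exists_unit_mul (hM.fg x) w hw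
      exact ⟨g, fun h => absurd h hx, h1, h2⟩
  choose g hgV hg hg' using key
  have hprin : ∀ x ∈ V, prin X (g x) x = (1 : Family X) x := fun x hx => by
    rw [hgV x hx, Units.val_one, one_eq_prin]
  have hprin' : ∀ x ∈ V, prin X ((g x)⁻¹ : X.functionFieldˣ) x = (1 : Family X) x := fun x hx => by
    rw [hgV x hx, inv_one, Units.val_one, one_eq_prin]
  let I : Family X := fun x => (prin X (g x) * χ.fam) x
  have hIV : ∀ x ∈ V, I x = (1 : Family X) x := fun x hx => by
    change prin X (g x) x * χ.fam x = _
    rw [hprin x hx, hV1 x hx, ← Pi.mul_apply, one_mul]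
  have hI : IsIdealFamily I := by
    refine ⟨fun x k hk => ?_, fun x => ?_, V, hV, hIV⟩
    · obtain ⟨m, hm, rfl⟩ := mem_prin_mul.mp hk
      exact mem_one_iff.mpr (hg x m hm)
    · obtain ⟨w, hw⟩ := hunit x
      exact ⟨g x * w, mem_prin_mul.mpr ⟨w, hw, (Units.val_mul _ _).symm⟩⟩
  obtain ⟨Z, hZ⟩ := hI.exists_idealSheaf hX hC
  refine ⟨Z, (IsTwistOfIdeal.iff_family hC hM e).mpr ⟨fun x => prin X ((g x)⁻¹ : X.functionFieldˣ) x,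
    locPrincipal_of_finite hC (fun x => ⟨_, rfl⟩) hV hprin', ?_⟩, ?_, ?_, ?_⟩
  · rw [hZ]
    funext x
    change _ = prin X (g x) x * χ.fam x * prin X ((g x)⁻¹ : X.functionFieldˣ) x
    rw [mul_right_comm, ← Pi.mul_apply, prin_mul, Units.mul_inv, ← one_eq_prin, ← Pi.mul_apply, one_mul]
  · exact (hC.cofinite V hV).subset
      (support_subset_of_idealFam_eq_one hX.genInjective fun x hx => (congrFun hZ x).trans (hIV x hx))
  -- The condition that `y x ^ (n - 1)` lies in the normalized module puts the power `n - 1` of the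
  -- nilradical inside the ideal of `Z`.
  · refine (idealFam_le_iff hX.genInjective).mp fun x => (idealFam_pow_le _ (hN x) _).trans ?_
    rw [hZ]
    obtain ⟨k, hk, h⟩ := hg' x
    exact (Submodule.span_singleton_le_iff_mem _ _).mpr (mem_prin_mul.mpr ⟨k, hk, h⟩)
  · exact χ.isSupportOfTorsion hX.genInjective hcoh hn.1 (hM.mem_genericPoint 1) hy hN hg hg'
      fun x => congrFun hZ x

/-- Both classes are twists of `F`, by `ℓ₁` and `ℓ₂`, and the inverse of `ℓ₁` times `ℓ₂` carries one
to the other. -/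
lemma exists_locIsoSMul_eq (hC : CurveLike X) {F : X.Modules} (hF : IsGeneralizedLineBundle F)
    (c c' : LocIsoClass F) : ∃ p : Pic X, locIsoSMul hC hF p c = c' := by
  obtain ⟨F₁, h₁, rfl⟩ := c.exists_mk_eq
  obtain ⟨F₂, h₂, rfl⟩ := c'.exists_mk_eq
  obtain ⟨M, hM, ⟨e⟩⟩ := hF.exists_fam hC
  obtain ⟨M₁, hM₁, ⟨e₁⟩⟩ := h₁.1.exists_fam hC
  obtain ⟨M₂, hM₂, ⟨e₂⟩⟩ := h₂.1.exists_fam hC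
  obtain ⟨ℓ₁, hℓ₁, rfl⟩ := exists_mul_eq_of_locallyIsomorphic hC hM hM₁ e e₁ h₁.2
  obtain ⟨ℓ₂, hℓ₂, rfl⟩ := exists_mul_eq_of_locallyIsomorphic hC hM hM₂ e e₂ h₂.2
  obtain ⟨μ, hμ, h⟩ := hℓ₁.exists_inv
  refine ⟨picOfFam hC (hμ.mul hℓ₂), locIsoSMul_mk hC hF _ h₁ h₂ e₁ (e₂ ≪≫ eqToIso ?_)⟩
  rw [mul_assoc, ← mul_assoc ℓ₁, h, one_mul]

end

end GLB

end

theorem mainTheorem1 {K : Type u} [Field K] [IsAlgClosed K] (X : Scheme.{u}) [IrreducibleSpace X]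
    (f : X ⟶ Spec (CommRingCat.of K)) (n : ℕ) (hX : GLB.IsPrimitiveMultipleCurve K X f n) :
    -- existence of the associated subscheme, and its uniqueness up to adding a Cartier divisor
    (∀ F : X.Modules, GLB.IsGeneralizedLineBundle F →
      (∃ Z : X.IdealSheafData, GLB.IsAssociatedSubscheme n F Z) ∧
      ∀ Z Z' : X.IdealSheafData, GLB.IsAssociatedSubscheme n F Z →
        (GLB.IsTwistOfIdeal F Z' ↔ GLB.DifferByCartier Z Z')) ∧
    -- locally isomorphic generalized line bundles
    (∀ F F' : X.Modules, GLB.IsGeneralizedLineBundle F → GLB.IsGeneralizedLineBundle F' →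
      GLB.LocallyIsomorphic F F' →
      (∀ Z Z' : X.IdealSheafData, GLB.IsAssociatedSubscheme n F Z →
        GLB.IsAssociatedSubscheme n F' Z' → GLB.DifferByCartier Z Z') ∧
      ∃ E : X.Modules, GLB.IsLineBundle E ∧ Nonempty (F ≅ GLB.tensor F' E)) ∧
    -- the tensor product makes `Pic X` a group, which acts transitively on the set of isomorphism
    -- classes in each local isomorphism class
    ∃ _ : CommGroup (GLB.Pic X),
      (∀ (L L' : X.Modules) (hL : GLB.IsLineBundle L) (hL' : GLB.IsLineBundle L'),
        ∃ h : GLB.IsLineBundle (GLB.tensor L L'),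
          GLB.Pic.mk L hL * GLB.Pic.mk L' hL' = GLB.Pic.mk (GLB.tensor L L') h) ∧
      ∀ F : X.Modules, GLB.IsGeneralizedLineBundle F →
        ∃ _ : MulAction (GLB.Pic X) (GLB.LocIsoClass F),
          (∀ (L F' : X.Modules) (hL : GLB.IsLineBundle L)
            (hF' : GLB.IsGeneralizedLineBundle F' ∧ GLB.LocallyIsomorphic F F'),
            ∃ h : GLB.IsGeneralizedLineBundle (GLB.tensor F' L) ∧
                GLB.LocallyIsomorphic F (GLB.tensor F' L),
              GLB.Pic.mk L hL • GLB.LocIsoClass.mk (F := F) F' hF' =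
                GLB.LocIsoClass.mk (GLB.tensor F' L) h) ∧
          MulAction.IsPretransitive (GLB.Pic X) (GLB.LocIsoClass F) := by
  have := hX.compactSpace
  have hS := hX.curveStalks
  have hC := hS.curveLike
  refine ⟨fun F hF => ⟨hF.exists_isAssociatedSubscheme hS hC hX.multiplicity hX.locally_principal,
    fun Z Z' hZ => hZ.twist.iff_differByCartier hS hC hF⟩, fun F F' hF hF' h =>
    ⟨fun Z Z' hZ hZ' => hZ.twist.differByCartier_of_locallyIsomorphic hS hC hF hF' h hZ'.twist,
      hF.exists_tensor_iso hC hF' h⟩,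
    GLB.picCommGroup hC, fun L L' hL hL' => ⟨hL.tensor hC hL', rfl⟩, fun F hF =>
    ⟨GLB.locIsoMulAction hC hF, fun L F' hL hF' => ⟨hF.tensor_mem hC hF' hL, rfl⟩, ?_⟩⟩
  let _ := GLB.picCommGroup hC
  let _ := GLB.locIsoMulAction hC hF
  exact ⟨GLB.exists_locIsoSMul_eq hC hF⟩
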